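/- Let $d\ge 2$ and let $(M,\omega)$ be a compact smooth symplectic manifold of dimension $2d$, possibly with boundary, with a fixed Riemannian metric. Let $C^2(M,\mathbb{R})$ be the set of Hamiltonians, i.e. $C^2$ functions $H:M\to\mathbb{R}$ that are constant on each connected component of $\partial M$, with the $C^2$ topology. For a Hamiltonian $H$, let $X_H$ be its Hamiltonian vector field, $d_xH(u)=\omega(X_H(x),u)$, and $X_H^t$ its flow. A Hamiltonian level is a pair $(H,e)$ with $e\in H(M)$; the set of Hamiltonian levels, written $C^2(M,\mathbb{R})\times H(M)$, carries the subspace topology from $C^2(M,\mathbb{R})\times\mathbb{R}$. A Hamiltonian level $(H,e)$ is called Anosov if there is a connected component $\mathcal{E}$ of $H^{-1}(\{e\})$, contained in the interior of $M$ (no condition if $\partial M=\emptyset$), which is free of critical points of $H$ and hyperbolic for $X_H^t$: there are an integer $m\ge 1$, a constant $\theta\in(0,1)$ and a splitting $$T_x\mathcal{E}=\ker d_xH=E^-_x\oplus\mathbb{R}X_H(x)\oplus E^+_x\qquad (x\in\mathcal{E}),$$ with $DX_H^t(x)E^\pm_x=E^\pm_{X_H^t(x)}$ for all $t\in\mathbb{R}$,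 such that $\|DX_H^m(x)|_{E^-_x}\|\le\theta$ and $\|DX_H^{-m}(x)|_{E^+_x}\|\le\theta$ for all $x\in\mathcal{E}$. Then the set $\mathcal{A}^{2d}(M)$ of Anosov Hamiltonian levels is open in $C^2(M,\mathbb{R})\times H(M)$. Moreover, if $(H,e)$ is Anosov, then there are a $C^2$-neighbourhood $\mathcal{V}$ of $H$ and $\delta>0$ such that for every $\tilde H\in\mathcal{V}$ and every $\tilde e\in(e-\delta,e+\delta)$ one has $\tilde e\in\tilde H(M)$ and $(\tilde H,\tilde e)$ is Anosov. -/

import Mathlib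

open scoped Manifold ContDiff Topology Bundle

noncomputable section

namespace HamiltonianLevels

variable {E : Type*} [NormedAddCommGroup E] [NormedSpace ℝ E]
  {B : Type*} [TopologicalSpace B] (I : ModelWithCorners ℝ E B)
  (M : Type*) [TopologicalSpace M] [ChartedSpace B M]

/-- A Hamiltonian: a `C²` function `M → ℝ` that is constant on each connected component of the
boundary of `M`. -/
structure Hamiltonian where
  /-- the underlying function -/
  toFun : M → ℝ
  contMDiff' : ContMDiff I 𝓘(ℝ, ℝ) 2 toFun
  const_boundary' : ∀ x ∈ I.boundary M, ∀ y ∈ connectedComponentIn (I.boundary M) x,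
    toFun y = toFun x

instance : CoeFun (Hamiltonian I M) (fun _ => M → ℝ) := ⟨Hamiltonian.toFun⟩

variable {I M}

/-- The subbasic `C²`-neighbourhood of `H`: all Hamiltonians `G` such that, in the chart around
`x₀`, all derivatives of order at most `2` of `G - H` have norm less than `ε` on `K`. -/
def c2Nhd (H : Hamiltonian I M) (x₀ : M) (K : Set E) (ε : ℝ) : Set (Hamiltonian I M) :=
  {G | ∀ k : ℕ, k ≤ 2 → ∀ y ∈ K,
    ‖iteratedFDerivWithin ℝ k
      (fun z => G ((extChartAt I x₀).symm z) - H ((extChartAt I x₀).symm z)) (Set.range I) y‖ < ε}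

/-- The (Whitney) `C²` topology: it is generated by the sets `c2Nhd H x₀ K ε` with `K` a compact
subset of the domain of the coordinates around `x₀` and `ε > 0`. -/
instance c2Topology : TopologicalSpace (Hamiltonian I M) :=
  TopologicalSpace.generateFrom
    {S | ∃ (H : Hamiltonian I M) (x₀ : M) (K : Set E) (ε : ℝ),
      IsCompact K ∧ K ⊆ (extChartAt I x₀).target ∧ 0 < ε ∧ S = c2Nhd H x₀ K ε}

/-- The differential `d_x H`, as a linear form on `T_x M`. -/
def dHam (H : Hamiltonian I M) (x : M) : TangentSpace I x →L[ℝ] ℝ :=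
  (NormedSpace.fromTangentSpace (𝕜 := ℝ) (H x) :
    TangentSpace 𝓘(ℝ, ℝ) (H x) →L[ℝ] ℝ).comp (mfderiv I 𝓘(ℝ, ℝ) (H : M → ℝ) x)

/-- The vectors `u, v` of the model space, seen as constant vector fields in the coordinates around
`x₀`, inserted into a field of bilinear forms `σ`: this is the coefficient of `σ` in these
coordinates, as a function of the point `y` of the coordinate domain. -/
def coordForm (σ : ∀ x : M, TangentSpace I x →L[ℝ] TangentSpace I x →L[ℝ] ℝ) (x₀ : M) (u v y : E) :
    ℝ :=
  σ ((extChartAt I x₀).symm y)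
    (mfderivWithin 𝓘(ℝ, E) I (extChartAt I x₀).symm (Set.range I) y u)
    (mfderivWithin 𝓘(ℝ, E) I (extChartAt I x₀).symm (Set.range I) y v)

variable (I M) in
/-- A symplectic form on `M`: a smooth, skew-symmetric, nondegenerate and closed 2-form. -/
structure SymplecticForm [IsManifold I ∞ M] where
  /-- the bilinear form on each tangent space -/
  form (x : M) : TangentSpace I x →L[ℝ] TangentSpace I x →L[ℝ] ℝ
  skew (x : M) (v w : TangentSpace I x) : form x v w = -form x w v
  nondeg (x : M) (v : TangentSpace I x) : (∀ w, form x v w = 0) → v = 0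
  contMDiff : ContMDiff I (I.prod 𝓘(ℝ, E →L[ℝ] E →L[ℝ] ℝ)) ∞
    (fun x ↦ Bundle.TotalSpace.mk' (E →L[ℝ] E →L[ℝ] ℝ)
      (E := fun x : M ↦ TangentSpace I x →L[ℝ] TangentSpace I x →L[ℝ] ℝ) x (form x))
  /-- `dσ = 0`, in coordinates -/
  closed (x₀ : M) (y : E) (hy : y ∈ (extChartAt I x₀).target) (u v w : E) :
    fderivWithin ℝ (coordForm form x₀ v w) (Set.range I) y u
      + fderivWithin ℝ (coordForm form x₀ w u) (Set.range I) y v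
      + fderivWithin ℝ (coordForm form x₀ u v) (Set.range I) y w = 0

section

variable [FiniteDimensional ℝ E] [IsManifold I ∞ M]

instance (x : M) : FiniteDimensional ℝ (TangentSpace I x) :=
  inferInstanceAs (FiniteDimensional ℝ E)

/-- The isomorphism `v ↦ σ(v, ·)` from the tangent space to its dual. -/
def SymplecticForm.flat (σ : SymplecticForm I M) (x : M) :
    TangentSpace I x ≃ₗ[ℝ] Module.Dual ℝ (TangentSpace I x) :=
  LinearMap.linearEquivOfInjective
    { toFun := fun v => (σ.form x v : TangentSpace I x →ₗ[ℝ] ℝ)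
      map_add' := fun v w => by ext u; simp
      map_smul' := fun c v => by ext u; simp }
    ((injective_iff_map_eq_zero _).2 fun v hv =>
      σ.nondeg x v fun w => by simpa using LinearMap.congr_fun hv w)
    (Subspace.dual_finrank_eq).symm

/-- The Hamiltonian vector field `X_H`, given by `d_x H (u) = σ (X_H x, u)`. -/
def hamVF (σ : SymplecticForm I M) (H : Hamiltonian I M) (x : M) : TangentSpace I x :=
  (σ.flat x).symm (dHam H x : TangentSpace I x →ₗ[ℝ] ℝ)

theorem form_hamVF (σ : SymplecticForm I M) (H : Hamiltonian I M) (x : M) (u : TangentSpace I x) :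
    σ.form x (hamVF σ H x) u = dHam H x u := by
  have h := (σ.flat x).apply_symm_apply (dHam H x : TangentSpace I x →ₗ[ℝ] ℝ)
  exact LinearMap.congr_fun h u

open Classical in
/-- The Hamiltonian flow: `hamFlow σ H t x` is the point at time `t` of the integral curve of `X_H`
that starts at `x`. (Where there is no complete integral curve, the value is irrelevant.) -/
def hamFlow (σ : SymplecticForm I M) (H : Hamiltonian I M) (t : ℝ) (x : M) : M :=
  if h : ∃ γ : ℝ → M, γ 0 = x ∧ IsMIntegralCurve (I := I) γ (hamVF σ H) then h.choose t else x

/-- The tangent flow `D_x X_H^t : T_x M → T_{X_H^t x} M`. -/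
def tangentFlow (σ : SymplecticForm I M) (H : Hamiltonian I M) (t : ℝ) (x : M) :
    TangentSpace I x →L[ℝ] TangentSpace I (hamFlow σ H t x) :=
  mfderiv I I (hamFlow σ H t) x

/-- The norm of a tangent vector for the Riemannian metric `g`. -/
def gNorm (g : Bundle.ContMDiffRiemannianMetric I ∞ E (TangentSpace I : M → Type _)) {x : M}
    (v : TangentSpace I x) : ℝ :=
  √(g.inner x v v)

/-- The compact flow-invariant set `Λ`, contained in an energy level and free of critical points, is
hyperbolic for the Hamiltonian flow: there is a splitting
`ker d_x H = E⁻ ⊕ ℝ X_H ⊕ E⁺` (`x ∈ Λ`) of the tangent space of the energy level, invariant under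
the tangent flow, such that `E⁻` is uniformly contracted by time `m` and `E⁺` by time `-m`. -/
def IsHyperbolicSet (σ : SymplecticForm I M)
    (g : Bundle.ContMDiffRiemannianMetric I ∞ E (TangentSpace I : M → Type _))
    (H : Hamiltonian I M) (Λ : Set M) : Prop :=
  IsCompact Λ ∧ (∀ t : ℝ, hamFlow σ H t '' Λ = Λ) ∧ (∀ x ∈ Λ, dHam H x ≠ 0) ∧
  ∃ (m : ℕ) (θ : ℝ) (Em Ep : ∀ x : M, Submodule ℝ (TangentSpace I x)),
    0 < m ∧ 0 < θ ∧ θ < 1 ∧ ∀ x ∈ Λ,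
      iSupIndep ![Em x, Submodule.span ℝ {hamVF σ H x}, Ep x] ∧
      Em x ⊔ Submodule.span ℝ {hamVF σ H x} ⊔ Ep x
        = LinearMap.ker (dHam H x : TangentSpace I x →ₗ[ℝ] ℝ) ∧
      (∀ t : ℝ,
        (Em x).map (tangentFlow σ H t x : TangentSpace I x →ₗ[ℝ] TangentSpace I (hamFlow σ H t x))
          = Em (hamFlow σ H t x) ∧
        (Ep x).map (tangentFlow σ H t x : TangentSpace I x →ₗ[ℝ] TangentSpace I (hamFlow σ H t x))
          = Ep (hamFlow σ H t x)) ∧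
      (∀ v ∈ Em x, gNorm g (tangentFlow σ H (m : ℝ) x v) ≤ θ * gNorm g v) ∧
      (∀ v ∈ Ep x, gNorm g (tangentFlow σ H (-(m : ℝ)) x v) ≤ θ * gNorm g v)

/-- The energy surface through `x`: the connected component of `x` in its energy level. -/
def energySurface (H : Hamiltonian I M) (x : M) : Set M :=
  connectedComponentIn {y : M | H y = H x} x

variable (I M) in
/-- A Hamiltonian level: a pair of a Hamiltonian `H` and an energy `e ∈ H(M)`. It carries the
subspace topology of the product of the `C²` topology and the usual topology of `ℝ`. -/
abbrev HamiltonianLevel : Type _ :=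
  {p : Hamiltonian I M × ℝ // p.2 ∈ Set.range (p.1 : M → ℝ)}

/-- The pair `(H, e)` is Anosov: some energy surface of energy `e`, lying in the
interior of `M` (automatic when `M` has no boundary), is hyperbolic for the Hamiltonian flow. -/
def IsAnosov (σ : SymplecticForm I M)
    (g : Bundle.ContMDiffRiemannianMetric I ∞ E (TangentSpace I : M → Type _))
    (H : Hamiltonian I M) (e : ℝ) : Prop :=
  ∃ x : M, H x = e ∧ energySurface H x ⊆ I.interior M ∧
    IsHyperbolicSet σ g H (energySurface H x)

/-- The set of Anosov Hamiltonian levels. -/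
def anosovLevels (σ : SymplecticForm I M)
    (g : Bundle.ContMDiffRiemannianMetric I ∞ E (TangentSpace I : M → Type _)) :
    Set (HamiltonianLevel I M) :=
  {p | IsAnosov σ g p.1.1 p.1.2}

end

end HamiltonianLevels

end

/-!
Throughout, `X` is the Hamiltonian vector field, `φ` its flow, `D` the tangent flow, `N` the Riemannian
norm, and `p v` is the norm of the component of `v` orthogonal to `X`. On an energy surface without
critical points `p` is comparable to the quotient norm modulo `X`, and the tangent flow acts on
`ker dH / ℝ X` because it preserves both `dH` and `X`.

The proof characterises hyperbolicity by a condition that involves a single finite time and no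
splitting. Consider, for a time `T > 0` and a factor `k > 1`, the condition
`k * p w ≤ max (p (D T w)) (p (D (-T) w))` for all `w ∈ ker dH`.

* A hyperbolic energy surface satisfies it with `k = 3` for some `T`
  (`IsEnergyCocycle.exists_expansion`): modulo `X`, a vector has stable and unstable components, one
  of which is comparable to the vector, and this one is expanded in the past or in the future.
* Conversely, if the condition holds with `k = 2` on the whole surface, the surface is hyperbolic
  (`IsEnergyCocycle.exists_hyperbolic_splitting`). The sequence `n ↦ p (D (n * T) v)` satisfies
  `2 * b (n + 1) ≤ max (b n) (b (n + 2))`, so it either halves at every step or eventually doubles at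
  every step. The vectors of the first kind form a subspace that contains `X`; it is the direct sum
  of `ℝ X` and the vectors that tend to `0`, and these are contracted uniformly. The same holds in the
  past. It remains to see that the two subspaces span `ker dH`, and this is where the symplectic form
  enters (`IsEnergyCocycle.le_finrank_boundedSub`): on a complement of the first subspace the tangent
  flow expands by arbitrarily large factors while it preserves `ω`, so the images of the complement
  together with `X` are almost isotropic, hence of dimension at most `d`. Both subspaces therefore
  have dimension at least `d`, and they meet in `ℝ X` only.

The passage from the factor `3` to the factor `2` leaves room for a perturbation. The condition at a
point is open in the Hamiltonian and in the point (`eventually_expandsTransversally`), since the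
tangent flow at time `T` depends continuously on the Hamiltonian and on the tangent vector
(`continuousAt_flowMap`). The latter is a local statement about solutions of a `C¹` differential
equation and of its variational equation, obtained from Grönwall's inequality
(`IsLocalFlow.hasFDerivAt`, `IsLocalFlow.tendsto`), and it extends to all times by the group law; the
`C²` topology on Hamiltonians is what makes the vector fields `C¹` close in charts
(`tendstoUniformlyOn_coordVF_and_fderiv`).

Energy surfaces are upper semicontinuous: the energy surface of a nearby Hamiltonian through a nearby
point stays in any given neighbourhood of the original compact energy surface
(`eventually_energySurface_subset`). Since `H` has no critical point there, every energy close to `e`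
is attained by every nearby Hamiltonian near the surface (`exists_eventually_exists_eq`). By the tube
lemma, a nearby Hamiltonian then satisfies the condition with factor `2` on a whole component of the
nearby energy level, which is thus hyperbolic (`IsAnosov.exists_nhds`).
-/


noncomputable section

namespace HamiltonianLevels

/-! ### Local flows of `C¹` vector fields and their derivatives -/

section LocalFlow

open Set Metric

variable {E : Type*} [NormedAddCommGroup E] [NormedSpace ℝ E]

/-- The constant in the two-sided Grönwall inequality `norm_le_gronwallConst`. -/
def gronwallConst (K τ : ℝ) : ℝ := Real.exp (K * τ) * (1 + K⁻¹)

theorem gronwallConst_nonneg {K τ : ℝ} (hK : 0 < K) : 0 ≤ gronwallConst K τ := by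
  unfold gronwallConst; positivity

/-- Grönwall's inequality on the symmetric interval `[-τ, τ]`, with initial condition at `0`. -/
theorem norm_le_gronwallConst {G : Type*} [NormedAddCommGroup G] [NormedSpace ℝ G]
    {f f' : ℝ → G} {K τ δ ε : ℝ} (hK : 0 < K) (hδ : 0 ≤ δ) (hε : 0 ≤ ε)
    (hf : ∀ t ∈ Icc (-τ) τ, HasDerivWithinAt f (f' t) (Icc (-τ) τ) t)
    (h0 : ‖f 0‖ ≤ δ) (hb : ∀ t ∈ Icc (-τ) τ, ‖f' t‖ ≤ K * ‖f t‖ + ε) :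
    ∀ t ∈ Icc (-τ) τ, ‖f t‖ ≤ gronwallConst K τ * (δ + ε) := by
  have key : ∀ g g' : ℝ → G, (∀ t ∈ Icc (-τ) τ, HasDerivWithinAt g (g' t) (Icc (-τ) τ) t) →
      ‖g 0‖ ≤ δ → (∀ t ∈ Icc (-τ) τ, ‖g' t‖ ≤ K * ‖g t‖ + ε) →
      ∀ t ∈ Icc 0 τ, ‖g t‖ ≤ gronwallConst K τ * (δ + ε) := by
    intro g g' hg hg0 hgb t ht
    have hsub : Icc 0 τ ⊆ Icc (-τ) τ := fun s hs => ⟨by linarith [hs.1, hs.2], hs.2⟩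
    have := norm_le_gronwallBound_of_norm_deriv_right_le (f := g) (f' := g') (δ := δ) (K := K)
      (ε := ε) (a := 0) (b := τ) (fun s hs => ((hg s (hsub hs)).continuousWithinAt.mono hsub))
      (fun s hs => (hg s (hsub (Ico_subset_Icc_self hs))).mono_of_mem_nhdsWithin
        (by
          refine mem_nhdsWithin.2 ⟨Iio τ, isOpen_Iio, hs.2, fun u hu => ⟨?_, hu.1.le⟩⟩
          have := hu.2
          simp only [mem_Ici] at this
          linarith [hs.1, hs.2]))
      hg0 (fun s hs => hgb s (hsub (Ico_subset_Icc_self hs))) t ht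
    refine this.trans ?_
    rw [sub_zero, gronwallBound_of_K_ne_0 hK.ne']
    have h1 : Real.exp (K * t) ≤ Real.exp (K * τ) :=
      Real.exp_le_exp.2 (mul_le_mul_of_nonneg_left ht.2 hK.le)
    have h2 : 0 ≤ K⁻¹ := (inv_pos.2 hK).le
    have h3 : 0 ≤ Real.exp (K * τ) := (Real.exp_pos _).le
    have h4 : δ * Real.exp (K * t) ≤ δ * Real.exp (K * τ) := mul_le_mul_of_nonneg_left h1 hδ
    have h5 : ε / K * (Real.exp (K * t) - 1) ≤ ε * K⁻¹ * Real.exp (K * τ) := by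
      rw [div_eq_mul_inv]
      exact mul_le_mul_of_nonneg_left (by linarith) (by positivity)
    have h6 : 0 ≤ Real.exp (K * τ) * K⁻¹ * δ := by positivity
    have h7 : 0 ≤ Real.exp (K * τ) * ε := by positivity
    unfold gronwallConst
    nlinarith
  intro t ht
  rcases le_total 0 t with h | h
  · exact key f f' hf h0 hb t ⟨h, ht.2⟩
  · have hm : MapsTo Neg.neg (Icc (-τ) τ) (Icc (-τ) τ) :=
      fun s hs => ⟨by linarith [hs.2], by linarith [hs.1]⟩
    have := key (fun s => f (-s)) (fun s => -f' (-s)) (fun s hs => by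
        have := (hf (-s) (hm hs)).scomp s ((hasDerivAt_neg s).hasDerivWithinAt) hm
        simpa using! this) (by simpa using h0)
      (fun s hs => by simpa using hb (-s) (hm hs)) (-t) ⟨by linarith, by linarith [ht.1]⟩
    simpa using this

/-- Quantitative data for a `C¹` vector field `F` with derivative `DF` on the closed ball of radius
`R` around `y₀`: bounds `L` and `K` for `F` and `DF`, and a time `τ` so short that solutions
starting in the ball of radius `R / 2` do not leave the ball and that the variational equation
stays bounded. -/
structure IsFlowBox (F : E → E) (DF : E → E →L[ℝ] E) (y₀ : E) (R τ L K : ℝ) : Prop where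
  R_pos : 0 < R
  τ_pos : 0 < τ
  K_pos : 0 < K
  hasFDerivAt : ∀ y ∈ closedBall y₀ R, HasFDerivAt F (DF y) y
  continuousOn : ContinuousOn DF (closedBall y₀ R)
  norm_le : ∀ y ∈ closedBall y₀ R, ‖F y‖ ≤ L
  norm_deriv_le : ∀ y ∈ closedBall y₀ R, ‖DF y‖ ≤ K
  L_mul_le : L * τ ≤ R / 2
  K_mul_le : 2 * K * τ ≤ 1

/-- `ψ y` is the solution of `ẏ = F y` starting at `y`, and `D y` the solution of the variational
equation along it, for times in `[-τ, τ]` and `y` in the ball of radius `R / 2`. -/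
structure IsLocalFlow (F : E → E) (DF : E → E →L[ℝ] E) (y₀ : E) (R τ : ℝ)
    (ψ : E → ℝ → E) (D : E → ℝ → E →L[ℝ] E) : Prop where
  zero : ∀ y ∈ closedBall y₀ (R / 2), ψ y 0 = y
  mem : ∀ y ∈ closedBall y₀ (R / 2), ∀ t ∈ Icc (-τ) τ, ψ y t ∈ closedBall y₀ R
  deriv : ∀ y ∈ closedBall y₀ (R / 2), ∀ t ∈ Icc (-τ) τ,
    HasDerivWithinAt (ψ y) (F (ψ y t)) (Icc (-τ) τ) t
  D_zero : ∀ y ∈ closedBall y₀ (R / 2), D y 0 = ContinuousLinearMap.id ℝ E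
  D_norm_le : ∀ y ∈ closedBall y₀ (R / 2), ∀ t ∈ Icc (-τ) τ, ‖D y t‖ ≤ 2
  D_deriv : ∀ y ∈ closedBall y₀ (R / 2), ∀ t ∈ Icc (-τ) τ,
    HasDerivWithinAt (D y) ((DF (ψ y t)).comp (D y t)) (Icc (-τ) τ) t

/-- The Picard-Lindelöf theorem, with the information that the solution stays in the ball. -/
theorem exists_solution_mem_closedBall {G : Type*} [NormedAddCommGroup G] [NormedSpace ℝ G]
    [CompleteSpace G] {f : ℝ → G → G} {tmin tmax : ℝ} {t₀ : Icc tmin tmax} {x₀ x : G}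
    {a r L K : NNReal} (hf : IsPicardLindelof f t₀ x₀ a r L K) (hx : x ∈ closedBall x₀ r) :
    ∃ α : ℝ → G, α t₀ = x ∧ (∀ t, α t ∈ closedBall x₀ a) ∧
      ∀ t ∈ Icc tmin tmax, HasDerivWithinAt α (f t (α t)) (Icc tmin tmax) t := by
  obtain ⟨α, hα⟩ := ODE.FunSpace.exists_isFixedPt_next hf hx
  refine ⟨α.compProj, by rw [ODE.FunSpace.compProj_val, ← hα, ODE.FunSpace.next_apply₀],
    fun t => α.compProj_mem_closedBall hf.mul_max_le, fun t ht ↦ ?_⟩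
  apply ODE.hasDerivWithinAt_picard_Icc t₀.2 hf.continuousOn_uncurry
    α.continuous_compProj.continuousOn (fun _ ht' ↦ α.compProj_mem_closedBall hf.mul_max_le)
    x ht |>.congr_of_mem _ ht
  intro t' ht'
  nth_rw 1 [← hα]
  rw [ODE.FunSpace.compProj_of_mem ht', ODE.FunSpace.next_apply]

section

variable {F : E → E} {DF : E → E →L[ℝ] E} {y₀ : E} {R τ L K : ℝ}

theorem IsFlowBox.dist_le (h : IsFlowBox F DF y₀ R τ L K) {y z : E} (hy : y ∈ closedBall y₀ R)
    (hz : z ∈ closedBall y₀ R) : ‖F z - F y‖ ≤ K * ‖z - y‖ :=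
  (convex_closedBall y₀ R).norm_image_sub_le_of_norm_hasFDerivWithin_le
    (fun w hw => (h.hasFDerivAt w hw).hasFDerivWithinAt) h.norm_deriv_le hy hz

/-- Both the equation and its variational equation are solved by the Picard–Lindelöf theorem; the
bounds on `τ` make the time interval short enough for either of them. -/
theorem IsFlowBox.exists_isLocalFlow [CompleteSpace E] (h : IsFlowBox F DF y₀ R τ L K) :
    ∃ ψ D, IsLocalFlow F DF y₀ R τ ψ D := by
  have hR := h.R_pos
  have hτ := h.τ_pos
  have hK := h.K_pos
  have h0 : (0 : ℝ) ∈ Icc (-τ) τ := ⟨by linarith, hτ.le⟩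
  have hL : 0 ≤ L := (norm_nonneg _).trans (h.norm_le y₀ (mem_closedBall_self hR.le))
  have hPL : IsPicardLindelof (fun _ => F) (tmin := -τ) (tmax := τ) ⟨0, h0⟩ y₀ ⟨R, hR.le⟩
      ⟨R / 2, by positivity⟩ ⟨L, hL⟩ ⟨K, hK.le⟩ := by
    refine IsPicardLindelof.of_time_independent (fun y hy => h.norm_le y hy) ?_ ?_
    · refine LipschitzOnWith.of_dist_le_mul fun y hy z hz => ?_
      rw [dist_eq_norm, dist_eq_norm]
      exact h.dist_le hz hy
    · have := h.L_mul_le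
      simp only [sub_zero, zero_sub, neg_neg, max_self]
      change L * τ ≤ R - R / 2
      linarith
  have hex : ∀ y, ∃ α : ℝ → E, y ∈ closedBall y₀ (R / 2) → α 0 = y ∧
      (∀ t, α t ∈ closedBall y₀ R) ∧
      ∀ t ∈ Icc (-τ) τ, HasDerivWithinAt α (F (α t)) (Icc (-τ) τ) t := by
    intro y
    by_cases hy : y ∈ closedBall y₀ (R / 2)
    · obtain ⟨α, hα⟩ := exists_solution_mem_closedBall hPL hy
      exact ⟨α, fun _ => hα⟩
    · exact ⟨0, fun hy' => absurd hy' hy⟩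
  choose ψ hψ using hex
  have hexD : ∀ y, ∃ A : ℝ → E →L[ℝ] E, y ∈ closedBall y₀ (R / 2) →
      A 0 = ContinuousLinearMap.id ℝ E ∧
      (∀ t, A t ∈ closedBall (ContinuousLinearMap.id ℝ E) 1) ∧
      ∀ t ∈ Icc (-τ) τ, HasDerivWithinAt A ((DF (ψ y t)).comp (A t)) (Icc (-τ) τ) t := by
    intro y
    by_cases hy : y ∈ closedBall y₀ (R / 2)
    · have hPL' : IsPicardLindelof (fun t (A : E →L[ℝ] E) => (DF (ψ y t)).comp A)
          (tmin := -τ) (tmax := τ) ⟨0, h0⟩ (ContinuousLinearMap.id ℝ E) 1 0 ⟨2 * K, by positivity⟩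
          ⟨K, hK.le⟩ := by
        have hbd : ∀ t, ‖DF (ψ y t)‖ ≤ K := fun t => h.norm_deriv_le _ ((hψ y hy).2.1 t)
        refine ⟨fun t ht => ?_, fun A hA => ?_, fun t ht A hA => ?_, ?_⟩
        · refine LipschitzOnWith.of_dist_le_mul fun A _ B _ => ?_
          rw [dist_eq_norm, dist_eq_norm, ← ContinuousLinearMap.comp_sub]
          exact (ContinuousLinearMap.opNorm_comp_le _ _).trans
            (mul_le_mul_of_nonneg_right (hbd t) (norm_nonneg _))
        · have hc : ContinuousOn (fun t => DF (ψ y t)) (Icc (-τ) τ) :=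
            h.continuousOn.comp (fun t ht => ((hψ y hy).2.2 t ht).continuousWithinAt)
              (fun t _ => (hψ y hy).2.1 t)
          exact hc.clm_comp continuousOn_const
        · have hA2 : ‖A‖ ≤ 2 := by
            have h1 : ‖A - ContinuousLinearMap.id ℝ E‖ ≤ 1 := by
              simpa [dist_eq_norm] using hA
            have h2 := ContinuousLinearMap.norm_id_le (𝕜 := ℝ) (E := E)
            have h3 := norm_add_le (A - ContinuousLinearMap.id ℝ E) (ContinuousLinearMap.id ℝ E)
            rw [sub_add_cancel] at h3
            linarith
          refine (ContinuousLinearMap.opNorm_comp_le _ _).trans ?_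
          have := mul_le_mul (hbd t) hA2 (norm_nonneg _) hK.le
          change _ ≤ 2 * K
          linarith
        · simp only [sub_zero, zero_sub, neg_neg, max_self, NNReal.coe_one, NNReal.coe_zero]
          exact h.K_mul_le
      obtain ⟨A, hA⟩ := exists_solution_mem_closedBall hPL' (mem_closedBall_self le_rfl)
      exact ⟨A, fun _ => hA⟩
    · exact ⟨0, fun hy' => absurd hy' hy⟩
  choose D hD using hexD
  refine ⟨ψ, D, fun y hy => (hψ y hy).1, fun y hy t _ => (hψ y hy).2.1 t,
    fun y hy => (hψ y hy).2.2, fun y hy => (hD y hy).1, fun y hy t _ => ?_,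
    fun y hy => (hD y hy).2.2⟩
  have h1 : ‖D y t - ContinuousLinearMap.id ℝ E‖ ≤ 1 := by
    simpa [dist_eq_norm] using (hD y hy).2.1 t
  have h2 := ContinuousLinearMap.norm_id_le (𝕜 := ℝ) (E := E)
  have h3 := norm_add_le (D y t - ContinuousLinearMap.id ℝ E) (ContinuousLinearMap.id ℝ E)
  rw [sub_add_cancel] at h3
  linarith

variable {ψ : E → ℝ → E} {D : E → ℝ → E →L[ℝ] E}

/-- Dependence of solutions on the initial point and on the vector field. -/
theorem IsLocalFlow.dist_le (h : IsFlowBox F DF y₀ R τ L K) (hψ : IsLocalFlow F DF y₀ R τ ψ D)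
    {F' : E → E} {DF' : E → E →L[ℝ] E} {ψ' : E → ℝ → E} {D' : E → ℝ → E →L[ℝ] E}
    (hψ' : IsLocalFlow F' DF' y₀ R τ ψ' D') {ε : ℝ}
    (hε : ∀ y ∈ closedBall y₀ R, ‖F' y - F y‖ ≤ ε) {y z : E} (hy : y ∈ closedBall y₀ (R / 2))
    (hz : z ∈ closedBall y₀ (R / 2)) :
    ∀ t ∈ Icc (-τ) τ, ‖ψ' z t - ψ y t‖ ≤ gronwallConst K τ * (‖z - y‖ + ε) := by
  have hε0 : 0 ≤ ε := (norm_nonneg _).trans (hε y₀ (mem_closedBall_self h.R_pos.le))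
  refine norm_le_gronwallConst (f' := fun t => F' (ψ' z t) - F (ψ y t)) h.K_pos (norm_nonneg _) hε0
    (fun t ht => (hψ'.deriv z hz t ht).sub (hψ.deriv y hy t ht)) ?_ ?_
  · rw [hψ.zero y hy, hψ'.zero z hz]
  · intro t ht
    have h1 := hε _ (hψ'.mem z hz t ht)
    have h2 := h.dist_le (hψ.mem y hy t ht) (hψ'.mem z hz t ht)
    have h3 := norm_add_le (F' (ψ' z t) - F (ψ' z t)) (F (ψ' z t) - F (ψ y t))
    rw [sub_add_sub_cancel] at h3
    linarith

/-- Dependence of the solutions of the variational equation on the vector field. -/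
theorem IsLocalFlow.norm_D_sub_le (h : IsFlowBox F DF y₀ R τ L K)
    (hψ : IsLocalFlow F DF y₀ R τ ψ D)
    {F' : E → E} {DF' : E → E →L[ℝ] E} {ψ' : E → ℝ → E} {D' : E → ℝ → E →L[ℝ] E}
    (hψ' : IsLocalFlow F' DF' y₀ R τ ψ' D') {ε : ℝ} {y z : E} (hy : y ∈ closedBall y₀ (R / 2))
    (hz : z ∈ closedBall y₀ (R / 2))
    (hε : ∀ t ∈ Icc (-τ) τ, ‖DF' (ψ' z t) - DF (ψ y t)‖ ≤ ε) :
    ∀ t ∈ Icc (-τ) τ, ‖D' z t - D y t‖ ≤ gronwallConst K τ * (2 * ε) := by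
  have h0 : (0 : ℝ) ∈ Icc (-τ) τ := ⟨by linarith [h.τ_pos], h.τ_pos.le⟩
  have hε0 : 0 ≤ ε := (norm_nonneg _).trans (hε 0 h0)
  have := norm_le_gronwallConst (f := fun t => D' z t - D y t)
    (f' := fun t => (DF' (ψ' z t)).comp (D' z t) - (DF (ψ y t)).comp (D y t))
    (ε := 2 * ε) h.K_pos le_rfl (by positivity)
    (fun t ht => (hψ'.D_deriv z hz t ht).sub (hψ.D_deriv y hy t ht))
    (by rw [hψ.D_zero y hy, hψ'.D_zero z hz]; simp) ?_
  · intro t ht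
    simpa using this t ht
  · intro t ht
    have h1 : (DF' (ψ' z t)).comp (D' z t) - (DF (ψ y t)).comp (D y t)
        = (DF' (ψ' z t) - DF (ψ y t)).comp (D' z t) + (DF (ψ y t)).comp (D' z t - D y t) := by
      rw [ContinuousLinearMap.sub_comp, ContinuousLinearMap.comp_sub]; abel
    rw [h1]
    refine (norm_add_le _ _).trans ?_
    have h2 := (ContinuousLinearMap.opNorm_comp_le (DF' (ψ' z t) - DF (ψ y t)) (D' z t)).trans
      (mul_le_mul (hε t ht) (hψ'.D_norm_le z hz t ht) (norm_nonneg _) hε0)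
    have h3 := (ContinuousLinearMap.opNorm_comp_le (DF (ψ y t)) (D' z t - D y t)).trans
      (mul_le_mul_of_nonneg_right (h.norm_deriv_le _ (hψ.mem y hy t ht)) (norm_nonneg _))
    linarith

/-- The uniform first-order expansion of `F` on a compact ball. -/
theorem IsFlowBox.norm_sub_sub_le [FiniteDimensional ℝ E] (h : IsFlowBox F DF y₀ R τ L K) {c : ℝ}
    (hc : 0 < c) : ∃ δ > 0, ∀ y ∈ closedBall y₀ R, ∀ z ∈ closedBall y₀ R, ‖z - y‖ < δ →
      ‖DF z - DF y‖ ≤ c ∧ ‖F z - F y - DF y (z - y)‖ ≤ c * ‖z - y‖ := by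
  have huc := (isCompact_closedBall y₀ R).uniformContinuousOn_of_continuous h.continuousOn
  obtain ⟨δ, hδ, hδ'⟩ := Metric.uniformContinuousOn_iff.1 huc c hc
  have hD : ∀ y ∈ closedBall y₀ R, ∀ z ∈ closedBall y₀ R, ‖z - y‖ < δ → ‖DF z - DF y‖ ≤ c := by
    intro y hy z hz hyz
    have := hδ' z hz y hy (by rwa [dist_eq_norm])
    rw [dist_eq_norm] at this
    exact this.le
  refine ⟨δ, hδ, fun y hy z hz hyz => ⟨hD y hy z hz hyz, ?_⟩⟩
  refine (convex_segment y z).norm_image_sub_le_of_norm_hasFDerivWithin_le' (f' := DF) ?_ ?_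
    (left_mem_segment ℝ y z) (right_mem_segment ℝ y z)
  · intro w hw
    exact (h.hasFDerivAt w ((convex_closedBall y₀ R).segment_subset hy hz hw)).hasFDerivWithinAt
  · intro w hw
    refine hD y hy w ((convex_closedBall y₀ R).segment_subset hy hz hw) (lt_of_le_of_lt ?_ hyz)
    exact norm_sub_le_of_mem_segment hw

/-- The solution is differentiable with respect to the initial point, and its derivative solves the
variational equation. -/
theorem IsLocalFlow.hasFDerivAt [FiniteDimensional ℝ E] (h : IsFlowBox F DF y₀ R τ L K)
    (hψ : IsLocalFlow F DF y₀ R τ ψ D) {y : E} (hy : y ∈ ball y₀ (R / 2)) {t : ℝ}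
    (ht : t ∈ Icc (-τ) τ) : HasFDerivAt (fun z => ψ z t) (D y t) y := by
  have hy' := ball_subset_closedBall hy
  set C := gronwallConst K τ with hC
  have hC0 : 0 ≤ C := gronwallConst_nonneg h.K_pos
  rw [hasFDerivAt_iff_isLittleO_nhds_zero, Asymptotics.isLittleO_iff]
  intro c hc
  obtain ⟨δ, hδ, hδ'⟩ := h.norm_sub_sub_le (c := c / (C * C + 1)) (by positivity)
  have hev : ∀ᶠ u in 𝓝 (0 : E), y + u ∈ closedBall y₀ (R / 2) ∧ C * ‖u‖ < δ := by
    refine Filter.Eventually.and ?_ ?_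
    · have : Filter.Tendsto (fun u : E => y + u) (𝓝 0) (𝓝 y) := by
        have : Continuous fun u : E => y + u := by fun_prop
        simpa using this.tendsto 0
      exact this (Filter.mem_of_superset (isOpen_ball.mem_nhds hy) ball_subset_closedBall)
    · have : Filter.Tendsto (fun u : E => C * ‖u‖) (𝓝 0) (𝓝 0) := by
        have : Continuous fun u : E => C * ‖u‖ := by fun_prop
        simpa using this.tendsto 0
      exact this (Iio_mem_nhds hδ)
  filter_upwards [hev] with u hu
  have hdist : ∀ s ∈ Icc (-τ) τ, ‖ψ (y + u) s - ψ y s‖ ≤ C * ‖u‖ := by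
    intro s hs
    have := hψ.dist_le h hψ (ε := 0) (fun z _ => by simp) hy' hu.1 s hs
    simpa using this
  have := norm_le_gronwallConst (f := fun s => ψ (y + u) s - ψ y s - D y s u)
    (f' := fun s => F (ψ (y + u) s) - F (ψ y s) - (DF (ψ y s)).comp (D y s) u)
    (δ := 0) (ε := c / (C * C + 1) * (C * ‖u‖)) h.K_pos le_rfl (by positivity) (fun s hs => ?_)
    ?_ ?_ t ht
  · refine this.trans ?_
    rw [zero_add, ← hC]
    have : C * (c / (C * C + 1) * (C * ‖u‖)) = (C * C / (C * C + 1)) * (c * ‖u‖) := by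
      field_simp
    rw [this]
    refine mul_le_of_le_one_left (by positivity) ?_
    rw [div_le_one (by positivity)]
    linarith
  · have hd := (hψ.D_deriv y hy' s hs)
    have hd' : HasDerivWithinAt (fun s => D y s u) ((DF (ψ y s)).comp (D y s) u)
        (Icc (-τ) τ) s := by
      simpa using! hd.clm_apply (hasDerivWithinAt_const s (Icc (-τ) τ) u)
    exact ((hψ.deriv _ hu.1 s hs).sub (hψ.deriv y hy' s hs)).sub hd'
  · rw [hψ.zero _ hu.1, hψ.zero y hy', hψ.D_zero y hy']
    simp
  · intro s hs
    have h1 := (hδ' _ (hψ.mem y hy' s hs) _ (hψ.mem _ hu.1 s hs)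
      ((hdist s hs).trans_lt hu.2)).2
    have h2 : F (ψ (y + u) s) - F (ψ y s) - (DF (ψ y s)).comp (D y s) u
        = (F (ψ (y + u) s) - F (ψ y s) - DF (ψ y s) (ψ (y + u) s - ψ y s))
          + DF (ψ y s) (ψ (y + u) s - ψ y s - D y s u) := by
      simp only [map_sub, ContinuousLinearMap.comp_apply]; abel
    rw [h2]
    have h3 := (DF (ψ y s)).le_of_opNorm_le (h.norm_deriv_le _ (hψ.mem y hy' s hs))
      (ψ (y + u) s - ψ y s - D y s u)
    have h4 : c / (C * C + 1) * ‖ψ (y + u) s - ψ y s‖ ≤ c / (C * C + 1) * (C * ‖u‖) :=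
      mul_le_mul_of_nonneg_left (hdist s hs) (by positivity)
    exact (norm_add_le _ _).trans (by linarith)

/-- Continuity of the flow and of its derivative with respect to the initial point and, in the
`C¹` sense, the vector field. -/
theorem IsLocalFlow.tendsto [FiniteDimensional ℝ E] (h : IsFlowBox F DF y₀ R τ L K)
    (hψ : IsLocalFlow F DF y₀ R τ ψ D) {ι : Type*} {l : Filter ι}
    {F' : ι → E → E} {DF' : ι → E → E →L[ℝ] E} {ψ' : ι → E → ℝ → E} {D' : ι → E → ℝ → E →L[ℝ] E}
    (hψ' : ∀ᶠ i in l, IsLocalFlow (F' i) (DF' i) y₀ R τ (ψ' i) (D' i))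
    (hF : TendstoUniformlyOn F' F l (closedBall y₀ R))
    (hDF : TendstoUniformlyOn DF' DF l (closedBall y₀ R))
    {z : ι → E} {y : E} (hy : y ∈ ball y₀ (R / 2)) (hz : Filter.Tendsto z l (𝓝 y)) {t : ℝ}
    (ht : t ∈ Icc (-τ) τ) :
    Filter.Tendsto (fun i => ψ' i (z i) t) l (𝓝 (ψ y t)) ∧
      Filter.Tendsto (fun i => D' i (z i) t) l (𝓝 (D y t)) := by
  have hy' := ball_subset_closedBall hy
  set C := gronwallConst K τ with hC
  have hC0 : 0 ≤ C := gronwallConst_nonneg h.K_pos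
  have hzmem : ∀ᶠ i in l, z i ∈ closedBall y₀ (R / 2) :=
    hz (Filter.mem_of_superset (isOpen_ball.mem_nhds hy) ball_subset_closedBall)
  have key : ∀ δ > 0, ∀ᶠ i in l, ∀ s ∈ Icc (-τ) τ, ‖ψ' i (z i) s - ψ y s‖ < δ := by
    intro δ hδ
    have e1 := Metric.tendstoUniformlyOn_iff.1 hF (δ / (4 * (C + 1))) (by positivity)
    have e2 : ∀ᶠ i in l, ‖z i - y‖ < δ / (4 * (C + 1)) := by
      have := Metric.tendsto_nhds.1 hz (δ / (4 * (C + 1))) (by positivity)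
      simpa [dist_eq_norm] using this
    filter_upwards [e1, e2, hzmem, hψ'] with i h1 h2 h3 h4 s hs
    refine (hψ.dist_le h h4 (ε := δ / (4 * (C + 1))) (fun w hw => ?_) hy' h3 s hs).trans_lt ?_
    · have := (h1 w hw).le
      rwa [dist_comm, dist_eq_norm] at this
    · have h5 : C * (‖z i - y‖ + δ / (4 * (C + 1))) ≤ C * (2 * (δ / (4 * (C + 1)))) :=
        mul_le_mul_of_nonneg_left (by linarith) hC0
      refine h5.trans_lt ?_
      have h6 : C * (2 * (δ / (4 * (C + 1)))) = (C / (C + 1)) * (δ / 2) := by field_simp; ring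
      rw [h6]
      have h7 : C / (C + 1) ≤ 1 := by rw [div_le_one (by positivity)]; linarith
      have := mul_le_mul_of_nonneg_right h7 (by positivity : (0 : ℝ) ≤ δ / 2)
      linarith
  refine ⟨?_, ?_⟩
  · rw [Metric.tendsto_nhds]
    intro ε hε
    filter_upwards [key ε hε] with i hi
    rw [dist_eq_norm]
    exact hi t ht
  · rw [Metric.tendsto_nhds]
    intro ε hε
    set c := ε / (8 * (C + 1)) with hc
    have hc0 : 0 < c := by positivity
    obtain ⟨δ, hδ, hδ'⟩ := h.norm_sub_sub_le hc0
    filter_upwards [key δ hδ, Metric.tendstoUniformlyOn_iff.1 hDF c hc0, hzmem, hψ']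
      with i h1 h2 h3 h4
    rw [dist_eq_norm]
    refine (hψ.norm_D_sub_le h h4 (ε := 2 * c) hy' h3 (fun s hs => ?_) t ht).trans_lt ?_
    · have h5 := (hδ' _ (hψ.mem y hy' s hs) _ (h4.mem _ h3 s hs) (h1 s hs)).1
      have h6 := (h2 _ (h4.mem _ h3 s hs)).le
      rw [dist_comm, dist_eq_norm] at h6
      have h7 := norm_add_le (DF' i (ψ' i (z i) s) - DF (ψ' i (z i) s))
        (DF (ψ' i (z i) s) - DF (ψ y s))
      rw [sub_add_sub_cancel] at h7
      linarith
    · have h6 : C * (2 * (2 * c)) = (C / (C + 1)) * (ε / 2) := by rw [hc]; field_simp; ring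
      rw [← hC, h6]
      have h7 : C / (C + 1) ≤ 1 := by rw [div_le_one (by positivity)]; linarith
      have := mul_le_mul_of_nonneg_right h7 (by positivity : (0 : ℝ) ≤ ε / 2)
      linarith

end

end LocalFlow

/-! ### Hyperbolicity of linear cocycles over an invariant set -/

section Cocycle

open Set Filter

variable {α E : Type*} [NormedAddCommGroup E] [NormedSpace ℝ E]

/-- A linear cocycle `D` over the flow `φ` on the invariant set `Λ`, with an invariant vector field
`X` and an invariant linear form `ℓ` that vanishes on `X`. The norms `N x` are not assumed to depend
continuously on `x`, only to be distorted by bounded factors; `p x` is the quotient norm of `N x`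
modulo `X x`, seen as a seminorm on `E`. -/
structure IsEnergyCocycle (Λ : Set α) (φ : ℝ → α → α) (D : ℝ → α → E →L[ℝ] E) (X : α → E)
    (ℓ : α → E →ₗ[ℝ] ℝ) (N p : α → Seminorm ℝ E) : Prop where
  mem : ∀ t, ∀ x ∈ Λ, φ t x ∈ Λ
  map_zero : ∀ x ∈ Λ, φ 0 x = x
  map_add : ∀ s t, ∀ x ∈ Λ, φ (s + t) x = φ s (φ t x)
  D_zero : ∀ x ∈ Λ, ∀ v, D 0 x v = v
  D_add : ∀ s t, ∀ x ∈ Λ, ∀ v, D (s + t) x v = D s (φ t x) (D t x v)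
  D_X : ∀ t, ∀ x ∈ Λ, D t x (X x) = X (φ t x)
  ℓ_D : ∀ t, ∀ x ∈ Λ, ∀ v, ℓ (φ t x) (D t x v) = ℓ x v
  ℓ_X : ∀ x ∈ Λ, ℓ x (X x) = 0
  N_eq_zero : ∀ x ∈ Λ, ∀ v, N x v = 0 → v = 0
  p_le : ∀ x ∈ Λ, ∀ v, p x v ≤ N x v
  p_add_smul : ∀ x ∈ Λ, ∀ v, ∀ s : ℝ, p x (v + s • X x) = p x v
  exists_sub_smul : ∀ x ∈ Λ, ∀ v, ∃ s : ℝ, N x (v - s • X x) = p x v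
  D_bound : ∀ t, ∃ C > 0, ∀ x ∈ Λ, ∀ v, N (φ t x) (D t x v) ≤ C * N x v
  X_bound : ∃ a > 0, ∃ b > 0, ∀ x ∈ Λ, a ≤ N x (X x) ∧ N x (X x) ≤ b

namespace IsEnergyCocycle

variable {Λ : Set α} {φ : ℝ → α → α} {D : ℝ → α → E →L[ℝ] E} {X : α → E}
  {ℓ : α → E →ₗ[ℝ] ℝ} {N p : α → Seminorm ℝ E}

/-- Time reversal. -/
theorem reverse (h : IsEnergyCocycle Λ φ D X ℓ N p) :
    IsEnergyCocycle Λ (fun t => φ (-t)) (fun t => D (-t)) X ℓ N p where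
  mem t := h.mem (-t)
  map_zero := by simpa using h.map_zero
  map_add s t := by simpa only [neg_add] using h.map_add (-s) (-t)
  D_zero := by simpa using h.D_zero
  D_add s t := by simpa only [neg_add] using h.D_add (-s) (-t)
  D_X t := h.D_X (-t)
  ℓ_D t := h.ℓ_D (-t)
  ℓ_X := h.ℓ_X
  N_eq_zero := h.N_eq_zero
  p_le := h.p_le
  p_add_smul := h.p_add_smul
  exists_sub_smul := h.exists_sub_smul
  D_bound t := h.D_bound (-t)
  X_bound := h.X_bound

theorem D_neg_D (h : IsEnergyCocycle Λ φ D X ℓ N p) (t : ℝ) {x : α} (hx : x ∈ Λ) (v : E) :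
    D (-t) (φ t x) (D t x v) = v := by
  rw [← h.D_add _ _ x hx, neg_add_cancel, h.D_zero x hx]

theorem map_neg_map (h : IsEnergyCocycle Λ φ D X ℓ N p) (t : ℝ) {x : α} (hx : x ∈ Λ) :
    φ (-t) (φ t x) = x := by
  rw [← h.map_add _ _ x hx, neg_add_cancel, h.map_zero x hx]

theorem D_D_neg (h : IsEnergyCocycle Λ φ D X ℓ N p) (t : ℝ) {x : α} (hx : x ∈ Λ) (v : E) :
    D t (φ (-t) x) (D (-t) x v) = v := by
  rw [← h.D_add _ _ x hx, add_neg_cancel, h.D_zero x hx]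

theorem p_D_add_smul (h : IsEnergyCocycle Λ φ D X ℓ N p) (t : ℝ) {x : α} (hx : x ∈ Λ) (v : E)
    (s : ℝ) : p (φ t x) (D t x (v + s • X x)) = p (φ t x) (D t x v) := by
  rw [_root_.map_add, map_smul, h.D_X t x hx, h.p_add_smul _ (h.mem t x hx)]

/-! #### From a hyperbolic splitting to growth of the quotient norm -/

theorem iterate_contraction (h : IsEnergyCocycle Λ φ D X ℓ N p) {m θ : ℝ} (hθ : 0 < θ)
    {S : ∀ _ : α, Submodule ℝ E} (hS : ∀ t, ∀ x ∈ Λ, ∀ v ∈ S x, D t x v ∈ S (φ t x))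
    (hc : ∀ x ∈ Λ, ∀ v ∈ S x, N (φ m x) (D m x v) ≤ θ * N x v) (k : ℕ) :
    ∀ x ∈ Λ, ∀ v ∈ S x, N (φ (k * m) x) (D (k * m) x v) ≤ θ ^ k * N x v := by
  induction k with
  | zero =>
    intro x hx v _
    simp [h.map_zero x hx, h.D_zero x hx]
  | succ k ih =>
    intro x hx v hv
    have e : ((k + 1 : ℕ) : ℝ) * m = m + k * m := by push_cast; ring
    rw [e, h.map_add _ _ x hx, h.D_add _ _ x hx]
    refine (hc _ (h.mem _ x hx) _ (hS _ x hx v hv)).trans ?_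
    calc θ * N (φ (k * m) x) (D (k * m) x v) ≤ θ * (θ ^ k * N x v) :=
          mul_le_mul_of_nonneg_left (ih x hx v hv) hθ.le
      _ = θ ^ (k + 1) * N x v := by ring

/-- A uniformly contracted invariant subbundle makes a uniform angle with `X`, which is neither
contracted nor expanded. -/
theorem exists_angle (h : IsEnergyCocycle Λ φ D X ℓ N p) {m θ : ℝ} (hθ : 0 < θ) (hθ1 : θ < 1)
    {S : ∀ _ : α, Submodule ℝ E} (hS : ∀ t, ∀ x ∈ Λ, ∀ v ∈ S x, D t x v ∈ S (φ t x))
    (hc : ∀ x ∈ Λ, ∀ v ∈ S x, N (φ m x) (D m x v) ≤ θ * N x v) :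
    ∃ c > 0, ∀ x ∈ Λ, ∀ v ∈ S x, c * N x v ≤ p x v := by
  obtain ⟨a, ha, b, hb, hX⟩ := h.X_bound
  obtain ⟨k, hk⟩ := exists_pow_lt_of_lt_one (show 0 < a / (2 * b) by positivity) hθ1
  obtain ⟨C, hC, hCb⟩ := h.D_bound (k * m)
  refine ⟨(2 * (1 + b / a * C))⁻¹, by positivity, fun x hx v hv => ?_⟩
  obtain ⟨s, hs⟩ := h.exists_sub_smul x hx v
  have hx' := h.mem (k * m) x hx
  have h1 : |s| * a ≤ θ ^ k * N x v + C * p x v := by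
    have e1 : s • X (φ (k * m) x) = D (k * m) x v - D (k * m) x (v - s • X x) := by
      rw [map_sub, map_smul, h.D_X _ x hx]; abel
    have e2 : |s| * N (φ (k * m) x) (X (φ (k * m) x)) = N (φ (k * m) x) (s • X (φ (k * m) x)) := by
      rw [map_smul_eq_mul, Real.norm_eq_abs]
    calc |s| * a ≤ |s| * N (φ (k * m) x) (X (φ (k * m) x)) :=
          mul_le_mul_of_nonneg_left (hX _ hx').1 (abs_nonneg s)
      _ ≤ N (φ (k * m) x) (D (k * m) x v) + N (φ (k * m) x) (D (k * m) x (v - s • X x)) := by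
          rw [e2, e1]; exact map_sub_le_add _ _ _
      _ ≤ θ ^ k * N x v + C * p x v := by
          refine add_le_add (h.iterate_contraction hθ hS hc k x hx v hv) ?_
          rw [← hs]; exact hCb x hx _
  have h2 : N x v ≤ p x v + |s| * b := by
    have e1 : v = (v - s • X x) + s • X x := by abel
    calc N x v = N x ((v - s • X x) + s • X x) := by rw [← e1]
      _ ≤ N x (v - s • X x) + N x (s • X x) := map_add_le_add _ _ _
      _ ≤ p x v + |s| * b := by
          rw [hs, map_smul_eq_mul, Real.norm_eq_abs]
          exact add_le_add le_rfl (mul_le_mul_of_nonneg_left (hX x hx).2 (abs_nonneg s))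
  have h3 : |s| * b ≤ N x v / 2 + b / a * C * p x v := by
    have e1 : |s| * b = b / a * (|s| * a) := by field_simp
    have e2 : b / a * (θ ^ k * N x v) ≤ N x v / 2 := by
      have : b / a * θ ^ k ≤ 1 / 2 := by
        calc b / a * θ ^ k ≤ b / a * (a / (2 * b)) :=
              mul_le_mul_of_nonneg_left hk.le (by positivity)
          _ = 1 / 2 := by field_simp
      calc b / a * (θ ^ k * N x v) = (b / a * θ ^ k) * N x v := by ring
        _ ≤ 1 / 2 * N x v := mul_le_mul_of_nonneg_right this (apply_nonneg _ _)
        _ = N x v / 2 := by ring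
    rw [e1]
    calc b / a * (|s| * a) ≤ b / a * (θ ^ k * N x v + C * p x v) :=
          mul_le_mul_of_nonneg_left h1 (by positivity)
      _ ≤ N x v / 2 + b / a * C * p x v := by rw [mul_add]; linarith
  rw [inv_mul_le_iff₀ (by positivity)]
  linarith

/-- Over a hyperbolic set, every vector on which `ℓ` vanishes is expanded in the quotient norm by
some definite time in the future or in the past. -/
theorem exists_expansion (h : IsEnergyCocycle Λ φ D X ℓ N p) {m : ℕ} (hm : 0 < m) {θ : ℝ}
    (hθ : 0 < θ) (hθ1 : θ < 1) {Em Ep : ∀ _ : α, Submodule ℝ E}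
    (hEm : ∀ t, ∀ x ∈ Λ, ∀ v ∈ Em x, D t x v ∈ Em (φ t x))
    (hEp : ∀ t, ∀ x ∈ Λ, ∀ v ∈ Ep x, D t x v ∈ Ep (φ t x))
    (hcm : ∀ x ∈ Λ, ∀ v ∈ Em x, N (φ m x) (D m x v) ≤ θ * N x v)
    (hcp : ∀ x ∈ Λ, ∀ v ∈ Ep x, N (φ (-m) x) (D (-m) x v) ≤ θ * N x v)
    (hsup : ∀ x ∈ Λ, Em x ⊔ Submodule.span ℝ {X x} ⊔ Ep x = LinearMap.ker (ℓ x)) :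
    ∃ T : ℕ, 0 < T ∧ ∀ x ∈ Λ, ∀ w, ℓ x w = 0 →
      3 * p x w ≤ max (p (φ T x) (D T x w)) (p (φ (-T) x) (D (-T) x w)) := by
  obtain ⟨c, hc, hcm'⟩ := h.exists_angle hθ hθ1 hEm hcm
  obtain ⟨c', hc', hcp'⟩ := h.reverse.exists_angle (m := m) hθ hθ1 (fun t => hEp (-t)) hcp
  set d := min c c' with hd
  have hd0 : 0 < d := lt_min hc hc'
  obtain ⟨k, hk⟩ := exists_pow_lt_of_lt_one (show 0 < d / 7 by positivity) hθ1
  have hk1 : θ ^ (k + 1) < d / 7 :=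
    lt_of_le_of_lt (pow_le_pow_of_le_one hθ.le hθ1.le (Nat.le_succ k)) hk
  have hθk : 0 < θ ^ (k + 1) := by positivity
  refine ⟨(k + 1) * m, by positivity, fun x hx w hw => ?_⟩
  have hw' : w ∈ Em x ⊔ Submodule.span ℝ {X x} ⊔ Ep x := by
    rw [hsup x hx]; exact hw
  obtain ⟨u, hu, vp, hvp, rfl⟩ := Submodule.mem_sup.1 hw'
  obtain ⟨vm, hvm, y, hy, rfl⟩ := Submodule.mem_sup.1 hu
  obtain ⟨s, rfl⟩ := Submodule.mem_span_singleton.1 hy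
  -- expansion of `v` along the orbit in one time direction, `w` being contracted
  have key : ∀ (φ : ℝ → α → α) (D : ℝ → α → E →L[ℝ] E), IsEnergyCocycle Λ φ D X ℓ N p →
      ∀ Ea Eb : ∀ _ : α, Submodule ℝ E,
      (∀ t, ∀ x ∈ Λ, ∀ v ∈ Ea x, D t x v ∈ Ea (φ t x)) →
      (∀ t, ∀ x ∈ Λ, ∀ v ∈ Eb x, D t x v ∈ Eb (φ t x)) →
      (∀ x ∈ Λ, ∀ v ∈ Ea x, N (φ m x) (D m x v) ≤ θ * N x v) →
      (∀ x ∈ Λ, ∀ v ∈ Eb x, N (φ (-m) x) (D (-m) x v) ≤ θ * N x v) →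
      (∀ x ∈ Λ, ∀ v ∈ Eb x, d * N x v ≤ p x v) → ∀ va ∈ Ea x, ∀ vb ∈ Eb x,
      7 * N x vb - N x va
        ≤ p (φ (((k + 1) * m : ℕ) : ℝ) x) (D (((k + 1) * m : ℕ) : ℝ) x (va + s • X x + vb)) := by
    intro φ D h Ea Eb ha hb hca hcb hdb va hva vb hvb
    set T : ℝ := (((k + 1) * m : ℕ) : ℝ) with hT
    have hT1 : T = ((k + 1 : ℕ) : ℝ) * m := by rw [hT]; push_cast; ring
    have hxT := h.mem T x hx
    have h1 : N (φ T x) (D T x va) ≤ θ ^ (k + 1) * N x va := by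
      rw [hT1]; exact h.iterate_contraction hθ ha hca (k + 1) x hx va hva
    have h2 : N x vb ≤ θ ^ (k + 1) * N (φ T x) (D T x vb) := by
      have := h.reverse.iterate_contraction (m := m) hθ (fun t => hb (-t)) hcb (k + 1) _ hxT _
        (hb T x hx vb hvb)
      beta_reduce at this
      rw [← hT1, h.map_neg_map T hx, h.D_neg_D T hx] at this
      exact this
    have h3 : d * N (φ T x) (D T x vb) ≤ p (φ T x) (D T x vb) :=
      hdb _ hxT _ (hb T x hx vb hvb)
    have h4 : 7 * N x vb ≤ d * N (φ T x) (D T x vb) := by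
      have : θ ^ (k + 1) * N (φ T x) (D T x vb) ≤ d / 7 * N (φ T x) (D T x vb) :=
        mul_le_mul_of_nonneg_right hk1.le (apply_nonneg _ _)
      linarith
    have h5 : p (φ T x) (D T x va) ≤ N x va := by
      refine (h.p_le _ hxT _).trans (h1.trans ?_)
      exact mul_le_of_le_one_left (apply_nonneg _ _) (pow_le_one₀ hθ.le hθ1.le)
    have h6 : p (φ T x) (D T x vb) ≤ p (φ T x) (D T x (va + s • X x + vb)) + p (φ T x) (D T x va) := by
      have e1 : va + s • X x + vb = (va + vb) + s • X x := by abel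
      have e2 : D T x vb = D T x (va + vb) - D T x va := by rw [_root_.map_add]; abel
      rw [e1, h.p_D_add_smul T hx, e2]
      exact map_sub_le_add _ _ _
    linarith
  have k1 := key φ D h Em Ep hEm hEp hcm hcp (fun x hx v hv =>
    (mul_le_mul_of_nonneg_right (min_le_right c c') (apply_nonneg _ _)).trans (hcp' x hx v hv))
    vm hvm vp hvp
  have k2 := key (fun t => φ (-t)) (fun t => D (-t)) h.reverse Ep Em (fun t => hEp (-t))
    (fun t => hEm (-t)) hcp (by simpa using hcm) (fun x hx v hv =>
    (mul_le_mul_of_nonneg_right (min_le_left c c') (apply_nonneg _ _)).trans (hcm' x hx v hv))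
    vp hvp vm hvm
  have e : vp + s • X x + vm = vm + s • X x + vp := by abel
  beta_reduce at k2
  rw [e] at k2
  have hp : p x (vm + s • X x + vp) ≤ N x vm + N x vp := by
    have e1 : vm + s • X x + vp = (vm + vp) + s • X x := by abel
    rw [e1, h.p_add_smul x hx]
    exact (h.p_le x hx _).trans (map_add_le_add _ _ _)
  have m1 := le_max_left (p (φ (((k + 1) * m : ℕ) : ℝ) x)
    (D (((k + 1) * m : ℕ) : ℝ) x (vm + s • X x + vp)))
    (p (φ (-(((k + 1) * m : ℕ) : ℝ)) x) (D (-(((k + 1) * m : ℕ) : ℝ)) x (vm + s • X x + vp)))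
  have m2 := le_max_right (p (φ (((k + 1) * m : ℕ) : ℝ) x)
    (D (((k + 1) * m : ℕ) : ℝ) x (vm + s • X x + vp)))
    (p (φ (-(((k + 1) * m : ℕ) : ℝ)) x) (D (-(((k + 1) * m : ℕ) : ℝ)) x (vm + s • X x + vp)))
  linarith

end IsEnergyCocycle

end Cocycle

section Cocycle

open Set Filter

/-! #### From growth of the quotient norm to a hyperbolic splitting -/

/-- A sequence that is convex in this strong sense and increases once grows geometrically. -/
theorem two_pow_mul_le_of_lt {b : ℕ → ℝ} (h0 : ∀ n, 0 ≤ b n)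
    (hb : ∀ n, 2 * b (n + 1) ≤ max (b (n + 2)) (b n)) {n : ℕ} (hn : b n < b (n + 1)) (k : ℕ) :
    2 ^ k * b (n + 1) ≤ b (n + 1 + k) ∧ b (n + k) < b (n + k + 1) := by
  induction k with
  | zero => simpa using hn
  | succ k ih =>
    have h1 := hb (n + k)
    have h2 : 2 * b (n + k + 1) ≤ b (n + k + 2) := by
      rcases le_max_iff.1 h1 with h | h
      · exact h
      · linarith [ih.2, h0 (n + k)]
    have h3 : b (n + 1 + k) = b (n + k + 1) := by congr 1; ring
    have h4 : b (n + 1 + (k + 1)) = b (n + k + 2) := by congr 1; ring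
    refine ⟨?_, ?_⟩
    · rw [h4, pow_succ]
      linarith [ih.1]
    · change b (n + k + 1) < b (n + k + 2)
      linarith [ih.2, h0 (n + k)]

/-- A bounded sequence of this kind never increases, since it would then grow geometrically. -/
theorem le_half_of_bdd {b : ℕ → ℝ} (h0 : ∀ n, 0 ≤ b n)
    (hb : ∀ n, 2 * b (n + 1) ≤ max (b (n + 2)) (b n)) {B : ℝ} (hB : ∀ n, b n ≤ B) (n : ℕ) :
    b (n + 1) ≤ b n / 2 := by
  have hanti : ∀ n, b (n + 1) ≤ b n := by
    intro n
    by_contra! hn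
    have hpos : 0 < b (n + 1) := (h0 n).trans_lt hn
    obtain ⟨k, hk⟩ := pow_unbounded_of_one_lt (B / b (n + 1)) (one_lt_two)
    have := (two_pow_mul_le_of_lt h0 hb hn k).1
    rw [div_lt_iff₀ hpos] at hk
    linarith [hB (n + 1 + k)]
  have h1 := hb n
  have h2 := hanti (n + 1)
  rcases le_max_iff.1 h1 with h | h
  · have h3 : b (n + 1 + 1) = b (n + 2) := rfl
    linarith [h0 (n + 1), h0 n]
  · linarith

/-- A bilinear form `Ω` that is nondegenerate relative to a norm `N` coming from an inner product
`g` (through `g (J v) w = Ω v w`) has no almost isotropic subspaces of more than half the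
dimension. -/
theorem finrank_le_of_almost_isotropic {E : Type*} [AddCommGroup E] [Module ℝ E]
    [FiniteDimensional ℝ E] {d : ℕ} (hd : Module.finrank ℝ E = 2 * d) {N : Seminorm ℝ E}
    (hN : ∀ v, N v = 0 → v = 0) {Ω g : E →ₗ[ℝ] E →ₗ[ℝ] ℝ} {J : E →ₗ[ℝ] E}
    (hg : ∀ v, g v v = N v ^ 2) (hJ : ∀ v w, g (J v) w = Ω v w) {c ε : ℝ} (hε : 0 ≤ ε) (hεc : ε < c)
    (hc : ∀ v, c * N v ≤ N (J v)) {W : Submodule ℝ E}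
    (hW : ∀ v ∈ W, ∀ w ∈ W, |Ω v w| ≤ ε * (N v * N w)) : Module.finrank ℝ W ≤ d := by
  have key : ∀ v ∈ W, J v ∈ W → v = 0 := by
    intro v hv hJv
    apply hN
    have h1 : N (J v) ^ 2 ≤ ε * (N v * N (J v)) := by
      rw [← hg, hJ]
      exact (le_abs_self _).trans (hW v hv _ hJv)
    have h2 : N (J v) ≤ ε * N v := by
      rcases (apply_nonneg N (J v)).eq_or_lt with h | h
      · rw [← h]; exact mul_nonneg hε (apply_nonneg _ _)
      · nlinarith
    have h3 := hc v
    nlinarith [apply_nonneg N v]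
  have hinj : Function.Injective J := by
    rw [injective_iff_map_eq_zero]
    intro v hv
    apply hN
    have h3 := hc v
    rw [hv, map_zero] at h3
    nlinarith [apply_nonneg N v]
  have hdisj : Disjoint W (W.map J) := by
    rw [Submodule.disjoint_def]
    rintro _ hw ⟨v, hv, rfl⟩
    rw [key v hv hw, map_zero]
  have h1 := Submodule.finrank_add_finrank_le_of_disjoint hdisj
  rw [← (Submodule.equivMapOfInjective _ hinj _).finrank_eq, hd] at h1
  omega

variable {α E : Type*} [NormedAddCommGroup E] [NormedSpace ℝ E]

namespace IsEnergyCocycle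

variable {Λ : Set α} {φ : ℝ → α → α} {D : ℝ → α → E →L[ℝ] E} {X : α → E}
  {ℓ : α → E →ₗ[ℝ] ℝ} {N p : α → Seminorm ℝ E}

/-- The vectors in the kernel of `ℓ` whose quotient norm stays bounded in the future. -/
def boundedSub (φ : ℝ → α → α) (D : ℝ → α → E →L[ℝ] E) (ℓ : α → E →ₗ[ℝ] ℝ)
    (p : α → Seminorm ℝ E) (T : ℝ) (x : α) : Submodule ℝ E where
  carrier := {v | ℓ x v = 0 ∧ ∃ B, ∀ n : ℕ, p (φ (n * T) x) (D (n * T) x v) ≤ B}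
  zero_mem' := ⟨by simp, 0, by simp⟩
  add_mem' := by
    rintro v w ⟨hv, B, hB⟩ ⟨hw, B', hB'⟩
    refine ⟨by simp [hv, hw], B + B', fun n => ?_⟩
    rw [_root_.map_add]
    exact (map_add_le_add _ _ _).trans (add_le_add (hB n) (hB' n))
  smul_mem' := by
    rintro c v ⟨hv, B, hB⟩
    refine ⟨by simp [hv], ‖c‖ * B, fun n => ?_⟩
    rw [map_smul, map_smul_eq_mul]
    exact mul_le_mul_of_nonneg_left (hB n) (norm_nonneg c)

/-- The stable space: the vectors in the kernel of `ℓ` that tend to `0` in the future. -/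
def stableSub (φ : ℝ → α → α) (D : ℝ → α → E →L[ℝ] E) (ℓ : α → E →ₗ[ℝ] ℝ)
    (N : α → Seminorm ℝ E) (T : ℝ) (x : α) : Submodule ℝ E where
  carrier := {v | ℓ x v = 0 ∧
    Tendsto (fun n : ℕ => N (φ (n * T) x) (D (n * T) x v)) atTop (𝓝 0)}
  zero_mem' := ⟨by simp, by simp⟩
  add_mem' := by
    rintro v w ⟨hv, h⟩ ⟨hw, h'⟩
    refine ⟨by simp [hv, hw], ?_⟩
    refine squeeze_zero (fun n => apply_nonneg _ _) (fun n => ?_) (by simpa using h.add h')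
    rw [_root_.map_add]
    exact map_add_le_add _ _ _
  smul_mem' := by
    rintro c v ⟨hv, h⟩
    refine ⟨by simp [hv], ?_⟩
    simpa [map_smul_eq_mul] using h.const_mul |c|

theorem mem_boundedSub {T : ℝ} {x : α} {v : E} : v ∈ boundedSub φ D ℓ p T x ↔
    ℓ x v = 0 ∧ ∃ B, ∀ n : ℕ, p (φ (n * T) x) (D (n * T) x v) ≤ B := Iff.rfl

theorem mem_stableSub {T : ℝ} {x : α} {v : E} : v ∈ stableSub φ D ℓ N T x ↔
    ℓ x v = 0 ∧ Tendsto (fun n : ℕ => N (φ (n * T) x) (D (n * T) x v)) atTop (𝓝 0) := Iff.rfl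

theorem map_succ (h : IsEnergyCocycle Λ φ D X ℓ N p) (T : ℝ) {x : α} (hx : x ∈ Λ) (n : ℕ) :
    φ ((n + 1 : ℕ) * T) x = φ T (φ (n * T) x) := by
  rw [← h.map_add _ _ x hx]; congr 1; push_cast; ring

theorem D_succ (h : IsEnergyCocycle Λ φ D X ℓ N p) (T : ℝ) {x : α} (hx : x ∈ Λ) (n : ℕ) (v : E) :
    D ((n + 1 : ℕ) * T) x v = D T (φ (n * T) x) (D (n * T) x v) := by
  rw [← h.D_add _ _ x hx]; congr 2; push_cast; ring

theorem two_mul_p_le (h : IsEnergyCocycle Λ φ D X ℓ N p) {T : ℝ}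
    (hQ : ∀ x ∈ Λ, ∀ w, ℓ x w = 0 →
      2 * p x w ≤ max (p (φ T x) (D T x w)) (p (φ (-T) x) (D (-T) x w)))
    {x : α} (hx : x ∈ Λ) {v : E} (hv : ℓ x v = 0) (n : ℕ) :
    2 * p (φ ((n + 1 : ℕ) * T) x) (D ((n + 1 : ℕ) * T) x v)
      ≤ max (p (φ ((n + 2 : ℕ) * T) x) (D ((n + 2 : ℕ) * T) x v))
        (p (φ (n * T) x) (D (n * T) x v)) := by
  have h1 := hQ _ (h.mem ((n + 1 : ℕ) * T) x hx) (D ((n + 1 : ℕ) * T) x v)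
    (by rw [h.ℓ_D _ x hx, hv])
  have e1 := h.map_succ T hx (n + 1)
  have e2 := h.D_succ T hx (n + 1) v
  have e3 : φ (-T) (φ ((n + 1 : ℕ) * T) x) = φ (n * T) x := by
    rw [h.map_succ T hx n, h.map_neg_map T (h.mem _ x hx)]
  have e4 : D (-T) (φ ((n + 1 : ℕ) * T) x) (D ((n + 1 : ℕ) * T) x v) = D (n * T) x v := by
    rw [h.map_succ T hx n, h.D_succ T hx n, h.D_neg_D T (h.mem _ x hx)]
  rw [e3, e4, ← e1, ← e2] at h1
  exact h1

theorem p_le_two_pow (h : IsEnergyCocycle Λ φ D X ℓ N p) {T : ℝ}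
    (hQ : ∀ x ∈ Λ, ∀ w, ℓ x w = 0 →
      2 * p x w ≤ max (p (φ T x) (D T x w)) (p (φ (-T) x) (D (-T) x w)))
    {x : α} (hx : x ∈ Λ) {v : E} (hv : v ∈ boundedSub φ D ℓ p T x) (n : ℕ) :
    p (φ (n * T) x) (D (n * T) x v) ≤ p x v / 2 ^ n := by
  obtain ⟨hv0, B, hB⟩ := mem_boundedSub.1 hv
  have hhalf := le_half_of_bdd (b := fun n : ℕ => p (φ (n * T) x) (D (n * T) x v))
    (fun n => apply_nonneg _ _) (fun n => h.two_mul_p_le hQ hx hv0 n) hB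
  induction n with
  | zero => simp [h.map_zero x hx, h.D_zero x hx]
  | succ n ih =>
    refine (hhalf n).trans ?_
    rw [pow_succ, ← div_div]
    exact div_le_div_of_nonneg_right ih two_pos.le

/-- A vector that is bounded in the quotient norm is, up to a multiple of `X`, in the stable space,
and vectors of the stable space are contracted uniformly. -/
theorem exists_stable_bound (h : IsEnergyCocycle Λ φ D X ℓ N p) {T : ℝ}
    (hQ : ∀ x ∈ Λ, ∀ w, ℓ x w = 0 →
      2 * p x w ≤ max (p (φ T x) (D T x w)) (p (φ (-T) x) (D (-T) x w))) :
    ∃ C > 0, ∀ x ∈ Λ, ∀ v ∈ boundedSub φ D ℓ p T x, ∃ s : ℝ, ∀ n : ℕ,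
      N (φ (n * T) x) (D (n * T) x (v - s • X x)) ≤ C * p x v / 2 ^ n := by
  obtain ⟨a, ha, b, hb, hX⟩ := h.X_bound
  obtain ⟨C, hC, hCb⟩ := h.D_bound T
  refine ⟨1 + 2 * (1 + C) / a * b, by positivity, fun x hx v hv => ?_⟩
  have hp := h.p_le_two_pow hQ hx hv
  have hmem : ∀ n : ℕ, φ (n * T) x ∈ Λ := fun n => h.mem _ x hx
  choose s hs using fun n : ℕ => h.exists_sub_smul _ (hmem n) (D (n * T) x v)
  have hstep : ∀ n, dist (s n) (s (n + 1)) ≤ 2 * ((1 + C) / a * p x v) / 2 / 2 ^ n := by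
    intro n
    have e1 : (s (n + 1) - s n) • X (φ ((n + 1 : ℕ) * T) x)
        = D T (φ (n * T) x) (D (n * T) x v - s n • X (φ (n * T) x))
          - (D ((n + 1 : ℕ) * T) x v - s (n + 1) • X (φ ((n + 1 : ℕ) * T) x)) := by
      rw [map_sub, map_smul, h.D_X T _ (hmem n), ← h.D_succ T hx, ← h.map_succ T hx, sub_smul]
      abel
    have h1 : |s (n + 1) - s n| * a ≤ (1 + C) * (p x v / 2 ^ n) := by
      calc |s (n + 1) - s n| * a
          ≤ |s (n + 1) - s n| * N (φ ((n + 1 : ℕ) * T) x) (X (φ ((n + 1 : ℕ) * T) x)) :=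
            mul_le_mul_of_nonneg_left (hX _ (hmem (n + 1))).1 (abs_nonneg _)
        _ = N (φ ((n + 1 : ℕ) * T) x) ((s (n + 1) - s n) • X (φ ((n + 1 : ℕ) * T) x)) := by
            rw [map_smul_eq_mul, Real.norm_eq_abs]
        _ ≤ N (φ ((n + 1 : ℕ) * T) x) (D T (φ (n * T) x) (D (n * T) x v - s n • X (φ (n * T) x)))
            + N (φ ((n + 1 : ℕ) * T) x)
              (D ((n + 1 : ℕ) * T) x v - s (n + 1) • X (φ ((n + 1 : ℕ) * T) x)) := by
            rw [e1]; exact map_sub_le_add _ _ _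
        _ ≤ C * (p x v / 2 ^ n) + p x v / 2 ^ n := by
            refine add_le_add ?_ ?_
            · rw [h.map_succ T hx]
              refine (hCb _ (hmem n) _).trans (mul_le_mul_of_nonneg_left ?_ hC.le)
              rw [hs n]; exact hp n
            · rw [hs (n + 1)]
              refine (hp (n + 1)).trans ?_
              exact div_le_div_of_nonneg_left (apply_nonneg _ _) (by positivity)
                (pow_le_pow_right₀ one_le_two (Nat.le_succ n))
        _ = (1 + C) * (p x v / 2 ^ n) := by ring
    rw [Real.dist_eq, abs_sub_comm]
    calc |s (n + 1) - s n| = |s (n + 1) - s n| * a / a := by field_simp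
      _ ≤ (1 + C) * (p x v / 2 ^ n) / a := div_le_div_of_nonneg_right h1 ha.le
      _ = 2 * ((1 + C) / a * p x v) / 2 / 2 ^ n := by ring
  obtain ⟨σ, hσ⟩ := cauchySeq_tendsto_of_complete (cauchySeq_of_le_geometric_two hstep)
  have hdist := dist_le_of_le_geometric_two_of_tendsto hstep hσ
  refine ⟨σ, fun n => ?_⟩
  have e2 : D (n * T) x (v - σ • X x)
      = (D (n * T) x v - s n • X (φ (n * T) x)) + (s n - σ) • X (φ (n * T) x) := by
    rw [map_sub, map_smul, h.D_X _ x hx, sub_smul]; abel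
  rw [e2]
  have h1 : |s n - σ| ≤ 2 * ((1 + C) / a * p x v) / 2 ^ n := by
    have := hdist n
    rwa [Real.dist_eq] at this
  calc N (φ (n * T) x) ((D (n * T) x v - s n • X (φ (n * T) x)) + (s n - σ) • X (φ (n * T) x))
      ≤ N (φ (n * T) x) (D (n * T) x v - s n • X (φ (n * T) x))
        + N (φ (n * T) x) ((s n - σ) • X (φ (n * T) x)) := map_add_le_add _ _ _
    _ ≤ p x v / 2 ^ n + 2 * ((1 + C) / a * p x v) / 2 ^ n * b := by
        refine add_le_add (by rw [hs n]; exact hp n) ?_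
        rw [map_smul_eq_mul, Real.norm_eq_abs]
        exact mul_le_mul h1 (hX _ (hmem n)).2 (apply_nonneg _ _)
          (div_nonneg (mul_nonneg two_pos.le (mul_nonneg (by positivity) (apply_nonneg _ _)))
            (by positivity))
    _ = (1 + 2 * (1 + C) / a * b) * p x v / 2 ^ n := by ring

theorem X_mem_boundedSub (h : IsEnergyCocycle Λ φ D X ℓ N p) (T : ℝ) {x : α} (hx : x ∈ Λ) :
    X x ∈ boundedSub φ D ℓ p T x := by
  refine ⟨h.ℓ_X x hx, 0, fun n => ?_⟩
  have := h.p_D_add_smul (n * T) hx 0 1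
  simp only [zero_add, one_smul] at this
  rw [this, _root_.map_zero, _root_.map_zero]

theorem X_ne_zero (h : IsEnergyCocycle Λ φ D X ℓ N p) {x : α} (hx : x ∈ Λ) : X x ≠ 0 := by
  obtain ⟨a, ha, b, hb, hX⟩ := h.X_bound
  intro h0
  have := (hX x hx).1
  rw [h0, _root_.map_zero] at this
  linarith

theorem eq_smul_of_p_eq_zero (h : IsEnergyCocycle Λ φ D X ℓ N p) {x : α} (hx : x ∈ Λ) {v : E}
    (hv : p x v = 0) : ∃ s : ℝ, v = s • X x := by
  obtain ⟨s, hs⟩ := h.exists_sub_smul x hx v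
  rw [hv] at hs
  exact ⟨s, sub_eq_zero.1 (h.N_eq_zero x hx _ hs)⟩

theorem stableSub_le_boundedSub (h : IsEnergyCocycle Λ φ D X ℓ N p) (T : ℝ) {x : α} (hx : x ∈ Λ) :
    stableSub φ D ℓ N T x ≤ boundedSub φ D ℓ p T x := by
  rintro v ⟨hv, ht⟩
  obtain ⟨B, hB⟩ := ht.bddAbove_range
  exact ⟨hv, B, fun n => (h.p_le _ (h.mem _ x hx) _).trans (hB ⟨n, rfl⟩)⟩

theorem smul_X_mem_stableSub (h : IsEnergyCocycle Λ φ D X ℓ N p) {T : ℝ} {x : α} (hx : x ∈ Λ)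
    {s : ℝ} (hs : s • X x ∈ stableSub φ D ℓ N T x) : s = 0 := by
  obtain ⟨a, ha, b, hb, hX⟩ := h.X_bound
  obtain ⟨-, ht⟩ := mem_stableSub.1 hs
  have h1 : |s| * a ≤ 0 := by
    refine ge_of_tendsto' ht fun n => ?_
    rw [map_smul, map_smul_eq_mul, h.D_X _ x hx, Real.norm_eq_abs]
    exact mul_le_mul_of_nonneg_left (hX _ (h.mem _ x hx)).1 (abs_nonneg s)
  have h2 : |s| ≤ 0 := by nlinarith [abs_nonneg s]
  exact abs_nonpos_iff.1 h2

theorem boundedSub_le (h : IsEnergyCocycle Λ φ D X ℓ N p) {T : ℝ}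
    (hQ : ∀ x ∈ Λ, ∀ w, ℓ x w = 0 →
      2 * p x w ≤ max (p (φ T x) (D T x w)) (p (φ (-T) x) (D (-T) x w))) {x : α} (hx : x ∈ Λ) :
    boundedSub φ D ℓ p T x ≤ stableSub φ D ℓ N T x ⊔ Submodule.span ℝ {X x} := by
  intro v hv
  obtain ⟨C, hC, hCb⟩ := h.exists_stable_bound hQ
  obtain ⟨s, hs⟩ := hCb x hx v hv
  refine Submodule.mem_sup.2 ⟨v - s • X x, ⟨?_, ?_⟩, s • X x,
    Submodule.smul_mem _ _ (Submodule.mem_span_singleton_self _), by abel⟩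
  · rw [map_sub, map_smul, h.ℓ_X x hx, hv.1]; simp
  · refine squeeze_zero (fun n => apply_nonneg _ _) hs ?_
    have : Tendsto (fun n : ℕ => C * p x v * (1 / 2 : ℝ) ^ n) atTop (𝓝 (C * p x v * 0)) :=
      (tendsto_pow_atTop_nhds_zero_of_lt_one (by norm_num) (by norm_num)).const_mul _
    simpa [div_eq_mul_inv] using this

theorem exists_stable_contraction (h : IsEnergyCocycle Λ φ D X ℓ N p) {T : ℝ}
    (hQ : ∀ x ∈ Λ, ∀ w, ℓ x w = 0 →
      2 * p x w ≤ max (p (φ T x) (D T x w)) (p (φ (-T) x) (D (-T) x w))) :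
    ∃ C > 0, ∀ x ∈ Λ, ∀ v ∈ stableSub φ D ℓ N T x, ∀ n : ℕ,
      N (φ (n * T) x) (D (n * T) x v) ≤ C * N x v / 2 ^ n := by
  obtain ⟨C, hC, hCb⟩ := h.exists_stable_bound hQ
  refine ⟨C, hC, fun x hx v hv n => ?_⟩
  have hvb := h.stableSub_le_boundedSub T hx hv
  obtain ⟨s, hs⟩ := hCb x hx v hvb
  have hs' : v - s • X x ∈ stableSub φ D ℓ N T x := by
    refine ⟨?_, ?_⟩
    · rw [map_sub, map_smul, h.ℓ_X x hx, hv.1]; simp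
    · refine squeeze_zero (fun n => apply_nonneg _ _) hs ?_
      have : Tendsto (fun n : ℕ => C * p x v * (1 / 2 : ℝ) ^ n) atTop (𝓝 (C * p x v * 0)) :=
        (tendsto_pow_atTop_nhds_zero_of_lt_one (by norm_num) (by norm_num)).const_mul _
      simpa [div_eq_mul_inv] using this
  have h0 : s = 0 := by
    refine h.smul_X_mem_stableSub (T := T) hx ?_
    have := (stableSub φ D ℓ N T x).sub_mem hv hs'
    simpa using this
  have := hs n
  rw [h0, zero_smul, sub_zero] at this
  refine this.trans ?_
  gcongr
  exact h.p_le x hx v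

theorem map_stableSub (h : IsEnergyCocycle Λ φ D X ℓ N p) (T t : ℝ) {x : α} (hx : x ∈ Λ) :
    (stableSub φ D ℓ N T x).map (D t x : E →ₗ[ℝ] E) = stableSub φ D ℓ N T (φ t x) := by
  have key : ∀ t, ∀ x ∈ Λ, ∀ v ∈ stableSub φ D ℓ N T x, D t x v ∈ stableSub φ D ℓ N T (φ t x) := by
    rintro t x hx v ⟨hv, ht⟩
    refine ⟨by rw [h.ℓ_D t x hx, hv], ?_⟩
    obtain ⟨C, hC, hCb⟩ := h.D_bound t
    refine squeeze_zero (fun n => apply_nonneg _ _) (fun n : ℕ => ?_) (by simpa using ht.const_mul C)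
    rw [← h.D_add _ _ x hx, ← h.map_add _ _ x hx, add_comm, h.D_add _ _ x hx, h.map_add _ _ x hx]
    exact hCb _ (h.mem _ x hx) _
  refine le_antisymm ?_ fun v hv => ?_
  · rintro _ ⟨v, hv, rfl⟩
    exact key t x hx v hv
  · refine ⟨D (-t) (φ t x) v, ?_, ?_⟩
    · have := key (-t) _ (h.mem t x hx) v hv
      rwa [h.map_neg_map t hx] at this
    · have := h.D_D_neg t (h.mem t x hx) v
      rw [h.map_neg_map t hx] at this
      exact this

/-- The symplectic structure enters through a lower bound on the dimension of the space of vectors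
that stay bounded in the quotient norm: vectors in a complement eventually grow at a uniform rate,
so that the images of the complement under the cocycle become almost isotropic. -/
theorem le_finrank_boundedSub [FiniteDimensional ℝ E] (h : IsEnergyCocycle Λ φ D X ℓ N p) {T : ℝ}
    (hQ : ∀ x ∈ Λ, ∀ w, ℓ x w = 0 →
      2 * p x w ≤ max (p (φ T x) (D T x w)) (p (φ (-T) x) (D (-T) x w)))
    {d : ℕ} (hd : Module.finrank ℝ E = 2 * d) {Ω g : α → E →ₗ[ℝ] E →ₗ[ℝ] ℝ} {J : α → E →ₗ[ℝ] E}
    (hℓ : ∀ x ∈ Λ, ℓ x ≠ 0) (hp : ∀ x ∈ Λ, Continuous (p x))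
    (hΩ : ∀ t, ∀ x ∈ Λ, ∀ v w, Ω (φ t x) (D t x v) (D t x w) = Ω x v w)
    (hΩX : ∀ x ∈ Λ, ∀ v, Ω x (X x) v = ℓ x v) (hskew : ∀ x ∈ Λ, ∀ v w, Ω x v w = -Ω x w v)
    (hg : ∀ x ∈ Λ, ∀ v, g x v v = N x v ^ 2) (hgle : ∀ x ∈ Λ, ∀ v w, |g x v w| ≤ N x v * N x w)
    (hJ : ∀ x ∈ Λ, ∀ v w, g x (J x v) w = Ω x v w) {c C : ℝ} (hc : 0 < c) (hC : 0 < C)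
    (hcJ : ∀ x ∈ Λ, ∀ v, c * N x v ≤ N x (J x v)) (hCJ : ∀ x ∈ Λ, ∀ v, N x (J x v) ≤ C * N x v)
    {x : α} (hx : x ∈ Λ) : d ≤ Module.finrank ℝ (boundedSub φ D ℓ p T x) := by
  set S := boundedSub φ D ℓ p T x with hS
  set K := LinearMap.ker (ℓ x) with hK
  have hSK : S ≤ K := fun v hv => hv.1
  have hKrank : Module.finrank ℝ K + 1 = 2 * d := by
    rw [← hd, hK]
    have := LinearMap.finrank_range_add_finrank_ker (ℓ x)
    rw [LinearMap.range_eq_top.2 (LinearMap.surjective (hℓ x hx)), finrank_top,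
      Module.finrank_self] at this
    omega
  obtain ⟨U, hU⟩ := Submodule.exists_isCompl S
  set V := U ⊓ K with hV
  have hVS : Disjoint S V := hU.disjoint.mono_right inf_le_left
  have hVSK : S ⊔ V = K := by
    rw [hV, ← sup_inf_assoc_of_le U hSK, hU.sup_eq_top, top_inf_eq]
  have hVrank : Module.finrank ℝ S + Module.finrank ℝ V = Module.finrank ℝ K := by
    have := Submodule.finrank_sup_add_finrank_inf_eq S V
    rw [hVSK, hVS.eq_bot, finrank_bot, add_zero] at this
    exact this.symm
  set b : E → ℕ → ℝ := fun v n => p (φ (n * T) x) (D (n * T) x v) with hb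
  have hb0 : ∀ v n, 0 ≤ b v n := fun v n => apply_nonneg _ _
  have hbcont : ∀ n, Continuous fun v => b v n := fun n =>
    (hp _ (h.mem _ x hx)).comp (D (n * T) x).continuous
  have hbQ : ∀ v ∈ K, ∀ n, 2 * b v (n + 1) ≤ max (b v (n + 2)) (b v n) :=
    fun v hv n => h.two_mul_p_le hQ hx hv n
  have hgrow : ∀ v ∈ V, v ≠ 0 → ∃ n, b v n < b v (n + 1) := by
    intro v hv hv0
    by_contra! hcon
    apply hv0
    have hvS : v ∈ S := by
      refine ⟨hv.2, b v 0, fun n => ?_⟩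
      exact antitone_nat_of_succ_le hcon (Nat.zero_le n)
    exact (Submodule.disjoint_def.1 hVS) v hvS hv
  -- by compactness of the unit sphere of `V`, the growth starts at a uniform time
  have hunif : ∃ n₀, ∀ v ∈ V, v ≠ 0 → b v n₀ < b v (n₀ + 1) := by
    have hcomp : IsCompact ((V : Set E) ∩ Metric.sphere 0 1) :=
      (isCompact_sphere (0 : E) 1).inter_left V.closed_of_finiteDimensional
    obtain ⟨n₀, hn₀⟩ := hcomp.elim_directed_cover
      (fun n => {v | b v n < b v (n + 1)} ∪ (K : Set E)ᶜ)
      (fun n => (isOpen_lt (hbcont n) (hbcont (n + 1))).union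
        K.closed_of_finiteDimensional.isOpen_compl)
      (fun v hv => by
        obtain ⟨n, hn⟩ := hgrow v hv.1 (by
          rintro rfl
          have := hv.2
          simp at this)
        exact mem_iUnion.2 ⟨n, Or.inl hn⟩)
      (directed_of_isDirected_le (by
        intro n m hnm v hv
        rcases hv with hv | hv
        · by_cases hvK : v ∈ K
          · left
            obtain ⟨k, rfl⟩ := Nat.exists_eq_add_of_le hnm
            exact (two_pow_mul_le_of_lt (hb0 v) (hbQ v hvK) hv k).2
          · exact Or.inr hvK
        · exact Or.inr hv))
    refine ⟨n₀, fun v hv hv0 => ?_⟩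
    have hv' : ‖v‖⁻¹ • v ∈ (V : Set E) ∩ Metric.sphere 0 1 :=
      ⟨V.smul_mem _ hv, by simp [norm_smul, norm_ne_zero_iff.2 hv0]⟩
    rcases hn₀ hv' with h1 | h1
    · simp only [mem_ofPred_eq, hb, map_smul, map_smul_eq_mul] at h1
      exact lt_of_mul_lt_mul_left h1 (norm_nonneg _)
    · exact absurd (V.smul_mem _ hv).2 h1
  obtain ⟨n₀, hn₀⟩ := hunif
  set V' := V ⊔ Submodule.span ℝ {X x} with hV'
  have hXS : X x ∈ S := h.X_mem_boundedSub T hx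
  have hdisj' : Disjoint V (Submodule.span ℝ {X x}) :=
    (hVS.symm).mono_right ((Submodule.span_singleton_le_iff_mem _ _).2 hXS)
  have hV'rank : Module.finrank ℝ V' = Module.finrank ℝ V + 1 := by
    have := Submodule.finrank_sup_add_finrank_inf_eq V (Submodule.span ℝ {X x})
    rw [hdisj'.eq_bot, finrank_bot, add_zero, finrank_span_singleton (h.X_ne_zero hx)] at this
    exact this
  have hV'K : V' ≤ K := sup_le inf_le_right
    ((Submodule.span_singleton_le_iff_mem _ _).2 (h.ℓ_X x hx))
  have hV'grow : ∀ v ∈ V', ∀ k : ℕ, 2 ^ k * b v (n₀ + 1) ≤ b v (n₀ + 1 + k) := by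
    intro v hv k
    obtain ⟨u, hu, y, hy, rfl⟩ := Submodule.mem_sup.1 hv
    obtain ⟨s, rfl⟩ := Submodule.mem_span_singleton.1 hy
    have hbe : ∀ n, b (u + s • X x) n = b u n := fun n => h.p_D_add_smul _ hx u s
    rw [hbe, hbe]
    rcases eq_or_ne u 0 with rfl | hu0
    · simp [hb]
    · exact (two_pow_mul_le_of_lt (hb0 u) (hbQ u hu.2) (hn₀ u hu hu0) k).1
  -- on the kernel of `ℓ`, the form `Ω` is bounded by the quotient norm
  have hΩp : ∀ y ∈ Λ, ∀ v w, ℓ y v = 0 → ℓ y w = 0 → |Ω y v w| ≤ C * (p y v * p y w) := by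
    intro y hy v w hv hw
    obtain ⟨s, hs⟩ := h.exists_sub_smul y hy v
    obtain ⟨r, hr⟩ := h.exists_sub_smul y hy w
    have hXX : Ω y (X y) (X y) = 0 := by rw [hΩX y hy, h.ℓ_X y hy]
    have e : Ω y v w = Ω y (v - s • X y) (w - r • X y) := by
      have h1 : Ω y v (X y) = 0 := by rw [hskew y hy, hΩX y hy, hv, neg_zero]
      simp only [map_sub, map_smul, LinearMap.sub_apply, LinearMap.smul_apply, hΩX y hy, hw, h1,
        h.ℓ_X y hy, smul_zero, sub_zero]
    rw [e, ← hJ y hy, ← hs, ← hr, ← mul_assoc]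
    exact (hgle y hy _ _).trans (mul_le_mul_of_nonneg_right (hCJ y hy _) (apply_nonneg _ _))
  obtain ⟨k, hk⟩ := exists_pow_lt_of_lt_one (show 0 < c / C by positivity)
    (show (1 / 4 : ℝ) < 1 by norm_num)
  set t : ℝ := ((n₀ + 1 + k : ℕ) : ℝ) * T with ht
  have hinj : Function.Injective (D t x : E →ₗ[ℝ] E) := by
    rw [injective_iff_map_eq_zero]
    intro v hv
    have := h.D_neg_D t hx v
    have hv' : D t x v = 0 := hv
    rw [hv', _root_.map_zero] at this
    exact this.symm
  have hrank := finrank_le_of_almost_isotropic hd (N := N (φ t x))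
    (h.N_eq_zero _ (h.mem t x hx)) (hg _ (h.mem t x hx)) (hJ _ (h.mem t x hx))
    (ε := C * (1 / 4) ^ k) (c := c) (by positivity)
    (by rw [mul_comm]; exact (lt_div_iff₀ hC).1 hk) (hcJ _ (h.mem t x hx))
    (W := V'.map (D t x : E →ₗ[ℝ] E)) (by
      rintro _ ⟨v, hv, rfl⟩ _ ⟨w, hw, rfl⟩
      set t₁ : ℝ := ((n₀ + 1 : ℕ) : ℝ) * T with ht₁
      have e1 : Ω (φ t x) (D t x v) (D t x w) = Ω (φ t₁ x) (D t₁ x v) (D t₁ x w) := by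
        rw [hΩ t x hx, hΩ t₁ x hx]
      have h1 := hΩp _ (h.mem t₁ x hx) (D t₁ x v) (D t₁ x w)
        (by rw [h.ℓ_D _ x hx]; exact hV'K hv) (by rw [h.ℓ_D _ x hx]; exact hV'K hw)
      have h2 : 2 ^ k * p (φ t₁ x) (D t₁ x v) ≤ N (φ t x) (D t x v) :=
        (hV'grow v hv k).trans (h.p_le _ (h.mem t x hx) _)
      have h3 : 2 ^ k * p (φ t₁ x) (D t₁ x w) ≤ N (φ t x) (D t x w) :=
        (hV'grow w hw k).trans (h.p_le _ (h.mem t x hx) _)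
      have h4 := mul_le_mul h2 h3 (mul_nonneg (by positivity) (apply_nonneg _ _))
        (apply_nonneg _ _)
      change |Ω (φ t x) (D t x v) (D t x w)| ≤ _ * (N (φ t x) (D t x v) * N (φ t x) (D t x w))
      rw [e1]
      refine h1.trans ?_
      have e2 : C * (p (φ t₁ x) (D t₁ x v) * p (φ t₁ x) (D t₁ x w))
          = C * (1 / 4) ^ k * (2 ^ k * p (φ t₁ x) (D t₁ x v) * (2 ^ k * p (φ t₁ x) (D t₁ x w))) := by
        have : (1 / 4 : ℝ) ^ k * (2 ^ k * 2 ^ k) = 1 := by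
          rw [← mul_pow, ← mul_pow]; norm_num
        linear_combination (-(C * p (φ t₁ x) (D t₁ x v) * p (φ t₁ x) (D t₁ x w))) * this
      rw [e2]
      exact mul_le_mul_of_nonneg_left h4 (by positivity))
  rw [← (Submodule.equivMapOfInjective _ hinj _).finrank_eq, hV'rank] at hrank
  omega

theorem p_eq_zero_of_mem_inf (h : IsEnergyCocycle Λ φ D X ℓ N p) {T : ℝ}
    (hQ : ∀ x ∈ Λ, ∀ w, ℓ x w = 0 →
      2 * p x w ≤ max (p (φ T x) (D T x w)) (p (φ (-T) x) (D (-T) x w)))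
    {x : α} (hx : x ∈ Λ) {v : E} (hv : v ∈ boundedSub φ D ℓ p T x)
    (hv' : v ∈ boundedSub (fun t => φ (-t)) (fun t => D (-t)) ℓ p T x) : p x v = 0 := by
  have h1 := h.p_le_two_pow hQ hx hv 1
  have h2 := h.reverse.p_le_two_pow (T := T) (fun x hx w hw => by
    simpa [max_comm] using hQ x hx w hw) hx hv' 1
  have h3 := hQ x hx v hv.1
  simp only [Nat.cast_one, one_mul, pow_one] at h1 h2
  have h4 := max_le h1 h2
  linarith [apply_nonneg (p x) v]

theorem iSupIndep_three {A B C : Submodule ℝ E}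
    (h : ∀ a ∈ A, ∀ b ∈ B, ∀ c ∈ C, a + b + c = 0 → a = 0 ∧ b = 0 ∧ c = 0) :
    iSupIndep ![A, B, C] := by
  rw [iSupIndep_iff_finsetSum_eq_zero_imp_eq_zero]
  intro s v hv hsum i hi
  set w : Fin 3 → E := fun i => if i ∈ s then v i else 0 with hw
  have hwmem : ∀ i, w i ∈ ![A, B, C] i := by
    intro i
    by_cases hi : i ∈ s
    · simp only [hw, hi, if_true]; exact hv i hi
    · simp only [hw, hi, if_false]; exact Submodule.zero_mem _
  have hwsum : w 0 + w 1 + w 2 = 0 := by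
    rw [← Fin.sum_univ_three, hw, Finset.sum_ite_mem, Finset.univ_inter]
    exact hsum
  have := h (w 0) (hwmem 0) (w 1) (hwmem 1) (w 2) (hwmem 2) hwsum
  have hwi : w i = 0 := by
    fin_cases i
    · exact this.1
    · exact this.2.1
    · exact this.2.2
  simpa [hw, hi] using hwi

/-- Growth of the quotient norm, in the presence of an invariant symplectic structure, implies the
existence of a hyperbolic splitting. -/
theorem exists_hyperbolic_splitting [FiniteDimensional ℝ E] (h : IsEnergyCocycle Λ φ D X ℓ N p)
    {T : ℕ} (hT : 0 < T)
    (hQ : ∀ x ∈ Λ, ∀ w, ℓ x w = 0 →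
      2 * p x w ≤ max (p (φ T x) (D T x w)) (p (φ (-T) x) (D (-T) x w)))
    {d : ℕ} (hd : Module.finrank ℝ E = 2 * d) {Ω g : α → E →ₗ[ℝ] E →ₗ[ℝ] ℝ} {J : α → E →ₗ[ℝ] E}
    (hℓ : ∀ x ∈ Λ, ℓ x ≠ 0) (hp : ∀ x ∈ Λ, Continuous (p x))
    (hΩ : ∀ t, ∀ x ∈ Λ, ∀ v w, Ω (φ t x) (D t x v) (D t x w) = Ω x v w)
    (hΩX : ∀ x ∈ Λ, ∀ v, Ω x (X x) v = ℓ x v) (hskew : ∀ x ∈ Λ, ∀ v w, Ω x v w = -Ω x w v)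
    (hg : ∀ x ∈ Λ, ∀ v, g x v v = N x v ^ 2) (hgle : ∀ x ∈ Λ, ∀ v w, |g x v w| ≤ N x v * N x w)
    (hJ : ∀ x ∈ Λ, ∀ v w, g x (J x v) w = Ω x v w) {c C : ℝ} (hc : 0 < c) (hC : 0 < C)
    (hcJ : ∀ x ∈ Λ, ∀ v, c * N x v ≤ N x (J x v)) (hCJ : ∀ x ∈ Λ, ∀ v, N x (J x v) ≤ C * N x v) :
    ∃ (m : ℕ) (Em Ep : α → Submodule ℝ E), 0 < m ∧ ∀ x ∈ Λ,
      iSupIndep ![Em x, Submodule.span ℝ {X x}, Ep x] ∧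
      Em x ⊔ Submodule.span ℝ {X x} ⊔ Ep x = LinearMap.ker (ℓ x) ∧
      (∀ t, (Em x).map (D t x : E →ₗ[ℝ] E) = Em (φ t x) ∧
        (Ep x).map (D t x : E →ₗ[ℝ] E) = Ep (φ t x)) ∧
      (∀ v ∈ Em x, N (φ m x) (D m x v) ≤ 1 / 2 * N x v) ∧
      (∀ v ∈ Ep x, N (φ (-m) x) (D (-m) x v) ≤ 1 / 2 * N x v) := by
  have hr := h.reverse
  have hQr : ∀ x ∈ Λ, ∀ w, ℓ x w = 0 → 2 * p x w ≤ max (p ((fun t => φ (-t)) T x)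
      ((fun t => D (-t)) T x w)) (p ((fun t => φ (-t)) (-T) x) ((fun t => D (-t)) (-T) x w)) :=
    fun x hx w hw => by simpa [max_comm] using hQ x hx w hw
  obtain ⟨C₁, hC₁, hcon₁⟩ := h.exists_stable_contraction hQ
  obtain ⟨C₂, hC₂, hcon₂⟩ := hr.exists_stable_contraction hQr
  obtain ⟨n, hn⟩ := pow_unbounded_of_one_lt (2 * max C₁ C₂) (one_lt_two (α := ℝ))
  have hn' : (2 : ℝ) ^ n ≤ 2 ^ (n + 1) := pow_le_pow_right₀ one_le_two (Nat.le_succ n)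
  have hsmall : ∀ C' ≤ max C₁ C₂, ∀ y : ℝ, 0 ≤ y → C' * y / 2 ^ (n + 1) ≤ 1 / 2 * y := by
    intro C' hC' y hy
    rw [div_le_iff₀ (by positivity)]
    nlinarith
  refine ⟨(n + 1) * T, fun x => stableSub φ D ℓ N T x,
    fun x => stableSub (fun t => φ (-t)) (fun t => D (-t)) ℓ N T x, by positivity, fun x hx => ?_⟩
  have hd₁ := h.le_finrank_boundedSub hQ hd hℓ hp hΩ hΩX hskew hg hgle hJ hc hC hcJ hCJ hx
  have hd₂ := hr.le_finrank_boundedSub hQr hd hℓ hp (fun t => hΩ (-t)) hΩX hskew hg hgle hJ hc hC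
    hcJ hCJ hx
  set S₁ := boundedSub φ D ℓ p T x with hS₁
  set S₂ := boundedSub (fun t => φ (-t)) (fun t => D (-t)) ℓ p T x with hS₂
  have hinf : S₁ ⊓ S₂ ≤ Submodule.span ℝ {X x} := by
    rintro v ⟨hv₁, hv₂⟩
    obtain ⟨s, rfl⟩ := h.eq_smul_of_p_eq_zero hx (h.p_eq_zero_of_mem_inf hQ hx hv₁ hv₂)
    exact Submodule.smul_mem _ _ (Submodule.mem_span_singleton_self _)
  have hsup : S₁ ⊔ S₂ = LinearMap.ker (ℓ x) := by
    refine Submodule.eq_of_le_of_finrank_le (sup_le (fun v hv => hv.1) (fun v hv => hv.1)) ?_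
    have h1 := Submodule.finrank_sup_add_finrank_inf_eq S₁ S₂
    have h2 := Submodule.finrank_mono hinf
    rw [finrank_span_singleton (h.X_ne_zero hx)] at h2
    have h3 := LinearMap.finrank_range_add_finrank_ker (ℓ x)
    rw [LinearMap.range_eq_top.2 (LinearMap.surjective (hℓ x hx)), finrank_top,
      Module.finrank_self] at h3
    omega
  refine ⟨?_, ?_, ?_, ?_, ?_⟩
  · refine iSupIndep_three ?_
    rintro a ha _ hb c hc habc
    obtain ⟨s, rfl⟩ := Submodule.mem_span_singleton.1 hb
    have ha₁ := h.stableSub_le_boundedSub T hx ha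
    have hc₂ := hr.stableSub_le_boundedSub T hx hc
    have hX₁ := (S₁).smul_mem s (h.X_mem_boundedSub T hx)
    have hX₂ := (S₂).smul_mem s (hr.X_mem_boundedSub T hx)
    have ha₂ : a ∈ S₂ := by
      have : a = -(s • X x) - c := by
        rw [eq_sub_iff_add_eq, eq_neg_iff_add_eq_zero, ← habc]; abel
      rw [this]
      exact S₂.sub_mem (S₂.neg_mem hX₂) hc₂
    have hc₁ : c ∈ S₁ := by
      have : c = -(s • X x) - a := by
        rw [eq_sub_iff_add_eq, eq_neg_iff_add_eq_zero, ← habc]; abel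
      rw [this]
      exact S₁.sub_mem (S₁.neg_mem hX₁) ha₁
    obtain ⟨s₁, rfl⟩ := h.eq_smul_of_p_eq_zero hx (h.p_eq_zero_of_mem_inf hQ hx ha₁ ha₂)
    obtain ⟨s₂, rfl⟩ := h.eq_smul_of_p_eq_zero hx (h.p_eq_zero_of_mem_inf hQ hx hc₁ hc₂)
    rw [h.smul_X_mem_stableSub hx ha, hr.smul_X_mem_stableSub hx hc] at *
    simpa using habc
  · have hle : ∀ v ∈ stableSub φ D ℓ N T x, v ∈ LinearMap.ker (ℓ x) := fun v hv => hv.1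
    refine le_antisymm (sup_le (sup_le hle ?_) fun v hv => hv.1) ?_
    · exact (Submodule.span_singleton_le_iff_mem _ _).2 (h.ℓ_X x hx)
    · rw [← hsup]
      refine sup_le ((h.boundedSub_le hQ hx).trans le_sup_left) ?_
      refine (hr.boundedSub_le hQr hx).trans (sup_le le_sup_right ?_)
      exact le_sup_right.trans le_sup_left
  · intro t
    refine ⟨h.map_stableSub T t hx, ?_⟩
    have := hr.map_stableSub T (-t) hx
    simpa using this
  · intro v hv
    have := hcon₁ x hx v hv (n + 1)
    rw [← Nat.cast_mul] at this
    exact this.trans (hsmall _ (le_max_left _ _) _ (apply_nonneg _ _))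
  · intro v hv
    have := hcon₂ x hx v hv (n + 1)
    rw [← Nat.cast_mul] at this
    exact this.trans (hsmall _ (le_max_right _ _) _ (apply_nonneg _ _))

end IsEnergyCocycle

end Cocycle

/-! ### Tangent vectors and bilinear forms in coordinates -/

section Coordinates

open Set Filter Bundle

variable {E : Type*} [NormedAddCommGroup E] [NormedSpace ℝ E]
  {B : Type*} [TopologicalSpace B] {I : ModelWithCorners ℝ E B}
  {M : Type*} [TopologicalSpace M] [ChartedSpace B M]

variable (I) in
/-- The derivative at `x` of the chart around `x₀`, as an endomorphism of the model space. -/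
def toCoord (x₀ x : M) : E →L[ℝ] E := mfderiv I 𝓘(ℝ, E) (extChartAt I x₀) x

variable (I) in
/-- The derivative at `y` of the inverse of the chart around `x₀`. -/
def ofCoord (x₀ : M) (y : E) : E →L[ℝ] E :=
  mfderivWithin 𝓘(ℝ, E) I (extChartAt I x₀).symm (range I) y

variable (I) in
/-- The interior of the range of the chart around `x₀`. -/
def chartInterior (x₀ : M) : Set E := interior (extChartAt I x₀).target

theorem isOpen_chartInterior (x₀ : M) : IsOpen (chartInterior I x₀) := isOpen_interior

theorem chartInterior_subset (x₀ : M) : chartInterior I x₀ ⊆ (extChartAt I x₀).target :=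
  interior_subset

theorem chartInterior_subset_range (x₀ : M) : chartInterior I x₀ ⊆ range I :=
  (chartInterior_subset x₀).trans (extChartAt_target_subset_range x₀)

theorem range_mem_nhds_of_mem_chartInterior {x₀ : M} {y : E} (hy : y ∈ chartInterior I x₀) :
    range I ∈ 𝓝 y :=
  mem_of_superset ((isOpen_chartInterior x₀).mem_nhds hy) (chartInterior_subset_range x₀)

variable (I) in
/-- The part of the domain of the chart around `x₀` that is mapped into the interior. -/
def chartDomain (x₀ : M) : Set M :=
  (extChartAt I x₀).source ∩ extChartAt I x₀ ⁻¹' chartInterior I x₀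

theorem isOpen_chartDomain (x₀ : M) : IsOpen (chartDomain I x₀) := by
  have := isOpen_extChartAt_preimage (I := I) x₀ (isOpen_chartInterior (I := I) x₀)
  rwa [← extChartAt_source I] at this

theorem mem_chart_of_mem_chartDomain {x₀ x : M} (hx : x ∈ chartDomain I x₀) :
    x ∈ (chartAt B x₀).source := by rw [← extChartAt_source I]; exact hx.1

theorem symm_mem_chartDomain {x₀ : M} {y : E} (hy : y ∈ chartInterior I x₀) :
    (extChartAt I x₀).symm y ∈ chartDomain I x₀ := by
  refine ⟨(extChartAt I x₀).map_target (chartInterior_subset x₀ hy), ?_⟩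
  rw [mem_preimage, (extChartAt I x₀).right_inv (chartInterior_subset x₀ hy)]
  exact hy

theorem self_mem_chartDomain {x₀ : M} (hx : x₀ ∈ I.interior M) : x₀ ∈ chartDomain I x₀ :=
  ⟨mem_extChartAt_source x₀, I.isInteriorPoint_iff.1 hx⟩

theorem chart_symm_chart {x₀ x : M} (hx : x ∈ chartDomain I x₀) :
    (extChartAt I x₀).symm (extChartAt I x₀ x) = x := (extChartAt I x₀).left_inv hx.1

theorem chart_chart_symm {x₀ : M} {y : E} (hy : y ∈ chartInterior I x₀) :
    extChartAt I x₀ ((extChartAt I x₀).symm y) = y :=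
  (extChartAt I x₀).right_inv (chartInterior_subset x₀ hy)

theorem continuousAt_chart {x₀ x : M} (hx : x ∈ chartDomain I x₀) :
    ContinuousAt (extChartAt I x₀) x := continuousAt_extChartAt' hx.1

theorem continuousAt_chart_symm {x₀ : M} {y : E} (hy : y ∈ chartInterior I x₀) :
    ContinuousAt (extChartAt I x₀).symm y := continuousAt_extChartAt_symm'' (chartInterior_subset x₀ hy)

section

variable [IsManifold I ∞ M]

theorem ofCoord_toCoord {x₀ : M} {x : M} (hx : x ∈ chartDomain I x₀) (v : E) :
    ofCoord I x₀ (extChartAt I x₀ x) (toCoord I x₀ x v) = v := by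
  have := mfderivWithin_extChartAt_symm_comp_mfderiv_extChartAt' (I := I) hx.1
  exact congrArg (fun A : E →L[ℝ] E => A v) this

theorem toCoord_ofCoord {x₀ : M} {y : E} (hy : y ∈ chartInterior I x₀) (u : E) :
    toCoord I x₀ ((extChartAt I x₀).symm y) (ofCoord I x₀ y u) = u := by
  have := mfderiv_extChartAt_comp_mfderivWithin_extChartAt_symm (I := I)
    (chartInterior_subset x₀ hy)
  exact congrArg (fun A : E →L[ℝ] E => A u) this

theorem toCoord_ofCoord' {x₀ x : M} (hx : x ∈ chartDomain I x₀) (u : E) :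
    toCoord I x₀ x (ofCoord I x₀ (extChartAt I x₀ x) u) = u := by
  have := toCoord_ofCoord (I := I) (y := extChartAt I x₀ x) hx.2 u
  rwa [chart_symm_chart hx] at this

theorem hasMFDerivAt_chart {x₀ x : M} (hx : x ∈ chartDomain I x₀) :
    HasMFDerivAt I 𝓘(ℝ, E) (extChartAt I x₀) x (toCoord I x₀ x :) :=
  (mdifferentiableAt_extChartAt (mem_chart_of_mem_chartDomain hx)).hasMFDerivAt

theorem hasMFDerivAt_chart_symm {x₀ : M} {y : E} (hy : y ∈ chartInterior I x₀) :
    HasMFDerivAt 𝓘(ℝ, E) I (extChartAt I x₀).symm y (ofCoord I x₀ y :) :=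
  (mdifferentiableWithinAt_extChartAt_symm (chartInterior_subset x₀ hy)).hasMFDerivWithinAt.hasMFDerivAt
    (range_mem_nhds_of_mem_chartInterior hy)

theorem trivializationAt_snd {x₀ x : M} (hx : x ∈ (chartAt B x₀).source) (v : TangentSpace I x) :
    (trivializationAt E (TangentSpace I) x₀ ⟨x, v⟩).2 = toCoord I x₀ x v := by
  have h1 := TangentBundle.continuousLinearMapAt_trivializationAt (I := I) (𝕜 := ℝ) hx
  have h2 : (trivializationAt E (TangentSpace I) x₀).continuousLinearMapAt ℝ x v
      = (trivializationAt E (TangentSpace I) x₀ ⟨x, v⟩).2 := by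
    rw [Trivialization.continuousLinearMapAt_apply, Trivialization.coe_linearMapAt_of_mem]
    exact hx
  rw [← h2, h1]
  rfl

/-- Convergence in the tangent bundle, in terms of the coordinates around `x₀`. -/
theorem tendsto_tangentBundle_iff {ι : Type*} {l : Filter ι} {f : ι → TangentBundle I M}
    {z : TangentBundle I M} {x₀ : M} (hz : z.1 ∈ chartDomain I x₀) :
    Tendsto f l (𝓝 z) ↔ Tendsto (fun i => (f i).1) l (𝓝 z.1) ∧
      Tendsto (fun i => toCoord I x₀ (f i).1 (f i).2) l (𝓝 (toCoord I x₀ z.1 z.2)) := by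
  have hz' : z ∈ (trivializationAt E (TangentSpace I) x₀).source := by
    rw [TangentBundle.trivializationAt_source]
    exact mem_chart_of_mem_chartDomain hz
  rw [Trivialization.tendsto_nhds_iff _ hz']
  refine and_congr_right fun h => ?_
  have hev : ∀ᶠ i in l, (f i).1 ∈ chartDomain I x₀ :=
    h.eventually ((isOpen_chartDomain x₀).mem_nhds hz)
  rw [← trivializationAt_snd (I := I) (mem_chart_of_mem_chartDomain hz) z.2]
  refine tendsto_congr' ?_
  filter_upwards [hev] with i hi
  exact trivializationAt_snd (mem_chart_of_mem_chartDomain hi) _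

theorem symm_trivializationAt {x₀ : M} {y : E} (hy : y ∈ chartInterior I x₀) (u : E) :
    (trivializationAt E (TangentSpace I) x₀).toOpenPartialHomeomorph.symm
      ((extChartAt I x₀).symm y, u) = ⟨(extChartAt I x₀).symm y, ofCoord I x₀ y u⟩ := by
  have hx := mem_chart_of_mem_chartDomain (symm_mem_chartDomain hy)
  rw [← Trivialization.mk_symm _ (by exact hx)]
  have h1 := TangentBundle.symmL_trivializationAt (I := I) (𝕜 := ℝ) hx
  rw [chart_chart_symm hy] at h1
  have h2 : (trivializationAt E (TangentSpace I) x₀).symm ((extChartAt I x₀).symm y) u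
      = (trivializationAt E (TangentSpace I) x₀).symmL ℝ ((extChartAt I x₀).symm y) u := by
    rw [Trivialization.symmL_apply]
    exact hx
  rw [h2, h1]
  rfl

theorem contMDiffOn_ofCoord (x₀ : M) (u : E) :
    ContMDiffOn 𝓘(ℝ, E) (I.prod 𝓘(ℝ, E)) ∞
      (fun y => (⟨(extChartAt I x₀).symm y, ofCoord I x₀ y u⟩ : TangentBundle I M))
      (chartInterior I x₀) := by
  have h1 : ContMDiffOn 𝓘(ℝ, E) I ∞ (extChartAt I x₀).symm (chartInterior I x₀) :=
    (contMDiffOn_extChartAt_symm x₀).mono (chartInterior_subset x₀)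
  have h2 : ContMDiffOn 𝓘(ℝ, E) (I.prod 𝓘(ℝ, E)) ∞
      (fun y => ((extChartAt I x₀).symm y, u)) (chartInterior I x₀) :=
    h1.prodMk contMDiffOn_const
  have h3 := (Trivialization.contMDiffOn_symm (n := ∞) (IB := I)
    (trivializationAt E (TangentSpace I : M → Type _) x₀)).comp h2 (fun y hy => by
      rw [mem_preimage, TangentBundle.trivializationAt_target]
      exact ⟨mem_chart_of_mem_chartDomain (symm_mem_chartDomain hy), mem_univ _⟩)
  exact h3.congr fun y hy => (symm_trivializationAt hy u).symm

/-- The coefficients of a smooth field of bilinear forms are smooth. -/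
theorem contDiffOn_coordForm (b : ∀ x : M, TangentSpace I x →L[ℝ] TangentSpace I x →L[ℝ] ℝ)
    (hb : ContMDiff I (I.prod 𝓘(ℝ, E →L[ℝ] E →L[ℝ] ℝ)) ∞
      (fun x ↦ Bundle.TotalSpace.mk' (E →L[ℝ] E →L[ℝ] ℝ)
      (E := fun x : M ↦ TangentSpace I x →L[ℝ] TangentSpace I x →L[ℝ] ℝ) x (b x)))
    (x₀ : M) (u v : E) : ContDiffOn ℝ ∞ (coordForm b x₀ u v) (chartInterior I x₀) := by
  rw [← contMDiffOn_iff_contDiffOn]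
  intro y hy
  have h1 : ContMDiffOn 𝓘(ℝ, E) I ∞ (extChartAt I x₀).symm (chartInterior I x₀) :=
    (contMDiffOn_extChartAt_symm x₀).mono (chartInterior_subset x₀)
  have : ContMDiffWithinAt 𝓘(ℝ, E) (I.prod 𝓘(ℝ, ℝ)) ∞
      (fun y ↦ Bundle.TotalSpace.mk' ℝ (E := Bundle.Trivial M ℝ) ((extChartAt I x₀).symm y)
        (b ((extChartAt I x₀).symm y) (ofCoord I x₀ y u) (ofCoord I x₀ y v)))
      (chartInterior I x₀) y := by
    apply ContMDiffWithinAt.clm_bundle_apply₂ (F₁ := E) (F₂ := E) (E₁ := (TangentSpace I : M → Type _))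
      (E₂ := (TangentSpace I : M → Type _))
    · exact ContMDiffAt.comp_contMDiffWithinAt y hb.contMDiffAt (h1 y hy)
    · exact contMDiffOn_ofCoord x₀ u y hy
    · exact contMDiffOn_ofCoord x₀ v y hy
  simp only [contMDiffWithinAt_totalSpace] at this
  exact this.2

end

/-- The field of bilinear forms `b` in the coordinates around `x₀`. -/
def coordBilin (b : ∀ x : M, TangentSpace I x →L[ℝ] TangentSpace I x →L[ℝ] ℝ) (x₀ : M) (y : E) :
    E →L[ℝ] E →L[ℝ] ℝ :=
  let β : E →L[ℝ] E →L[ℝ] ℝ := b ((extChartAt I x₀).symm y)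
  β.bilinearComp (ofCoord I x₀ y) (ofCoord I x₀ y)

theorem contDiffOn_coordBilin [IsManifold I ∞ M] [FiniteDimensional ℝ E]
    (b : ∀ x : M, TangentSpace I x →L[ℝ] TangentSpace I x →L[ℝ] ℝ)
    (hb : ContMDiff I (I.prod 𝓘(ℝ, E →L[ℝ] E →L[ℝ] ℝ)) ∞
      (fun x ↦ Bundle.TotalSpace.mk' (E →L[ℝ] E →L[ℝ] ℝ)
      (E := fun x : M ↦ TangentSpace I x →L[ℝ] TangentSpace I x →L[ℝ] ℝ) x (b x)))
    (x₀ : M) : ContDiffOn ℝ ∞ (coordBilin b x₀) (chartInterior I x₀) := by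
  rw [contDiffOn_clm_apply]
  intro u
  rw [contDiffOn_clm_apply]
  intro v
  exact contDiffOn_coordForm b hb x₀ u v

theorem coordBilin_toCoord [IsManifold I ∞ M]
    (b : ∀ x : M, TangentSpace I x →L[ℝ] TangentSpace I x →L[ℝ] ℝ)
    {x₀ x : M} (hx : x ∈ chartDomain I x₀) (v w : E) :
    coordBilin b x₀ (extChartAt I x₀ x) (toCoord I x₀ x v) (toCoord I x₀ x w)
      = b x v w := by
  change b ((extChartAt I x₀).symm (extChartAt I x₀ x))
    (ofCoord I x₀ (extChartAt I x₀ x) (toCoord I x₀ x v))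
    (ofCoord I x₀ (extChartAt I x₀ x) (toCoord I x₀ x w)) = _
  rw [ofCoord_toCoord hx, ofCoord_toCoord hx, chart_symm_chart hx]

/-- A nondegenerate bilinear form on a finite-dimensional space, as an isomorphism onto the dual. -/
theorem isInvertible_of_nondegenerate [FiniteDimensional ℝ E] {b : E →L[ℝ] E →L[ℝ] ℝ}
    (hb : ∀ v, (∀ w, b v w = 0) → v = 0) : b.IsInvertible := by
  have hinj : Function.Injective (b : E →ₗ[ℝ] (E →L[ℝ] ℝ)) :=
    (injective_iff_map_eq_zero _).2 fun v hv => hb v fun w => by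
      have : b v = 0 := hv
      rw [this]; rfl
  have hfr : Module.finrank ℝ E = Module.finrank ℝ (E →L[ℝ] ℝ) := by
    rw [← (LinearMap.toContinuousLinearMap (𝕜 := ℝ) (E := E) (F' := ℝ)).finrank_eq]
    exact (Subspace.dual_finrank_eq).symm
  refine ⟨(LinearEquiv.ofInjectiveOfFinrankEq (b : E →ₗ[ℝ] (E →L[ℝ] ℝ)) hinj
    hfr).toContinuousLinearEquiv, ?_⟩
  ext v w
  rfl

theorem isInvertible_coordBilin [IsManifold I ∞ M] [FiniteDimensional ℝ E]
    {b : ∀ x : M, TangentSpace I x →L[ℝ] TangentSpace I x →L[ℝ] ℝ}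
    (hb : ∀ x v, (∀ w, b x v w = 0) → v = 0) {x₀ : M} {y : E} (hy : y ∈ chartInterior I x₀) :
    (coordBilin b x₀ y).IsInvertible := by
  refine isInvertible_of_nondegenerate fun v hv => ?_
  have h0 : ofCoord I x₀ y v = 0 := by
    refine hb ((extChartAt I x₀).symm y) (ofCoord I x₀ y v) fun w => ?_
    have := hv (toCoord I x₀ ((extChartAt I x₀).symm y) w)
    change b ((extChartAt I x₀).symm y) (ofCoord I x₀ y v)
      (ofCoord I x₀ y (toCoord I x₀ ((extChartAt I x₀).symm y) w)) = 0 at this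
    have h2 := ofCoord_toCoord (I := I) (symm_mem_chartDomain hy) w
    rw [chart_chart_symm hy] at h2
    rwa [h2] at this
  rw [← toCoord_ofCoord hy v, h0, map_zero]

/-- The inverse of the coordinate expression of a field of nondegenerate bilinear forms is
smooth. -/
theorem contDiffOn_inverse_coordBilin [IsManifold I ∞ M] [FiniteDimensional ℝ E]
    {b : ∀ x : M, TangentSpace I x →L[ℝ] TangentSpace I x →L[ℝ] ℝ}
    (hb : ContMDiff I (I.prod 𝓘(ℝ, E →L[ℝ] E →L[ℝ] ℝ)) ∞
      (fun x ↦ Bundle.TotalSpace.mk' (E →L[ℝ] E →L[ℝ] ℝ)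
      (E := fun x : M ↦ TangentSpace I x →L[ℝ] TangentSpace I x →L[ℝ] ℝ) x (b x)))
    (hb' : ∀ x v, (∀ w, b x v w = 0) → v = 0) (x₀ : M) :
    ContDiffOn ℝ ∞ (fun y => (coordBilin b x₀ y).inverse) (chartInterior I x₀) := by
  intro y hy
  obtain ⟨e, he⟩ := isInvertible_coordBilin hb' hy
  have h1 : ContDiffAt ℝ ∞ ContinuousLinearMap.inverse (coordBilin b x₀ y) := by
    rw [← he]; exact contDiffAt_map_inverse e
  exact h1.comp_contDiffWithinAt y (contDiffOn_coordBilin b hb x₀ y hy)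

end Coordinates

/-! ### Hamiltonians and Hamiltonian vector fields in coordinates -/

section CoordinateHamiltonian

open Set Filter Bundle

variable {E : Type*} [NormedAddCommGroup E] [NormedSpace ℝ E]
  {B : Type*} [TopologicalSpace B] {I : ModelWithCorners ℝ E B}
  {M : Type*} [TopologicalSpace M] [ChartedSpace B M]

/-- The Hamiltonian `H` in the coordinates around `x₀`. -/
def coordHam (H : Hamiltonian I M) (x₀ : M) (y : E) : ℝ := H ((extChartAt I x₀).symm y)

theorem contDiffOn_coordHam [IsManifold I ∞ M] (H : Hamiltonian I M) (x₀ : M) :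
    ContDiffOn ℝ 2 (coordHam H x₀) (chartInterior I x₀) := by
  rw [← contMDiffOn_iff_contDiffOn]
  exact H.contMDiff'.comp_contMDiffOn
    ((contMDiffOn_extChartAt_symm x₀).mono (chartInterior_subset x₀))

theorem contDiffAt_coordHam [IsManifold I ∞ M] (H : Hamiltonian I M) {x₀ : M} {y : E}
    (hy : y ∈ chartInterior I x₀) : ContDiffAt ℝ 2 (coordHam H x₀) y :=
  (contDiffOn_coordHam H x₀).contDiffAt ((isOpen_chartInterior x₀).mem_nhds hy)

theorem contDiffAt_fderiv_coordHam [IsManifold I ∞ M] (H : Hamiltonian I M) {x₀ : M} {y : E}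
    (hy : y ∈ chartInterior I x₀) : ContDiffAt ℝ 1 (fderiv ℝ (coordHam H x₀)) y :=
  (contDiffAt_coordHam H hy).fderiv_right (m := 1) (by norm_num)

theorem differentiableAt_coordHam [IsManifold I ∞ M] (H : Hamiltonian I M) {x₀ : M} {y : E}
    (hy : y ∈ chartInterior I x₀) : DifferentiableAt ℝ (coordHam H x₀) y :=
  (contDiffAt_coordHam H hy).differentiableAt (by norm_num)

theorem mdifferentiableAt_ham (H : Hamiltonian I M) (x : M) :
    MDifferentiableAt I 𝓘(ℝ, ℝ) (H : M → ℝ) x :=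
  H.contMDiff'.mdifferentiableAt (by norm_num)

theorem dHam_ofCoord [IsManifold I ∞ M] (H : Hamiltonian I M) {x₀ : M} {y : E}
    (hy : y ∈ chartInterior I x₀) (u : E) :
    dHam H ((extChartAt I x₀).symm y) (ofCoord I x₀ y u) = fderiv ℝ (coordHam H x₀) y u := by
  have h1 := HasMFDerivAt.comp y
    (mdifferentiableAt_ham H ((extChartAt I x₀).symm y)).hasMFDerivAt (hasMFDerivAt_chart_symm hy)
  let A : E →L[ℝ] ℝ := mfderiv I 𝓘(ℝ, ℝ) H ((extChartAt I x₀).symm y)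
  have h2 : HasFDerivAt (coordHam H x₀) (A.comp (ofCoord I x₀ y)) y := h1.hasFDerivAt
  rw [h2.fderiv]
  rfl

theorem dHam_toCoord [IsManifold I ∞ M] (H : Hamiltonian I M) {x₀ x : M}
    (hx : x ∈ chartDomain I x₀) (v : E) :
    fderiv ℝ (coordHam H x₀) (extChartAt I x₀ x) (toCoord I x₀ x v) = dHam H x v := by
  rw [← dHam_ofCoord H hx.2, ofCoord_toCoord hx, chart_symm_chart hx]

section

variable [FiniteDimensional ℝ E] [IsManifold I ∞ M]

/-- The Hamiltonian vector field in the coordinates around `x₀`. -/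
def coordVF (σ : SymplecticForm I M) (H : Hamiltonian I M) (x₀ : M) (y : E) : E :=
  (coordBilin σ.form x₀ y).inverse (fderiv ℝ (coordHam H x₀) y)

theorem coordBilin_coordVF (σ : SymplecticForm I M) (H : Hamiltonian I M) {x₀ : M} {y : E}
    (hy : y ∈ chartInterior I x₀) (u : E) :
    coordBilin σ.form x₀ y (coordVF σ H x₀ y) u = fderiv ℝ (coordHam H x₀) y u := by
  obtain ⟨e, he⟩ := isInvertible_coordBilin σ.nondeg hy
  rw [coordVF, ← he, ContinuousLinearMap.inverse_equiv]
  exact congrArg (fun A : E →L[ℝ] ℝ => A u) (e.apply_symm_apply _)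

omit [FiniteDimensional ℝ E] in
theorem form_left_injective (σ : SymplecticForm I M) (x : M) {v w : TangentSpace I x}
    (h : ∀ u, σ.form x v u = σ.form x w u) : v = w := by
  refine sub_eq_zero.1 (σ.nondeg x _ fun u => ?_)
  rw [map_sub, sub_apply, h u, sub_self]

theorem hamVF_eq_ofCoord (σ : SymplecticForm I M) (H : Hamiltonian I M) {x₀ : M} {y : E}
    (hy : y ∈ chartInterior I x₀) :
    hamVF σ H ((extChartAt I x₀).symm y) = ofCoord I x₀ y (coordVF σ H x₀ y) := by
  set x := (extChartAt I x₀).symm y with hx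
  have key : ∀ v : E, σ.form x (ofCoord I x₀ y (coordVF σ H x₀ y)) v = dHam H x v := by
    intro v
    have h2 := ofCoord_toCoord (I := I) (symm_mem_chartDomain hy) v
    rw [chart_chart_symm hy] at h2
    have h3 := coordBilin_coordVF σ H hy (toCoord I x₀ x v)
    rw [← dHam_ofCoord H hy, h2] at h3
    rw [← h3]
    change _ = σ.form x (ofCoord I x₀ y (coordVF σ H x₀ y)) (ofCoord I x₀ y (toCoord I x₀ x v))
    rw [h2]
  refine form_left_injective σ x fun w => ?_
  rw [form_hamVF]
  exact (key w).symm

theorem toCoord_hamVF (σ : SymplecticForm I M) (H : Hamiltonian I M) {x₀ x : M}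
    (hx : x ∈ chartDomain I x₀) :
    toCoord I x₀ x (hamVF σ H x) = coordVF σ H x₀ (extChartAt I x₀ x) := by
  have h1 := hamVF_eq_ofCoord σ H hx.2
  rw [chart_symm_chart hx] at h1
  rw [h1]
  exact toCoord_ofCoord' hx _

theorem contDiffAt_inverse_form (σ : SymplecticForm I M) {x₀ : M} {y : E}
    (hy : y ∈ chartInterior I x₀) :
    ContDiffAt ℝ ∞ (fun y => (coordBilin σ.form x₀ y).inverse) y :=
  (contDiffOn_inverse_coordBilin σ.contMDiff σ.nondeg x₀).contDiffAt
    ((isOpen_chartInterior x₀).mem_nhds hy)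

theorem contDiffAt_coordVF (σ : SymplecticForm I M) (H : Hamiltonian I M) {x₀ : M} {y : E}
    (hy : y ∈ chartInterior I x₀) : ContDiffAt ℝ 1 (coordVF σ H x₀) y :=
  ((contDiffAt_inverse_form σ hy).of_le (by exact_mod_cast le_top)).clm_apply
    (contDiffAt_fderiv_coordHam H hy)

/-- The Hamiltonian vector field is `C¹` at interior points. -/
theorem contMDiffAt_hamVF (σ : SymplecticForm I M) (H : Hamiltonian I M) {x₀ : M}
    (hx₀ : x₀ ∈ I.interior M) : ContMDiffAt I I.tangent 1
      (fun x ↦ (⟨x, hamVF σ H x⟩ : TangentBundle I M)) x₀ := by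
  have hx := self_mem_chartDomain hx₀
  rw [contMDiffAt_totalSpace]
  refine ⟨contMDiffAt_id, ?_⟩
  have h1 : ContMDiffAt I 𝓘(ℝ, E) 1 (fun x => coordVF σ H x₀ (extChartAt I x₀ x)) x₀ :=
    (contDiffAt_coordVF σ H hx.2).contMDiffAt.comp x₀ contMDiffAt_extChartAt
  refine h1.congr_of_eventuallyEq ?_
  filter_upwards [(isOpen_chartDomain x₀).mem_nhds hx] with x hx'
  rw [trivializationAt_snd (mem_chart_of_mem_chartDomain hx')]
  exact toCoord_hamVF σ H hx'

end

/-! #### The `C²` topology in coordinates -/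

theorem mem_c2Nhd_self (H : Hamiltonian I M) (x₀ : M) (K : Set E) {ε : ℝ} (hε : 0 < ε) :
    H ∈ c2Nhd H x₀ K ε := by
  intro k _ y _
  simp only [sub_self]
  rw [iteratedFDerivWithin_fun_zero]
  simpa using hε

theorem c2Nhd_mem_nhds (H : Hamiltonian I M) {x₀ : M} {K : Set E} (hK : IsCompact K)
    (hKt : K ⊆ (extChartAt I x₀).target) {ε : ℝ} (hε : 0 < ε) : c2Nhd H x₀ K ε ∈ 𝓝 H := by
  refine IsOpen.mem_nhds ?_ (mem_c2Nhd_self H x₀ K hε)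
  exact TopologicalSpace.isOpen_generateFrom_of_mem ⟨H, x₀, K, ε, hK, hKt, hε, rfl⟩

/-- `C²`-closeness implies closeness of the functions and of their first two derivatives on compact
subsets of a chart. -/
theorem eventually_c2_close [IsManifold I ∞ M] (H : Hamiltonian I M) {x₀ : M} {K : Set E}
    (hK : IsCompact K) (hKt : K ⊆ chartInterior I x₀) {ε : ℝ} (hε : 0 < ε) :
    ∀ᶠ G in 𝓝 H, ∀ y ∈ K, ‖coordHam G x₀ y - coordHam H x₀ y‖ < ε ∧
      ‖fderiv ℝ (coordHam G x₀) y - fderiv ℝ (coordHam H x₀) y‖ < ε ∧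
      ‖fderiv ℝ (fderiv ℝ (coordHam G x₀)) y - fderiv ℝ (fderiv ℝ (coordHam H x₀)) y‖ < ε := by
  filter_upwards [c2Nhd_mem_nhds H hK (hKt.trans (chartInterior_subset x₀)) hε] with G hG y hy
  have hyI := hKt hy
  have hr := range_mem_nhds_of_mem_chartInterior hyI
  have hs : (fun z => G ((extChartAt I x₀).symm z) - H ((extChartAt I x₀).symm z))
      = coordHam G x₀ - coordHam H x₀ := rfl
  have hD : ∀ z ∈ chartInterior I x₀, fderiv ℝ (coordHam G x₀ - coordHam H x₀) z
      = fderiv ℝ (coordHam G x₀) z - fderiv ℝ (coordHam H x₀) z := fun z hz =>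
    fderiv_sub (differentiableAt_coordHam G hz) (differentiableAt_coordHam H hz)
  have hconv : ∀ k : ℕ, iteratedFDerivWithin ℝ k (coordHam G x₀ - coordHam H x₀) (range I) y
      = iteratedFDeriv ℝ k (coordHam G x₀ - coordHam H x₀) y := by
    intro k
    rw [← iteratedFDerivWithin_univ, ← univ_inter (range I)]
    exact iteratedFDerivWithin_inter hr
  refine ⟨?_, ?_, ?_⟩
  · have := hG 0 (by norm_num) y hy
    rw [hs, hconv, norm_iteratedFDeriv_zero] at this
    exact this
  · have := hG 1 (by norm_num) y hy
    rw [hs, hconv, norm_iteratedFDeriv_one, hD y hyI] at this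
    exact this
  · have := hG 2 le_rfl y hy
    rw [hs, hconv, ← norm_iteratedFDeriv_fderiv, norm_iteratedFDeriv_one] at this
    have h2 : fderiv ℝ (coordHam G x₀ - coordHam H x₀) =ᶠ[𝓝 y]
        fderiv ℝ (coordHam G x₀) - fderiv ℝ (coordHam H x₀) := by
      filter_upwards [(isOpen_chartInterior x₀).mem_nhds hyI] with z hz
      exact hD z hz
    rw [h2.fderiv_eq, fderiv_sub ((contDiffAt_fderiv_coordHam G hyI).differentiableAt (by norm_num))
      ((contDiffAt_fderiv_coordHam H hyI).differentiableAt (by norm_num))] at this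
    exact this

theorem tendstoUniformlyOn_coordHam [IsManifold I ∞ M] (H : Hamiltonian I M) {x₀ : M} {K : Set E}
    (hK : IsCompact K) (hKt : K ⊆ chartInterior I x₀) :
    TendstoUniformlyOn (fun G : Hamiltonian I M => coordHam G x₀) (coordHam H x₀) (𝓝 H) K := by
  rw [Metric.tendstoUniformlyOn_iff]
  intro ε hε
  filter_upwards [eventually_c2_close H hK hKt hε] with G hG y hy
  rw [dist_comm, dist_eq_norm]
  exact (hG y hy).1

theorem tendstoUniformlyOn_fderiv_coordHam [IsManifold I ∞ M] (H : Hamiltonian I M) {x₀ : M}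
    {K : Set E} (hK : IsCompact K) (hKt : K ⊆ chartInterior I x₀) :
    TendstoUniformlyOn (fun G : Hamiltonian I M => fderiv ℝ (coordHam G x₀))
      (fderiv ℝ (coordHam H x₀)) (𝓝 H) K := by
  rw [Metric.tendstoUniformlyOn_iff]
  intro ε hε
  filter_upwards [eventually_c2_close H hK hKt hε] with G hG y hy
  rw [dist_comm, dist_eq_norm]
  exact (hG y hy).2.1

section

variable [FiniteDimensional ℝ E] [IsManifold I ∞ M]

set_option synthInstance.maxHeartbeats 200000 in
omit [FiniteDimensional ℝ E] in
/-- Applying a fixed `C¹` family of linear maps preserves `C¹` convergence on compact sets. -/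
theorem tendstoUniformlyOn_clm_apply {F G ι : Type*} [NormedAddCommGroup F] [NormedSpace ℝ F]
    [NormedAddCommGroup G] [NormedSpace ℝ G] {l : Filter ι} {Θ : E → F →L[ℝ] G} {U K : Set E}
    (hK : IsCompact K) (hKU : K ⊆ U) (hΘ : ∀ y ∈ U, ContDiffAt ℝ 1 Θ y)
    {f : ι → E → F} {f₀ : E → F} (hd : ∀ i, ∀ y ∈ U, DifferentiableAt ℝ (f i) y)
    (hd₀ : ∀ y ∈ U, DifferentiableAt ℝ f₀ y)
    (hf : TendstoUniformlyOn f f₀ l K)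
    (hf' : TendstoUniformlyOn (fun i => fderiv ℝ (f i)) (fderiv ℝ f₀) l K) :
    TendstoUniformlyOn (fun i y => Θ y (f i y)) (fun y => Θ y (f₀ y)) l K ∧
    TendstoUniformlyOn (fun i => fderiv ℝ fun y => Θ y (f i y)) (fderiv ℝ fun y => Θ y (f₀ y))
      l K := by
  obtain ⟨C₁, hC₁⟩ := hK.exists_bound_of_continuousOn (f := Θ) fun y hy =>
    (hΘ y (hKU hy)).continuousAt.continuousWithinAt
  obtain ⟨C₂, hC₂⟩ := hK.exists_bound_of_continuousOn (f := fderiv ℝ Θ) fun y hy =>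
    ((hΘ y (hKU hy)).fderiv_right (m := 0) (by norm_num)).continuousAt.continuousWithinAt
  set C := |C₁| + |C₂| + 1 with hC
  have hC0 : 0 < C := by positivity
  have hb1 : ∀ y ∈ K, ‖Θ y‖ ≤ C := fun y hy => by
    linarith [hC₁ y hy, le_abs_self C₁, abs_nonneg C₂]
  have hb2 : ∀ y ∈ K, ‖fderiv ℝ Θ y‖ ≤ C := fun y hy => by
    linarith [hC₂ y hy, le_abs_self C₂, abs_nonneg C₁]
  rw [Metric.tendstoUniformlyOn_iff] at hf hf' ⊢
  rw [Metric.tendstoUniformlyOn_iff]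
  have key : ∀ ε > 0, C * (ε / (4 * C)) = ε / 4 := fun ε _ => by field_simp
  constructor
  · intro ε hε
    filter_upwards [hf (ε / (4 * C)) (by positivity)] with i hi y hy
    have := hi y hy
    rw [dist_eq_norm] at this
    rw [dist_eq_norm, ← map_sub]
    calc _ ≤ C * ‖f₀ y - f i y‖ := ContinuousLinearMap.le_of_opNorm_le _ (hb1 y hy) _
      _ ≤ C * (ε / (4 * C)) := mul_le_mul_of_nonneg_left this.le hC0.le
      _ < ε := by rw [key ε hε]; linarith
  · intro ε hε
    filter_upwards [hf (ε / (4 * C)) (by positivity), hf' (ε / (4 * C)) (by positivity)]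
      with i hi hi' y hy
    have h1 := hi y hy
    have h2 := hi' y hy
    have hΘy := (hΘ y (hKU hy)).differentiableAt (by norm_num)
    rw [dist_eq_norm] at h1 h2
    rw [dist_eq_norm, fderiv_clm_apply hΘy (hd i y (hKU hy)), fderiv_clm_apply hΘy
      (hd₀ y (hKU hy)), add_sub_add_comm, ← ContinuousLinearMap.comp_sub, ← map_sub]
    refine (norm_add_le _ _).trans_lt ?_
    have e1 : ‖(Θ y).comp (fderiv ℝ f₀ y - fderiv ℝ (f i) y)‖ ≤ C * (ε / (4 * C)) :=
      (ContinuousLinearMap.opNorm_comp_le _ _).trans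
        (mul_le_mul (hb1 y hy) h2.le (norm_nonneg _) hC0.le)
    have e2 : ‖(fderiv ℝ Θ y).flip (f₀ y - f i y)‖ ≤ C * (ε / (4 * C)) := by
      refine (ContinuousLinearMap.le_opNorm _ _).trans ?_
      rw [ContinuousLinearMap.opNorm_flip]
      exact mul_le_mul (hb2 y hy) h1.le (norm_nonneg _) hC0.le
    rw [key ε hε] at e1 e2
    linarith

/-- `C²`-convergence of Hamiltonians implies `C¹`-convergence of their vector fields. -/
theorem tendstoUniformlyOn_coordVF_and_fderiv (σ : SymplecticForm I M) (H : Hamiltonian I M)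
    {x₀ : M} {K : Set E} (hK : IsCompact K) (hKt : K ⊆ chartInterior I x₀) :
    TendstoUniformlyOn (fun G : Hamiltonian I M => coordVF σ G x₀) (coordVF σ H x₀) (𝓝 H) K ∧
    TendstoUniformlyOn (fun G : Hamiltonian I M => fderiv ℝ (coordVF σ G x₀))
      (fderiv ℝ (coordVF σ H x₀)) (𝓝 H) K := by
  refine tendstoUniformlyOn_clm_apply (Θ := fun y => (coordBilin σ.form x₀ y).inverse)
    (f := fun (G : Hamiltonian I M) => fderiv ℝ (coordHam G x₀)) hK hKt
    (fun y hy => (contDiffAt_inverse_form σ hy).of_le (by exact_mod_cast le_top))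
    (fun G y hy => (contDiffAt_fderiv_coordHam G hy).differentiableAt (by norm_num))
    (fun y hy => (contDiffAt_fderiv_coordHam H hy).differentiableAt (by norm_num))
    (tendstoUniformlyOn_fderiv_coordHam H hK hKt) ?_
  rw [Metric.tendstoUniformlyOn_iff]
  intro ε hε
  filter_upwards [eventually_c2_close H hK hKt hε] with G hG y hy
  rw [dist_comm, dist_eq_norm]
  exact (hG y hy).2.2

end

/-- Joint continuity of a uniform limit near a point. -/
theorem continuousAt_uncurry_of_tendstoUniformlyOn [FiniteDimensional ℝ E] {X G : Type*}
    [TopologicalSpace X] [PseudoMetricSpace G] {F : X → E → G} {x : X} {y : E} {U : Set E}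
    (hU : IsOpen U) (hy : y ∈ U)
    (hF : ∀ K, IsCompact K → K ⊆ U → TendstoUniformlyOn F (F x) (𝓝 x) K)
    (hc : ContinuousAt (F x) y) : ContinuousAt (fun p : X × E => F p.1 p.2) (x, y) := by
  obtain ⟨r, hr, hrU⟩ := Metric.nhds_basis_closedBall.mem_iff.1 (hU.mem_nhds hy)
  have := Metric.tendstoUniformlyOn_iff.1 (hF _ (isCompact_closedBall y r) hrU)
  rw [ContinuousAt, Metric.tendsto_nhds, nhds_prod_eq]
  intro ε hε
  have h1 := this (ε / 2) (by positivity)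
  have h2 := Metric.tendsto_nhds.1 hc (ε / 2) (by positivity)
  filter_upwards [h1.prod_mk (h2.and (Metric.closedBall_mem_nhds y hr))] with p hp
  have h3 := hp.1 p.2 hp.2.2
  rw [dist_comm] at h3
  exact (dist_triangle _ (F x p.2) _).trans_lt (by linarith [hp.2.1])

section

variable [FiniteDimensional ℝ E] [IsManifold I ∞ M]

theorem continuousAt_coordHam (H : Hamiltonian I M) {x₀ : M} {y : E}
    (hy : y ∈ chartInterior I x₀) :
    ContinuousAt (fun p : Hamiltonian I M × E => coordHam p.1 x₀ p.2) (H, y) :=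
  continuousAt_uncurry_of_tendstoUniformlyOn (F := fun (G : Hamiltonian I M) => coordHam G x₀)
    (isOpen_chartInterior x₀) hy (fun _ hK hKt => tendstoUniformlyOn_coordHam H hK hKt)
    (contDiffAt_coordHam H hy).continuousAt

theorem continuousAt_fderiv_coordHam (H : Hamiltonian I M) {x₀ : M} {y : E}
    (hy : y ∈ chartInterior I x₀) :
    ContinuousAt (fun p : Hamiltonian I M × E => fderiv ℝ (coordHam p.1 x₀) p.2) (H, y) :=
  continuousAt_uncurry_of_tendstoUniformlyOn
    (F := fun (G : Hamiltonian I M) => fderiv ℝ (coordHam G x₀))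
    (isOpen_chartInterior x₀) hy (fun _ hK hKt => tendstoUniformlyOn_fderiv_coordHam H hK hKt)
    (contDiffAt_fderiv_coordHam H hy).continuousAt

theorem continuousAt_coordVF (σ : SymplecticForm I M) (H : Hamiltonian I M) {x₀ : M} {y : E}
    (hy : y ∈ chartInterior I x₀) :
    ContinuousAt (fun p : Hamiltonian I M × E => coordVF σ p.1 x₀ p.2) (H, y) :=
  continuousAt_uncurry_of_tendstoUniformlyOn
    (F := fun (G : Hamiltonian I M) => coordVF σ G x₀)
    (isOpen_chartInterior x₀) hy (fun _ hK hKt => (tendstoUniformlyOn_coordVF_and_fderiv σ H hK hKt).1)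
    (contDiffAt_coordVF σ H hy).continuousAt

/-- The value of a Hamiltonian depends continuously on the Hamiltonian and the interior point. -/
theorem continuousAt_eval (H : Hamiltonian I M) {x : M} (hx : x ∈ I.interior M) :
    ContinuousAt (fun p : Hamiltonian I M × M => p.1 p.2) (H, x) := by
  have hx' := self_mem_chartDomain hx
  have h1 : ContinuousAt (fun p : Hamiltonian I M × M => (p.1, extChartAt I x p.2)) (H, x) :=
    continuousAt_fst.prodMk ((continuousAt_chart hx').comp continuousAt_snd)
  have h2 := (continuousAt_coordHam H hx'.2).comp_of_eq h1 rfl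
  refine h2.congr ?_
  have : ∀ᶠ p : Hamiltonian I M × M in 𝓝 (H, x), p.2 ∈ chartDomain I x :=
    continuousAt_snd ((isOpen_chartDomain x).mem_nhds hx')
  filter_upwards [this] with p hp
  change p.1 ((extChartAt I x).symm (extChartAt I x p.2)) = _
  rw [chart_symm_chart hp]

end

end CoordinateHamiltonian

/-! ### Energy surfaces -/

section EnergySurface

open Set Filter

variable {E : Type*} [NormedAddCommGroup E] [NormedSpace ℝ E]
  {B : Type*} [TopologicalSpace B] {I : ModelWithCorners ℝ E B}
  {M : Type*} [TopologicalSpace M] [ChartedSpace B M]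

theorem continuous_ham (H : Hamiltonian I M) : Continuous (H : M → ℝ) := H.contMDiff'.continuous

theorem mem_energySurface_self (H : Hamiltonian I M) (x : M) : x ∈ energySurface H x :=
  mem_connectedComponentIn rfl

theorem ham_eq_of_mem_energySurface {H : Hamiltonian I M} {x y : M} (hy : y ∈ energySurface H x) :
    H y = H x :=
  connectedComponentIn_subset {y : M | H y = H x} x hy

theorem energySurface_eq {H : Hamiltonian I M} {x y : M} (hy : y ∈ energySurface H x) :
    energySurface H y = energySurface H x := by
  rw [energySurface, ham_eq_of_mem_energySurface hy]
  exact (connectedComponentIn_eq hy).symm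

theorem isClosed_level (H : Hamiltonian I M) (e : ℝ) : IsClosed {y : M | H y = e} :=
  isClosed_eq (continuous_ham H) continuous_const

theorem isClosed_connectedComponentIn {X : Type*} [TopologicalSpace X] {F : Set X} (hF : IsClosed F)
    {x : X} : IsClosed (connectedComponentIn F x) := by
  by_cases hx : x ∈ F
  · rw [connectedComponentIn_eq_image hx]
    exact hF.isClosedEmbedding_subtypeVal.isClosedMap _ isClosed_connectedComponent
  · rw [connectedComponentIn_eq_empty hx]
    exact isClosed_empty

theorem isClosed_energySurface (H : Hamiltonian I M) (x : M) : IsClosed (energySurface H x) :=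
  isClosed_connectedComponentIn (isClosed_level H _)

theorem isCompact_energySurface [CompactSpace M] (H : Hamiltonian I M) (x : M) :
    IsCompact (energySurface H x) := (isClosed_energySurface H x).isCompact

theorem mem_energySurface_of_isPreconnected {H : Hamiltonian I M} {x y : M} {S : Set M}
    (hS : IsPreconnected S) (hx : x ∈ S) (hy : y ∈ S) (h : ∀ z ∈ S, H z = H x) :
    y ∈ energySurface H x :=
  hS.subset_connectedComponentIn hx h hy

/-- In a compact Hausdorff space, a component of a closed set which is contained in an open set `W`
is contained in an open set whose frontier misses the closed set and whose closure is contained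
in `W`. -/
theorem exists_isOpen_connectedComponentIn_subset {X : Type*} [TopologicalSpace X] [CompactSpace X]
    [T2Space X] {L W : Set X} (hL : IsClosed L) (hW : IsOpen W) {x : X} (hx : x ∈ L)
    (h : connectedComponentIn L x ⊆ W) :
    ∃ U : Set X, IsOpen U ∧ x ∈ U ∧ closure U ⊆ W ∧ Disjoint (frontier U) L := by
  have : CompactSpace L := isCompact_iff_compactSpace.1 hL.isCompact
  have h1 : connectedComponent (⟨x, hx⟩ : L) ⊆ Subtype.val ⁻¹' W := by
    rw [connectedComponentIn_eq_image hx] at h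
    exact image_subset_iff.1 h
  obtain ⟨⟨Z, hZ, hxZ⟩, hZW⟩ : ∃ s : {s : Set L // IsClopen s ∧ ⟨x, hx⟩ ∈ s},
      (s : Set L) ⊆ Subtype.val ⁻¹' W := by
    have : Nonempty {s : Set L // IsClopen s ∧ ⟨x, hx⟩ ∈ s} := ⟨⟨univ, isClopen_univ, mem_univ _⟩⟩
    refine exists_subset_nhds_of_isCompact (fun a b => ⟨⟨a.1 ∩ b.1, a.2.1.inter b.2.1,
      a.2.2, b.2.2⟩, inter_subset_left, inter_subset_right⟩)
      (fun s => s.2.1.isClosed.isCompact) fun y hy => ?_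
    rw [← connectedComponent_eq_iInter_isClopen] at hy
    exact (hW.preimage continuous_subtype_val).mem_nhds (h1 hy)
  have hA : IsClosed (Subtype.val '' Z) := hL.isClosedEmbedding_subtypeVal.isClosedMap _ hZ.isClosed
  have hA' : IsClosed (Subtype.val '' Zᶜ) :=
    hL.isClosedEmbedding_subtypeVal.isClosedMap _ hZ.compl.isClosed
  obtain ⟨U, hU, hAU, hUW⟩ := normal_exists_closure_subset hA (hW.inter hA'.isOpen_compl) (by
    rintro _ ⟨z, hz, rfl⟩
    refine ⟨hZW hz, ?_⟩
    rintro ⟨z', hz', he⟩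
    rw [Subtype.val_injective he] at hz'
    exact hz' hz)
  refine ⟨U, hU, hAU ⟨_, hxZ, rfl⟩, hUW.trans inter_subset_left, ?_⟩
  rw [disjoint_left]
  intro y hy hyL
  rw [hU.frontier_eq] at hy
  by_cases hyZ : (⟨y, hyL⟩ : L) ∈ Z
  · exact hy.2 (hAU ⟨_, hyZ, rfl⟩)
  · exact (hUW hy.1).2 ⟨_, hyZ, rfl⟩

theorem isPreconnected_subset_of_disjoint_frontier {X : Type*} [TopologicalSpace X] {S U : Set X}
    (hS : IsPreconnected S) (hU : IsOpen U) {x : X} (hxS : x ∈ S) (hxU : x ∈ U)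
    (h : Disjoint (frontier U) S) : S ⊆ U := by
  refine hS.subset_of_closure_inter_subset hU ⟨x, hxS, hxU⟩ ?_
  rintro y ⟨hy, hyS⟩
  by_contra hyU
  exact disjoint_left.1 h (by rw [hU.frontier_eq]; exact ⟨hy, hyU⟩) hyS

variable [FiniteDimensional ℝ E] [IsManifold I ∞ M] [CompactSpace M] [T2Space M]

/-- Energy surfaces depend upper semicontinuously on the Hamiltonian and the base point: the energy
surfaces that are close to one in the open set `W` stay in `W`. -/
theorem eventually_energySurface_subset {H : Hamiltonian I M} {x : M} {W : Set M} (hW : IsOpen W)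
    (hWI : W ⊆ I.interior M) (h : energySurface H x ⊆ W) :
    ∀ᶠ p : Hamiltonian I M × M in 𝓝 (H, x), energySurface p.1 p.2 ⊆ W := by
  obtain ⟨U, hU, hxU, hUW, hd⟩ := exists_isOpen_connectedComponentIn_subset (isClosed_level H (H x))
    hW rfl h
  have hcf : IsCompact (frontier U) := isClosed_frontier.isCompact
  have hxI : x ∈ I.interior M := hWI (h (mem_energySurface_self H x))
  have h1 : ∀ᶠ p : Hamiltonian I M × M in 𝓝 (H, x), ∀ y ∈ frontier U, p.1 y ≠ p.1 p.2 := by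
    refine hcf.eventually_forall_of_forall_eventually fun y hy => ?_
    have hyI : y ∈ I.interior M := hWI (hUW (frontier_subset_closure hy))
    have hne : H y ≠ H x := fun he => disjoint_left.1 hd hy he
    have c1 : ContinuousAt (fun q : (Hamiltonian I M × M) × M => q.1.1 q.2) ((H, x), y) :=
      (continuousAt_eval H hyI).comp_of_eq
        (f := fun q : (Hamiltonian I M × M) × M => (q.1.1, q.2)) (by fun_prop) rfl
    have c2 : ContinuousAt (fun q : (Hamiltonian I M × M) × M => q.1.1 q.1.2) ((H, x), y) :=
      (continuousAt_eval H hxI).comp_of_eq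
        (f := fun q : (Hamiltonian I M × M) × M => (q.1.1, q.1.2)) (by fun_prop) rfl
    exact (c1.sub c2).eventually_ne (sub_ne_zero.2 hne) |>.mono fun q hq => sub_ne_zero.1 hq
  have h2 : ∀ᶠ p : Hamiltonian I M × M in 𝓝 (H, x), p.2 ∈ U :=
    continuousAt_snd (hU.mem_nhds hxU)
  filter_upwards [h1, h2] with p hp1 hp2
  refine (isPreconnected_subset_of_disjoint_frontier isPreconnected_connectedComponentIn hU
    (mem_energySurface_self p.1 p.2) hp2 ?_).trans (subset_closure.trans hUW)
  rw [disjoint_left]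
  exact fun y hy hyE => hp1 y hy (ham_eq_of_mem_energySurface hyE)

/-- Having the energy surface in the interior of `M` is an open condition. -/
theorem eventually_energySurface_subset_interior {H : Hamiltonian I M} {x : M}
    (h : energySurface H x ⊆ I.interior M) :
    ∀ᶠ p : Hamiltonian I M × M in 𝓝 (H, x), energySurface p.1 p.2 ⊆ I.interior M :=
  eventually_energySurface_subset (ModelWithCorners.isOpen_interior (n := 1) one_ne_zero) subset_rfl h

end EnergySurface

/-! ### Complete integral curves on compact invariant sets -/

section IntegralCurves

open Set Filter

variable {E : Type*} [NormedAddCommGroup E] [NormedSpace ℝ E]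
  {B : Type*} [TopologicalSpace B] {I : ModelWithCorners ℝ E B}
  {M : Type*} [TopologicalSpace M] [ChartedSpace B M] [IsManifold I 1 M] [T2Space M]
  [CompleteSpace E]

omit [CompleteSpace E] in
/-- Integral curves that stay in the interior, where the vector field is `C¹`, are unique. -/
theorem isMIntegralCurveOn_Ioo_eqOn {v : ∀ x : M, TangentSpace I x} {γ γ' : ℝ → M} {a b t₀ : ℝ}
    (ht₀ : t₀ ∈ Ioo a b) (hγt : ∀ t ∈ Ioo a b, γ t ∈ I.interior M)
    (hv : ∀ x ∈ I.interior M,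
      ContMDiffAt I I.tangent 1 (fun x ↦ (⟨x, v x⟩ : TangentBundle I M)) x)
    (hγ : IsMIntegralCurveOn γ v (Ioo a b)) (hγ' : IsMIntegralCurveOn γ' v (Ioo a b))
    (h : γ t₀ = γ' t₀) : EqOn γ γ' (Ioo a b) := by
  set s := {t | t ∈ Ioo a b ∧ γ t = γ' t} with hs
  suffices hsub : Ioo a b ⊆ interior s from fun t ht => (interior_subset (hsub ht)).2
  have hs_int : ∀ t ∈ s, t ∈ interior s := by
    intro t₁ ht₁
    have hmem := Ioo_mem_nhds ht₁.1.1 ht₁.1.2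
    have heq : γ =ᶠ[𝓝 t₁] γ' := isMIntegralCurveAt_eventuallyEq_of_contMDiffAt
      (hγt _ ht₁.1) (hv _ (hγt _ ht₁.1)) (hγ.isMIntegralCurveAt hmem)
      (hγ'.isMIntegralCurveAt hmem) ht₁.2
    rw [mem_interior_iff_mem_nhds]
    filter_upwards [heq, hmem] with t h1 h2 using ⟨h2, h1⟩
  refine isPreconnected_Ioo.subset_of_closure_inter_subset isOpen_interior
    ⟨t₀, ht₀, hs_int _ ⟨ht₀, h⟩⟩ ?_
  rintro t ⟨ht, htab⟩
  refine hs_int t ⟨htab, ?_⟩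
  have hmem := Ioo_mem_nhds htab.1 htab.2
  have hne : (𝓝[s] t).NeBot :=
    mem_closure_iff_nhdsWithin_neBot.1 (closure_mono interior_subset ht)
  have c1 : Tendsto γ (𝓝[s] t) (𝓝 (γ t)) :=
    ((hγ.isMIntegralCurveAt hmem).continuousAt).mono_left nhdsWithin_le_nhds
  have c2 : Tendsto γ' (𝓝[s] t) (𝓝 (γ' t)) :=
    ((hγ'.isMIntegralCurveAt hmem).continuousAt).mono_left nhdsWithin_le_nhds
  refine tendsto_nhds_unique (c1.congr' ?_) c2
  filter_upwards [self_mem_nhdsWithin] with t ht using ht.2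

omit [IsManifold I 1 M] [T2Space M] [CompleteSpace E] in
theorem isMIntegralCurveAt_of_eventuallyEq {v : ∀ x : M, TangentSpace I x} {γ γ' : ℝ → M} {t : ℝ}
    (h : IsMIntegralCurveAt γ v t) (h' : γ' =ᶠ[𝓝 t] γ) : IsMIntegralCurveAt γ' v t := by
  filter_upwards [h, h'.eventuallyEq_nhds] with s hs hs'
  rw [hs'.eq_of_nhds]
  exact hs.congr_of_eventuallyEq hs'

omit [CompleteSpace E] in
/-- If all integral curves through `Λ` stay in `Λ` and exist for a uniform time, they exist for
all times. -/
theorem exists_isMIntegralCurve_of_uniform_time {v : ∀ x : M, TangentSpace I x} {Λ : Set M}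
    (hΛ : Λ ⊆ I.interior M)
    (hv : ∀ x ∈ I.interior M,
      ContMDiffAt I I.tangent 1 (fun x ↦ (⟨x, v x⟩ : TangentBundle I M)) x)
    (hstay : ∀ (γ : ℝ → M) (a b t₀ : ℝ), t₀ ∈ Ioo a b → γ t₀ ∈ Λ →
      IsMIntegralCurveOn γ v (Ioo a b) → ∀ t ∈ Ioo a b, γ t ∈ Λ)
    {ε : ℝ} (hε : 0 < ε)
    (h : ∀ x ∈ Λ, ∃ γ : ℝ → M, γ 0 = x ∧ IsMIntegralCurveOn γ v (Ioo (-ε) ε)) {x : M}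
    (hx : x ∈ Λ) : ∃ γ : ℝ → M, γ 0 = x ∧ IsMIntegralCurve γ v := by
  have hu : ∀ (γ γ' : ℝ → M) (a b t₀ : ℝ), t₀ ∈ Ioo a b → γ t₀ ∈ Λ →
      IsMIntegralCurveOn γ v (Ioo a b) → IsMIntegralCurveOn γ' v (Ioo a b) → γ t₀ = γ' t₀ →
      EqOn γ γ' (Ioo a b) := fun γ γ' a b t₀ ht₀ hγΛ hγ hγ' heq =>
    isMIntegralCurveOn_Ioo_eqOn ht₀ (fun t ht => hΛ (hstay γ a b t₀ ht₀ hγΛ hγ t ht)) hv hγ hγ' heq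
  have hstep : ∀ a : ℝ, 0 < a →
      (∀ x ∈ Λ, ∃ γ : ℝ → M, γ 0 = x ∧ IsMIntegralCurveOn γ v (Ioo (-a) a)) →
      ∀ x ∈ Λ, ∃ γ : ℝ → M, γ 0 = x ∧ IsMIntegralCurveOn γ v (Ioo (-(3 / 2 * a)) (3 / 2 * a)) := by
    intro a ha h x hx
    obtain ⟨γ, hγ0, hγ⟩ := h x hx
    have hγΛ := hstay γ (-a) a 0 ⟨by linarith, ha⟩ (hγ0 ▸ hx) hγ
    have hm1 : a / 2 ∈ Ioo (-a) a := ⟨by linarith, by linarith⟩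
    have hm2 : -(a / 2) ∈ Ioo (-a) a := ⟨by linarith, by linarith⟩
    -- the curves through the points at times `±a/2`, shifted in time
    obtain ⟨γ₁, hγ₁0, hγ₁⟩ := h _ (hγΛ _ hm1)
    obtain ⟨γ₂, hγ₂0, hγ₂⟩ := h _ (hγΛ _ hm2)
    have hs1 : IsMIntegralCurveOn (γ₁ ∘ (· - a / 2)) v (Ioo (-(a / 2)) (3 / 2 * a)) := by
      refine (isMIntegralCurveOn_comp_sub.2 hγ₁).mono fun t ht => ?_
      exact ⟨by linarith [ht.1], by linarith [ht.2]⟩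
    have hs2 : IsMIntegralCurveOn (γ₂ ∘ (· + a / 2)) v (Ioo (-(3 / 2 * a)) (a / 2)) := by
      refine (isMIntegralCurveOn_comp_add.2 hγ₂).mono fun t ht => ?_
      exact ⟨by linarith [ht.1], by linarith [ht.2]⟩
    have he1 : EqOn γ (γ₁ ∘ (· - a / 2)) (Ioo (-(a / 2)) a) :=
      hu _ _ _ _ (a / 2) ⟨by linarith, by linarith⟩ (hγΛ _ hm1)
        (hγ.mono (Ioo_subset_Ioo (by linarith) le_rfl))
        (hs1.mono (Ioo_subset_Ioo le_rfl (by linarith))) (by simp [hγ₁0])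
    have he2 : EqOn γ (γ₂ ∘ (· + a / 2)) (Ioo (-a) (a / 2)) :=
      hu _ _ _ _ (-(a / 2)) ⟨by linarith, by linarith⟩ (hγΛ _ hm2)
        (hγ.mono (Ioo_subset_Ioo le_rfl (by linarith)))
        (hs2.mono (Ioo_subset_Ioo (by linarith) le_rfl)) (by simp [hγ₂0])
    let δ : ℝ → M := fun t => if 0 ≤ t then γ₁ (t - a / 2) else γ₂ (t + a / 2)
    have hmid : EqOn δ γ (Ioo (-(a / 2)) (a / 2)) := by
      intro t ht
      by_cases h0 : 0 ≤ t
      · simp only [δ, if_pos h0]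
        exact (he1 ⟨ht.1, by linarith [ht.2]⟩).symm
      · simp only [δ, if_neg h0]
        exact (he2 ⟨by linarith [ht.1], ht.2⟩).symm
    refine ⟨δ, (hmid ⟨by linarith, by linarith⟩).trans hγ0, ?_⟩
    rw [isMIntegralCurveOn_iff_isMIntegralCurveAt isOpen_Ioo]
    intro t ht
    rcases lt_trichotomy t 0 with h0 | h0 | h0
    · refine isMIntegralCurveAt_of_eventuallyEq
        (hs2.isMIntegralCurveAt (Ioo_mem_nhds ht.1 (by linarith))) ?_
      filter_upwards [Iio_mem_nhds h0] with s hs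
      simp [δ, not_le.2 (mem_Iio.1 hs)]
    · have : Ioo (-(a / 2)) (a / 2) ∈ 𝓝 t := Ioo_mem_nhds (by linarith) (by linarith)
      refine isMIntegralCurveAt_of_eventuallyEq
        (hγ.isMIntegralCurveAt (Ioo_mem_nhds (by linarith) (by linarith))) ?_
      filter_upwards [this] with s hs using hmid hs
    · refine isMIntegralCurveAt_of_eventuallyEq
        (hs1.isMIntegralCurveAt (Ioo_mem_nhds (by linarith) ht.2)) ?_
      filter_upwards [Ioi_mem_nhds h0] with s hs
      simp [δ, (mem_Ioi.1 hs).le]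
  have hpow : ∀ n : ℕ, ∀ x ∈ Λ, ∃ γ : ℝ → M, γ 0 = x ∧
      IsMIntegralCurveOn γ v (Ioo (-((3 / 2) ^ n * ε)) ((3 / 2) ^ n * ε)) := by
    intro n
    induction n with
    | zero => simpa using h
    | succ n ih =>
      have := hstep _ (by positivity) ih
      rwa [← mul_assoc, ← pow_succ'] at this
  have hall : ∀ a : ℝ, ∃ γ : ℝ → M, γ 0 = x ∧ IsMIntegralCurveOn γ v (Ioo (-a) a) := by
    intro a
    obtain ⟨n, hn⟩ := pow_unbounded_of_one_lt (a / ε) (by norm_num : (1 : ℝ) < 3 / 2)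
    obtain ⟨γ, h0, hγ⟩ := hpow n x hx
    have := (div_lt_iff₀ hε).1 hn
    exact ⟨γ, h0, hγ.mono (Ioo_subset_Ioo (by linarith) this.le)⟩
  choose Γ hΓ0 hΓ using hall
  refine ⟨fun t => Γ (|t| + 1) t, hΓ0 _, ?_⟩
  rw [isMIntegralCurve_iff_isMIntegralCurveAt]
  intro t
  have hbig : Ioo (-(|t| + 1)) (|t| + 1) ∈ 𝓝 t :=
    Ioo_mem_nhds (by linarith [neg_abs_le t]) (by linarith [le_abs_self t])
  have hbig' : Ioo (-(|t| + 2)) (|t| + 2) ∈ 𝓝 t :=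
    mem_of_superset hbig (Ioo_subset_Ioo (by linarith) (by linarith))
  refine isMIntegralCurveAt_of_eventuallyEq ((hΓ (|t| + 2)).isMIntegralCurveAt hbig') ?_
  filter_upwards [hbig] with s hs
  have hle : |s| + 1 ≤ |t| + 2 := by
    linarith [abs_lt.2 hs]
  refine hu (Γ (|s| + 1)) (Γ (|t| + 2)) (-(|s| + 1)) (|s| + 1) 0
    ⟨by linarith [abs_nonneg s], by positivity⟩ (by rw [hΓ0]; exact hx) (hΓ _)
    ((hΓ (|t| + 2)).mono (Ioo_subset_Ioo (by linarith) hle)) (by rw [hΓ0, hΓ0]) ⟨by linarith [neg_abs_le s], by linarith [le_abs_self s]⟩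

/-- A uniform positive time on a compact set, from local ones. -/
theorem exists_uniform_time {X : Type*} [TopologicalSpace X] {K : Set X} (hK : IsCompact K)
    {P : ℝ → X → Prop} (hP : ∀ a b x, a ≤ b → P b x → P a x)
    (h : ∀ x ∈ K, ∃ ε > 0, ∀ᶠ y in 𝓝 x, P ε y) : ∃ ε > 0, ∀ x ∈ K, P ε x := by
  refine hK.induction_on (p := fun s => ∃ ε > 0, ∀ x ∈ s, P ε x) ⟨1, one_pos, by simp⟩
    (fun s t hst ⟨ε, hε, h⟩ => ⟨ε, hε, fun x hx => h x (hst hx)⟩) ?_ ?_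
  · rintro s t ⟨ε, hε, h⟩ ⟨ε', hε', h'⟩
    refine ⟨min ε ε', lt_min hε hε', ?_⟩
    rintro x (hx | hx)
    · exact hP _ _ _ (min_le_left _ _) (h x hx)
    · exact hP _ _ _ (min_le_right _ _) (h' x hx)
  · intro x hx
    obtain ⟨ε, hε, hx'⟩ := h x hx
    exact ⟨_, mem_nhdsWithin_of_mem_nhds hx', ε, hε, fun y hy => hy⟩

end IntegralCurves

/-! ### The Hamiltonian flow on energy surfaces in the interior -/

section HamiltonianFlow

open Set Filter Metric

variable {E : Type*} [NormedAddCommGroup E] [NormedSpace ℝ E]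
  {B : Type*} [TopologicalSpace B] {I : ModelWithCorners ℝ E B}
  {M : Type*} [TopologicalSpace M] [ChartedSpace B M]
  [FiniteDimensional ℝ E] [IsManifold I ∞ M]

omit [FiniteDimensional ℝ E] in
theorem form_self (σ : SymplecticForm I M) (x : M) (v : TangentSpace I x) : σ.form x v v = 0 := by
  have := σ.skew x v v
  linarith

theorem dHam_hamVF (σ : SymplecticForm I M) (H : Hamiltonian I M) (x : M) :
    dHam H x (hamVF σ H x) = 0 := by
  rw [← form_hamVF σ, form_self]

/-- Conservation of energy. -/
theorem ham_eq_of_isMIntegralCurveOn {σ : SymplecticForm I M} {H : Hamiltonian I M} {γ : ℝ → M}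
    {a b s t : ℝ} (hγ : IsMIntegralCurveOn γ (hamVF σ H) (Ioo a b)) (hs : s ∈ Ioo a b)
    (ht : t ∈ Ioo a b) : H (γ s) = H (γ t) := by
  have key : ∀ r ∈ Ioo a b, HasDerivAt (fun r => H (γ r)) 0 r := by
    intro r hr
    have h1 := HasMFDerivAt.comp r (mdifferentiableAt_ham H (γ r)).hasMFDerivAt
      ((hγ r hr).hasMFDerivAt (Ioo_mem_nhds hr.1 hr.2))
    let A : E →L[ℝ] ℝ := mfderiv I 𝓘(ℝ, ℝ) H (γ r)
    have h2 : HasFDerivAt (fun r => H (γ r))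
      (A.comp ((1 : ℝ →L[ℝ] ℝ).smulRight (hamVF σ H (γ r) : E))) r := h1.hasFDerivAt
    have h3 : dHam H (γ r) ((1 : ℝ) • hamVF σ H (γ r)) = 0 := by rw [one_smul, dHam_hamVF]
    have h4 := h2.hasDerivAt
    rwa [← h3]
  refine isOpen_Ioo.is_const_of_deriv_eq_zero (f := fun r => H (γ r)) isPreconnected_Ioo
    (fun r hr => (key r hr).differentiableAt.differentiableWithinAt)
    (fun r hr => (key r hr).deriv) hs ht

theorem mem_energySurface_of_isMIntegralCurveOn {σ : SymplecticForm I M} {H : Hamiltonian I M}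
    {γ : ℝ → M} {a b s t : ℝ} {x : M} (hs : s ∈ Ioo a b) (hγs : γ s ∈ energySurface H x)
    (hγ : IsMIntegralCurveOn γ (hamVF σ H) (Ioo a b)) (ht : t ∈ Ioo a b) :
    γ t ∈ energySurface H x := by
  rw [← energySurface_eq hγs]
  refine mem_energySurface_of_isPreconnected (S := γ '' Ioo a b)
    (isPreconnected_Ioo.image γ hγ.continuousOn) ⟨s, hs, rfl⟩ ⟨t, ht, rfl⟩ ?_
  rintro _ ⟨r, hr, rfl⟩
  exact ham_eq_of_isMIntegralCurveOn hγ hr hs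

/-- Around an interior point, the vector fields of all Hamiltonians close to `H` have a flow box of
the same size in the coordinates. -/
theorem exists_localFlow (σ : SymplecticForm I M) (H : Hamiltonian I M) {x₀ : M}
    (hx₀ : x₀ ∈ I.interior M) :
    ∃ (R τ : ℝ) (ψ : Hamiltonian I M → E → ℝ → E) (D : Hamiltonian I M → E → ℝ → E →L[ℝ] E),
      0 < R ∧ 0 < τ ∧ closedBall (extChartAt I x₀ x₀) R ⊆ chartInterior I x₀ ∧
      ∀ᶠ G in 𝓝 H, ∃ L K : ℝ,
        IsFlowBox (coordVF σ G x₀) (fderiv ℝ (coordVF σ G x₀)) (extChartAt I x₀ x₀) R τ L K ∧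
        IsLocalFlow (coordVF σ G x₀) (fderiv ℝ (coordVF σ G x₀)) (extChartAt I x₀ x₀) R τ
          (ψ G) (D G) := by
  have := FiniteDimensional.complete ℝ E
  set y₀ := extChartAt I x₀ x₀
  obtain ⟨R, hR, hRU⟩ := nhds_basis_closedBall.mem_iff.1
    ((isOpen_chartInterior x₀).mem_nhds (self_mem_chartDomain hx₀).2)
  have hK := isCompact_closedBall y₀ R
  have hc : ∀ G : Hamiltonian I M, ContinuousOn (coordVF σ G x₀) (closedBall y₀ R) := fun G y hy =>
    (contDiffAt_coordVF σ G (hRU hy)).continuousAt.continuousWithinAt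
  have hc' : ∀ G : Hamiltonian I M, ContinuousOn (fderiv ℝ (coordVF σ G x₀)) (closedBall y₀ R) :=
    fun G y hy => ((contDiffAt_coordVF σ G (hRU hy)).fderiv_right (m := 0)
      (by norm_num)).continuousAt.continuousWithinAt
  obtain ⟨L, hL⟩ := hK.exists_bound_of_continuousOn (hc H)
  obtain ⟨K, hK'⟩ := hK.exists_bound_of_continuousOn (hc' H)
  obtain ⟨hu, hu'⟩ := tendstoUniformlyOn_coordVF_and_fderiv σ H hK hRU
  set τ := min (R / (2 * (|L| + 1))) (1 / (2 * (|K| + 1))) with hτ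
  have hτ0 : 0 < τ := by positivity
  have hbox : ∀ᶠ G in 𝓝 H, IsFlowBox (coordVF σ G x₀) (fderiv ℝ (coordVF σ G x₀)) y₀ R τ
      (|L| + 1) (|K| + 1) := by
    filter_upwards [Metric.tendstoUniformlyOn_iff.1 hu 1 one_pos,
      Metric.tendstoUniformlyOn_iff.1 hu' 1 one_pos] with G h1 h2
    refine ⟨hR, hτ0, by positivity, fun y hy =>
      ((contDiffAt_coordVF σ G (hRU hy)).differentiableAt (by norm_num)).hasFDerivAt, hc' G,
      fun y hy => ?_, fun y hy => ?_, ?_, ?_⟩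
    · have := h1 y hy
      rw [dist_comm, dist_eq_norm] at this
      linarith [norm_le_norm_add_norm_sub' (coordVF σ G x₀ y) (coordVF σ H x₀ y), hL y hy,
        le_abs_self L]
    · have := h2 y hy
      rw [dist_comm, dist_eq_norm] at this
      linarith [norm_le_norm_add_norm_sub' (fderiv ℝ (coordVF σ G x₀) y)
        (fderiv ℝ (coordVF σ H x₀) y), hK' y hy, le_abs_self K]
    · calc (|L| + 1) * τ ≤ (|L| + 1) * (R / (2 * (|L| + 1))) :=
            mul_le_mul_of_nonneg_left (min_le_left _ _) (by positivity)
        _ = R / 2 := by field_simp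
    · calc 2 * (|K| + 1) * τ ≤ 2 * (|K| + 1) * (1 / (2 * (|K| + 1))) :=
            mul_le_mul_of_nonneg_left (min_le_right _ _) (by positivity)
        _ = 1 := by field_simp
  have hex : ∀ G : Hamiltonian I M, ∃ (ψ : E → ℝ → E) (D : E → ℝ → E →L[ℝ] E),
      IsFlowBox (coordVF σ G x₀) (fderiv ℝ (coordVF σ G x₀)) y₀ R τ (|L| + 1) (|K| + 1) →
      IsLocalFlow (coordVF σ G x₀) (fderiv ℝ (coordVF σ G x₀)) y₀ R τ ψ D := by
    intro G
    by_cases h : IsFlowBox (coordVF σ G x₀) (fderiv ℝ (coordVF σ G x₀)) y₀ R τ (|L| + 1) (|K| + 1)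
    · obtain ⟨ψ, D, hψ⟩ := h.exists_isLocalFlow
      exact ⟨ψ, D, fun _ => hψ⟩
    · exact ⟨fun y _ => y, fun _ _ => 0, fun h' => absurd h' h⟩
  choose ψ D hψ using hex
  exact ⟨R, τ, ψ, D, hR, hτ0, hRU, hbox.mono fun G hG => ⟨_, _, hG, hψ G hG⟩⟩

/-- The local flow in coordinates gives integral curves. -/
theorem IsLocalFlow.isMIntegralCurveOn {σ : SymplecticForm I M} {H : Hamiltonian I M} {x₀ : M}
    {y₀ : E} {R τ : ℝ} {DF : E → E →L[ℝ] E} {ψ : E → ℝ → E} {D : E → ℝ → E →L[ℝ] E}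
    (hψ : IsLocalFlow (coordVF σ H x₀) DF y₀ R τ ψ D)
    (hR : closedBall y₀ R ⊆ chartInterior I x₀) {y : E} (hy : y ∈ closedBall y₀ (R / 2)) :
    IsMIntegralCurveOn (fun t => (extChartAt I x₀).symm (ψ y t)) (hamVF σ H) (Ioo (-τ) τ) := by
  intro t ht
  have hm := hR (hψ.mem y hy t (Ioo_subset_Icc_self ht))
  have h1 : HasDerivAt (ψ y) (coordVF σ H x₀ (ψ y t)) t :=
    (hψ.deriv y hy t (Ioo_subset_Icc_self ht)).hasDerivAt (Icc_mem_nhds ht.1 ht.2)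
  have h2 := HasMFDerivAt.comp t (hasMFDerivAt_chart_symm hm) h1.hasFDerivAt.hasMFDerivAt
  refine HasMFDerivAt.hasMFDerivWithinAt ?_
  refine h2.congr_mfderiv ?_
  rw [hamVF_eq_ofCoord σ H hm]
  ext
  change ofCoord I x₀ (ψ y t) ((1 : ℝ) • coordVF σ H x₀ (ψ y t))
    = (1 : ℝ) • ofCoord I x₀ (ψ y t) (coordVF σ H x₀ (ψ y t))
  rw [map_smul]

variable [CompactSpace M] [T2Space M]

/-- Energy surfaces in the interior carry complete integral curves. -/
theorem exists_isMIntegralCurve_hamVF (σ : SymplecticForm I M) {H : Hamiltonian I M} {x : M}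
    (hx : energySurface H x ⊆ I.interior M) :
    ∃ γ : ℝ → M, γ 0 = x ∧ IsMIntegralCurve γ (hamVF σ H) := by
  have := FiniteDimensional.complete ℝ E
  obtain ⟨ε, hε, h⟩ := exists_uniform_time (isCompact_energySurface H x)
    (P := fun ε x => ∃ γ : ℝ → M, γ 0 = x ∧ IsMIntegralCurveOn γ (hamVF σ H) (Ioo (-ε) ε))
    (fun a b y hab ⟨γ, h0, hγ⟩ => ⟨γ, h0, hγ.mono (Ioo_subset_Ioo (neg_le_neg hab) hab)⟩) (by
      intro x₀ hx₀
      obtain ⟨R, τ, ψ, D, hR, hτ, hRU, hev⟩ := exists_localFlow σ H (hx hx₀)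
      obtain ⟨L, K, -, hψ⟩ := hev.self_of_nhds
      refine ⟨τ, hτ, ?_⟩
      have hd := self_mem_chartDomain (hx hx₀)
      filter_upwards [(isOpen_chartDomain x₀).mem_nhds hd,
        (continuousAt_chart hd).preimage_mem_nhds (closedBall_mem_nhds _ (half_pos hR))] with y hy hy'
      refine ⟨fun t => (extChartAt I x₀).symm (ψ H (extChartAt I x₀ y) t), ?_,
        hψ.isMIntegralCurveOn hRU hy'⟩
      simp only [hψ.zero _ hy', chart_symm_chart hy])
  exact exists_isMIntegralCurve_of_uniform_time hx (fun y hy => contMDiffAt_hamVF σ H hy)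
    (fun γ a b t₀ ht₀ h0 hγ t ht => mem_energySurface_of_isMIntegralCurveOn ht₀ h0 hγ ht) hε h
    (mem_energySurface_self H x)

section

variable {σ : SymplecticForm I M} {H : Hamiltonian I M} {x : M}

theorem hamFlow_spec (hx : energySurface H x ⊆ I.interior M) : hamFlow σ H 0 x = x ∧
    IsMIntegralCurve (fun t => hamFlow σ H t x) (hamVF σ H) := by
  have h := exists_isMIntegralCurve_hamVF σ hx
  have he : (fun t => hamFlow σ H t x) = h.choose := by
    ext t
    rw [hamFlow, dif_pos h]
  refine ⟨?_, he ▸ h.choose_spec.2⟩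
  have := congrFun he 0
  exact this.trans h.choose_spec.1

theorem hamFlow_zero (hx : energySurface H x ⊆ I.interior M) : hamFlow σ H 0 x = x :=
  (hamFlow_spec hx).1

theorem isMIntegralCurve_hamFlow (hx : energySurface H x ⊆ I.interior M) :
    IsMIntegralCurve (fun t => hamFlow σ H t x) (hamVF σ H) := (hamFlow_spec hx).2

theorem hamFlow_mem_energySurface (hx : energySurface H x ⊆ I.interior M) (t : ℝ) :
    hamFlow σ H t x ∈ energySurface H x := by
  have h := (isMIntegralCurve_hamFlow (σ := σ) hx).isMIntegralCurveOn (Ioo (-(|t| + 1)) (|t| + 1))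
  refine mem_energySurface_of_isMIntegralCurveOn (s := 0) ⟨by linarith [abs_nonneg t],
    by positivity⟩ ?_ h ⟨by linarith [neg_abs_le t], by linarith [le_abs_self t]⟩
  rw [hamFlow_zero hx]
  exact mem_energySurface_self H x

theorem energySurface_hamFlow (hx : energySurface H x ⊆ I.interior M) (t : ℝ) :
    energySurface H (hamFlow σ H t x) = energySurface H x :=
  energySurface_eq (hamFlow_mem_energySurface hx t)

theorem energySurface_hamFlow_subset (hx : energySurface H x ⊆ I.interior M) (t : ℝ) :
    energySurface H (hamFlow σ H t x) ⊆ I.interior M := by rwa [energySurface_hamFlow hx]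

/-- Uniqueness of the flow. -/
theorem eq_hamFlow_of_isMIntegralCurveOn (hx : energySurface H x ⊆ I.interior M) {γ : ℝ → M}
    {τ t : ℝ} (h0 : γ 0 = x) (hγ : IsMIntegralCurveOn γ (hamVF σ H) (Ioo (-τ) τ))
    (ht : t ∈ Ioo (-τ) τ) : γ t = hamFlow σ H t x := by
  have hτ : (0 : ℝ) ∈ Ioo (-τ) τ := by
    have : 0 < τ := by linarith [ht.1, ht.2]
    exact ⟨by linarith, this⟩
  refine (isMIntegralCurveOn_Ioo_eqOn hτ (fun s _ => hx (hamFlow_mem_energySurface hx s))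
    (fun y hy => contMDiffAt_hamVF σ H hy) ((isMIntegralCurve_hamFlow hx).isMIntegralCurveOn _) hγ
    ?_ ht).symm
  rw [hamFlow_zero hx, h0]

theorem hamFlow_add (hx : energySurface H x ⊆ I.interior M) (s t : ℝ) :
    hamFlow σ H (s + t) x = hamFlow σ H s (hamFlow σ H t x) := by
  have h1 := (isMIntegralCurve_hamFlow (σ := σ) hx).comp_add t
  refine eq_hamFlow_of_isMIntegralCurveOn (σ := σ) (γ := fun s => hamFlow σ H (s + t) x)
    (τ := |s| + 1) (energySurface_hamFlow_subset hx t) (by simp) (h1.isMIntegralCurveOn _)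
    ⟨by linarith [neg_abs_le s], by linarith [le_abs_self s]⟩

theorem hamFlow_neg_hamFlow (hx : energySurface H x ⊆ I.interior M) (t : ℝ) :
    hamFlow σ H (-t) (hamFlow σ H t x) = x := by
  rw [← hamFlow_add hx, neg_add_cancel, hamFlow_zero hx]

theorem hamFlow_image_energySurface (hx : energySurface H x ⊆ I.interior M) (t : ℝ) :
    hamFlow σ H t '' energySurface H x = energySurface H x := by
  have hy : ∀ y ∈ energySurface H x, energySurface H y ⊆ I.interior M := fun y hy => by
    rwa [energySurface_eq hy]
  have hm : ∀ s, ∀ y ∈ energySurface H x, hamFlow σ H s y ∈ energySurface H x := fun s y hyx => by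
    have := hamFlow_mem_energySurface (σ := σ) (hy y hyx) s
    rwa [energySurface_eq hyx] at this
  refine Subset.antisymm ?_ fun y hyx => ⟨hamFlow σ H (-t) y, hm _ y hyx, ?_⟩
  · rintro _ ⟨y, hyx, rfl⟩
    exact hm t y hyx
  · have := hamFlow_neg_hamFlow (σ := σ) (hy y hyx) (-t)
    rwa [neg_neg] at this

end

end HamiltonianFlow

/-! ### The tangent flow -/

section TangentFlow

open Set Filter Metric

variable {E : Type*} [NormedAddCommGroup E] [NormedSpace ℝ E]
  {B : Type*} [TopologicalSpace B] {I : ModelWithCorners ℝ E B}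
  {M : Type*} [TopologicalSpace M] [ChartedSpace B M]

theorem tangentBundle_mk_eq {x x' : M} {v : TangentSpace I x} {v' : TangentSpace I x'}
    (h : x = x') (hv : (v : E) = (v' : E)) :
    (⟨x, v⟩ : TangentBundle I M) = ⟨x', v'⟩ := by
  subst h
  exact congrArg (fun u : TangentSpace I x => (⟨x, u⟩ : TangentBundle I M)) hv

theorem forall_real_of_add {P : ℝ → Prop} {τ : ℝ} (hτ : 0 < τ) (h : ∀ t ∈ Ioo (-τ) τ, P t)
    (hadd : ∀ s t, P s → P t → P (s + t)) (t : ℝ) : P t := by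
  obtain ⟨n, hn⟩ := exists_nat_gt (|t| / τ)
  have hn0 : (0 : ℝ) < n := (div_nonneg (abs_nonneg t) hτ.le).trans_lt hn
  have h1 : P (t / n) := by
    refine h _ (abs_lt.1 ?_)
    rw [abs_div, Nat.abs_cast, div_lt_iff₀ hn0]
    rw [div_lt_iff₀ hτ] at hn
    linarith
  have h2 : ∀ k : ℕ, P (k * (t / n)) := by
    intro k
    induction k with
    | zero => simpa using h 0 ⟨by linarith, hτ⟩
    | succ k ih =>
      have := hadd _ _ ih h1
      rwa [← add_one_mul, ← Nat.cast_succ] at this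
  have := h2 n
  rwa [mul_div_cancel₀ _ hn0.ne'] at this

variable [FiniteDimensional ℝ E] [IsManifold I ∞ M]

/-- The tangent flow, as a family of endomorphisms of the model space. -/
def flowD (σ : SymplecticForm I M) (H : Hamiltonian I M) (t : ℝ) (x : M) : E →L[ℝ] E :=
  tangentFlow σ H t x

/-- The tangent flow as a map on the tangent bundle, jointly with the Hamiltonian. -/
def flowMap (σ : SymplecticForm I M) (t : ℝ) (q : Hamiltonian I M × TangentBundle I M) :
    TangentBundle I M :=
  ⟨hamFlow σ q.1 t q.2.1, tangentFlow σ q.1 t q.2.1 q.2.2⟩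

variable [CompactSpace M] [T2Space M]

theorem eventually_energySurface_subset_interior' {H : Hamiltonian I M} {x : M}
    (h : energySurface H x ⊆ I.interior M) :
    ∀ᶠ y in 𝓝 x, energySurface H y ⊆ I.interior M :=
  ((Continuous.prodMk_right H).tendsto x).eventually (eventually_energySurface_subset_interior h)

section LocalFlow

variable {σ : SymplecticForm I M} {H : Hamiltonian I M} {x₀ x : M} {R τ L K : ℝ} {ψ : E → ℝ → E}
  {D : E → ℝ → E →L[ℝ] E}

theorem hamFlow_eq_localFlow
    (hψ : IsLocalFlow (coordVF σ H x₀) (fderiv ℝ (coordVF σ H x₀)) (extChartAt I x₀ x₀) R τ ψ D)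
    (hR : closedBall (extChartAt I x₀ x₀) R ⊆ chartInterior I x₀)
    (hx : energySurface H x ⊆ I.interior M) (hxd : x ∈ chartDomain I x₀)
    (hxb : extChartAt I x₀ x ∈ closedBall (extChartAt I x₀ x₀) (R / 2)) {t : ℝ}
    (ht : t ∈ Ioo (-τ) τ) :
    hamFlow σ H t x = (extChartAt I x₀).symm (ψ (extChartAt I x₀ x) t) := by
  refine (eq_hamFlow_of_isMIntegralCurveOn hx
    (γ := fun t => (extChartAt I x₀).symm (ψ (extChartAt I x₀ x) t)) ?_
    (hψ.isMIntegralCurveOn hR hxb) ht).symm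
  simp only [hψ.zero _ hxb, chart_symm_chart hxd]

/-- The derivative of the flow is given by the variational equation in coordinates. -/
theorem hasMFDerivAt_hamFlow_of_localFlow
    (h : IsFlowBox (coordVF σ H x₀) (fderiv ℝ (coordVF σ H x₀)) (extChartAt I x₀ x₀) R τ L K)
    (hψ : IsLocalFlow (coordVF σ H x₀) (fderiv ℝ (coordVF σ H x₀)) (extChartAt I x₀ x₀) R τ ψ D)
    (hR : closedBall (extChartAt I x₀ x₀) R ⊆ chartInterior I x₀)
    (hx : energySurface H x ⊆ I.interior M) (hxd : x ∈ chartDomain I x₀)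
    (hxb : extChartAt I x₀ x ∈ ball (extChartAt I x₀ x₀) (R / 2)) {t : ℝ} (ht : t ∈ Ioo (-τ) τ) :
    HasMFDerivAt I I (hamFlow σ H t) x
      ((ofCoord I x₀ (ψ (extChartAt I x₀ x) t)).comp
        ((D (extChartAt I x₀ x) t).comp (toCoord I x₀ x)) :) := by
  have ht' := Ioo_subset_Icc_self ht
  have hm := hR (hψ.mem _ (ball_subset_closedBall hxb) t ht')
  have h1 := HasMFDerivAt.comp x (hasMFDerivAt_chart_symm hm)
    (HasMFDerivAt.comp x (hψ.hasFDerivAt h hxb ht').hasMFDerivAt (hasMFDerivAt_chart hxd))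
  refine HasMFDerivAt.congr_of_eventuallyEq h1 ?_
  filter_upwards [eventually_energySurface_subset_interior' hx, (isOpen_chartDomain x₀).mem_nhds hxd,
    (continuousAt_chart hxd).preimage_mem_nhds (isOpen_ball.mem_nhds hxb)] with y h1 h2 h3
  exact hamFlow_eq_localFlow hψ hR h1 h2 (ball_subset_closedBall h3) ht

theorem toCoord_flowD_of_localFlow
    (h : IsFlowBox (coordVF σ H x₀) (fderiv ℝ (coordVF σ H x₀)) (extChartAt I x₀ x₀) R τ L K)
    (hψ : IsLocalFlow (coordVF σ H x₀) (fderiv ℝ (coordVF σ H x₀)) (extChartAt I x₀ x₀) R τ ψ D)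
    (hR : closedBall (extChartAt I x₀ x₀) R ⊆ chartInterior I x₀)
    (hx : energySurface H x ⊆ I.interior M) (hxd : x ∈ chartDomain I x₀)
    (hxb : extChartAt I x₀ x ∈ ball (extChartAt I x₀ x₀) (R / 2)) {t : ℝ} (ht : t ∈ Ioo (-τ) τ)
    (v : E) : toCoord I x₀ (hamFlow σ H t x) (flowD σ H t x v)
      = D (extChartAt I x₀ x) t (toCoord I x₀ x v) := by
  have h1 := (hasMFDerivAt_hamFlow_of_localFlow h hψ hR hx hxd hxb ht).mfderiv
  have h2 : flowD σ H t x v = ofCoord I x₀ (ψ (extChartAt I x₀ x) t)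
      (D (extChartAt I x₀ x) t (toCoord I x₀ x v)) := congrArg (fun A : E →L[ℝ] E => A v) h1
  rw [h2, hamFlow_eq_localFlow hψ hR hx hxd (ball_subset_closedBall hxb) ht]
  exact toCoord_ofCoord (hR (hψ.mem _ (ball_subset_closedBall hxb) t (Ioo_subset_Icc_self ht))) _

end LocalFlow

/-- For small times, the flow is differentiable and the tangent flow is continuous, jointly with
the Hamiltonian. -/
theorem exists_time_flow_regular (σ : SymplecticForm I M) (H : Hamiltonian I M) {x₀ : M}
    (hx₀ : x₀ ∈ I.interior M) : ∃ τ > 0, ∀ᶠ x in 𝓝 x₀, ∀ t ∈ Ioo (-τ) τ,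
      energySurface H x ⊆ I.interior M → MDifferentiableAt I I (hamFlow σ H t) x ∧
        ∀ v : TangentSpace I x, ContinuousAt (flowMap σ t) (H, ⟨x, v⟩) := by
  obtain ⟨R, τ, ψ, D, hR, hτ, hRU, hev⟩ := exists_localFlow σ H hx₀
  refine ⟨τ, hτ, ?_⟩
  have hd := self_mem_chartDomain hx₀
  filter_upwards [(isOpen_chartDomain x₀).mem_nhds hd,
    (continuousAt_chart hd).preimage_mem_nhds (ball_mem_nhds _ (half_pos hR))] with x hxd hxb t ht hx
  obtain ⟨L, K, hbox, hψ⟩ := hev.self_of_nhds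
  refine ⟨(hasMFDerivAt_hamFlow_of_localFlow hbox hψ hRU hx hxd hxb ht).mdifferentiableAt,
    fun v => ?_⟩
  have hxb' := ball_subset_closedBall hxb
  have ht' := Ioo_subset_Icc_self ht
  have hm := hRU (hψ.mem _ hxb' t ht')
  have hfx := hamFlow_eq_localFlow hψ hRU hx hxd hxb' ht
  have hsnd : Tendsto (fun q : Hamiltonian I M × TangentBundle I M => q.2) (𝓝 (H, ⟨x, v⟩))
      (𝓝 ⟨x, v⟩) := continuousAt_snd
  rw [tendsto_tangentBundle_iff (x₀ := x₀) (by exact hxd)] at hsnd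
  obtain ⟨hs1, hs2⟩ := hsnd
  have hfst : Tendsto (fun q : Hamiltonian I M × TangentBundle I M => q.1) (𝓝 (H, ⟨x, v⟩))
      (𝓝 H) := continuousAt_fst
  have hz : Tendsto (fun q : Hamiltonian I M × TangentBundle I M => extChartAt I x₀ q.2.1)
      (𝓝 (H, ⟨x, v⟩)) (𝓝 (extChartAt I x₀ x)) := (continuousAt_chart hxd).tendsto.comp hs1
  have hlim := hψ.tendsto hbox (l := 𝓝 ((H, ⟨x, v⟩) : Hamiltonian I M × TangentBundle I M))
    (ψ' := fun q => ψ q.1) (D' := fun q => D q.1) (F' := fun q => coordVF σ q.1 x₀)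
    (DF' := fun q => fderiv ℝ (coordVF σ q.1 x₀))
    ((hfst.eventually hev).mono fun q ⟨_, _, _, h⟩ => h)
    (fun u hu => hfst.eventually ((tendstoUniformlyOn_coordVF_and_fderiv σ H
      (isCompact_closedBall _ _) hRU).1 u hu))
    (fun u hu => hfst.eventually ((tendstoUniformlyOn_coordVF_and_fderiv σ H
      (isCompact_closedBall _ _) hRU).2 u hu)) hxb hz ht'
  have hgood : ∀ᶠ q : Hamiltonian I M × TangentBundle I M in 𝓝 (H, ⟨x, v⟩),
      (∃ L K : ℝ, IsFlowBox (coordVF σ q.1 x₀) (fderiv ℝ (coordVF σ q.1 x₀))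
          (extChartAt I x₀ x₀) R τ L K ∧
        IsLocalFlow (coordVF σ q.1 x₀) (fderiv ℝ (coordVF σ q.1 x₀)) (extChartAt I x₀ x₀) R τ
          (ψ q.1) (D q.1)) ∧ energySurface q.1 q.2.1 ⊆ I.interior M ∧
      q.2.1 ∈ chartDomain I x₀ ∧ extChartAt I x₀ q.2.1 ∈ ball (extChartAt I x₀ x₀) (R / 2) := by
    refine (hfst.eventually hev).and (((hfst.prodMk_nhds hs1).eventually
      (eventually_energySurface_subset_interior hx)).and ?_)
    exact (hs1.eventually ((isOpen_chartDomain x₀).mem_nhds hxd)).and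
      (hz.eventually (isOpen_ball.mem_nhds hxb))
  rw [ContinuousAt, tendsto_tangentBundle_iff (x₀ := x₀)
    (by change hamFlow σ H t x ∈ _; rw [hfx]; exact symm_mem_chartDomain hm)]
  constructor
  · change Tendsto _ _ (𝓝 (hamFlow σ H t x))
    rw [hfx]
    refine ((continuousAt_chart_symm hm).tendsto.comp hlim.1).congr' ?_
    filter_upwards [hgood] with q hq
    obtain ⟨⟨_, _, _, h2⟩, h3, h4, h5⟩ := hq
    exact (hamFlow_eq_localFlow h2 hRU h3 h4 (ball_subset_closedBall h5) ht).symm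
  · have e1 := toCoord_flowD_of_localFlow hbox hψ hRU hx hxd hxb ht v
    change Tendsto _ _ (𝓝 (toCoord I x₀ (hamFlow σ H t x) (flowD σ H t x v)))
    rw [e1]
    refine Tendsto.congr' ?_ (((isBoundedBilinearMap_apply (𝕜 := ℝ) (E := E)
      (F := E)).continuous.tendsto (D H (extChartAt I x₀ x) t, toCoord I x₀ x v)).comp
      (hlim.2.prodMk_nhds hs2))
    filter_upwards [hgood] with q hq
    obtain ⟨⟨_, _, h1, h2⟩, h3, h4, h5⟩ := hq
    exact (toCoord_flowD_of_localFlow h1 h2 hRU h3 h4 h5 ht q.2.2).symm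

variable {σ : SymplecticForm I M} {H : Hamiltonian I M} {x : M}

theorem hamFlow_add_eventuallyEq (hx : energySurface H x ⊆ I.interior M) (s t : ℝ) :
    hamFlow σ H (s + t) =ᶠ[𝓝 x] hamFlow σ H s ∘ hamFlow σ H t := by
  filter_upwards [eventually_energySurface_subset_interior' hx] with y hy
  exact hamFlow_add hy s t

theorem mdifferentiableAt_hamFlow (hx : energySurface H x ⊆ I.interior M) (t : ℝ) :
    MDifferentiableAt I I (hamFlow σ H t) x := by
  obtain ⟨τ, hτ, h⟩ := exists_uniform_time (isCompact_energySurface H x)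
    (P := fun τ y => ∀ t ∈ Ioo (-τ) τ, energySurface H y ⊆ I.interior M →
      MDifferentiableAt I I (hamFlow σ H t) y)
    (fun a b y hab h t ht => h t ⟨by linarith [ht.1], by linarith [ht.2]⟩) (fun y hy => by
      obtain ⟨τ, hτ, h⟩ := exists_time_flow_regular σ H (hx hy)
      exact ⟨τ, hτ, h.mono fun z hz t ht hz' => (hz t ht hz').1⟩)
  have hgood : ∀ y ∈ energySurface H x, energySurface H y ⊆ I.interior M := fun y hy => by
    rwa [energySurface_eq hy]
  refine forall_real_of_add (P := fun t => ∀ y ∈ energySurface H x,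
    MDifferentiableAt I I (hamFlow σ H t) y) hτ (fun t ht y hy => h y hy t ht (hgood y hy)) ?_ t x
    (mem_energySurface_self H x)
  intro s t hs ht y hy
  refine MDifferentiableAt.congr_of_eventuallyEq ?_ (hamFlow_add_eventuallyEq (hgood y hy) s t)
  refine MDifferentiableAt.comp y (hs _ ?_) (ht y hy)
  rw [← energySurface_eq hy]
  exact hamFlow_mem_energySurface (hgood y hy) t

theorem flowD_zero (hx : energySurface H x ⊆ I.interior M) :
    flowD σ H 0 x = ContinuousLinearMap.id ℝ E := by
  have : hamFlow σ H 0 =ᶠ[𝓝 x] id := by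
    filter_upwards [eventually_energySurface_subset_interior' hx] with y hy
    exact hamFlow_zero hy
  have h := this.mfderiv_eq (I := I) (I' := I)
  rw [mfderiv_id] at h
  exact h

theorem flowD_add (hx : energySurface H x ⊆ I.interior M) (s t : ℝ) (v : E) :
    flowD σ H (s + t) x v = flowD σ H s (hamFlow σ H t x) (flowD σ H t x v) := by
  have h := (hamFlow_add_eventuallyEq (σ := σ) hx s t).mfderiv_eq (I := I) (I' := I)
  rw [mfderiv_comp x (mdifferentiableAt_hamFlow (energySurface_hamFlow_subset hx t) s)
    (mdifferentiableAt_hamFlow hx t)] at h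
  exact congrArg (fun A : E →L[ℝ] E => A v) h

/-- The tangent flow depends continuously on the Hamiltonian and the tangent vector. -/
theorem continuousAt_flowMap (hx : energySurface H x ⊆ I.interior M) (t : ℝ)
    (v : TangentSpace I x) : ContinuousAt (flowMap σ t) (H, ⟨x, v⟩) := by
  obtain ⟨τ, hτ, h⟩ := exists_uniform_time (isCompact_energySurface H x)
    (P := fun τ y => ∀ t ∈ Ioo (-τ) τ, energySurface H y ⊆ I.interior M →
      ∀ v : TangentSpace I y, ContinuousAt (flowMap σ t) (H, ⟨y, v⟩))
    (fun a b y hab h t ht => h t ⟨by linarith [ht.1], by linarith [ht.2]⟩) (fun y hy => by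
      obtain ⟨τ, hτ, h⟩ := exists_time_flow_regular σ H (hx hy)
      exact ⟨τ, hτ, h.mono fun z hz t ht hz' => (hz t ht hz').2⟩)
  have hgood : ∀ y ∈ energySurface H x, energySurface H y ⊆ I.interior M := fun y hy => by
    rwa [energySurface_eq hy]
  refine forall_real_of_add (P := fun t => ∀ y ∈ energySurface H x,
    ∀ v : TangentSpace I y, ContinuousAt (flowMap σ t) (H, ⟨y, v⟩)) hτ
    (fun t ht y hy => h y hy t ht (hgood y hy)) ?_ t x (mem_energySurface_self H x) v
  intro s t hs ht y hy v
  have hty : hamFlow σ H t y ∈ energySurface H x := by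
    rw [← energySurface_eq hy]
    exact hamFlow_mem_energySurface (hgood y hy) t
  have h1 : ContinuousAt (fun q : Hamiltonian I M × TangentBundle I M => (q.1, flowMap σ t q))
      (H, ⟨y, v⟩) := continuousAt_fst.prodMk (ht y hy v)
  have h2 := (hs _ hty (tangentFlow σ H t y v)).comp_of_eq h1 rfl
  refine h2.congr ?_
  have h3 : Tendsto (fun q : Hamiltonian I M × TangentBundle I M => (q.1, q.2.1)) (𝓝 (H, ⟨y, v⟩))
      (𝓝 (H, y)) := by
    refine Tendsto.prodMk_nhds continuousAt_fst ?_
    exact ((FiberBundle.continuous_proj E (TangentSpace I : M → Type _)).tendsto _).comp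
      continuousAt_snd
  filter_upwards [h3.eventually (eventually_energySurface_subset_interior (hgood y hy))] with q hq
  exact tangentBundle_mk_eq (hamFlow_add hq s t).symm (flowD_add hq s t q.2.2).symm

end TangentFlow

/-! ### Quantities preserved by the tangent flow -/

section Invariance

open Set Filter Metric

section BilinearDerivatives

variable {F : Type*} [NormedAddCommGroup F] [NormedSpace ℝ F]

set_option synthInstance.maxHeartbeats 200000 in
/-- The product rule for a field of bilinear forms with a vector field inserted. -/
theorem fderiv_bilin_apply {β : F → F →L[ℝ] F →L[ℝ] ℝ} {X : F → F} {f : F → F →L[ℝ] ℝ} {y : F}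
    (hβ : DifferentiableAt ℝ β y) (hX : DifferentiableAt ℝ X y)
    (h : (fun z => β z (X z)) =ᶠ[𝓝 y] f) (a b : F) :
    fderiv ℝ β y a (X y) b + β y (fderiv ℝ X y a) b = fderiv ℝ f y a b := by
  rw [← h.fderiv_eq, (hβ.hasFDerivAt.clm_apply hX.hasFDerivAt).fderiv, add_comm]
  rfl

theorem hasDerivAt_clm_comp_apply {G : Type*} [NormedAddCommGroup G] [NormedSpace ℝ G]
    {β : F → F →L[ℝ] G} {c a : ℝ → F} {c' a' : F} {t : ℝ} (hβ : DifferentiableAt ℝ β (c t))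
    (hc : HasDerivAt c c' t) (ha : HasDerivAt a a' t) :
    HasDerivAt (fun s => β (c s) (a s)) (fderiv ℝ β (c t) c' (a t) + β (c t) a') t := by
  have h1 : HasDerivAt (fun s => β (c s)) (fderiv ℝ β (c t) c') t :=
    hβ.hasFDerivAt.comp_hasDerivAt t hc
  exact h1.clm_apply ha

/-- The derivative of a bilinear form along a curve with two vector fields along it. -/
theorem hasDerivAt_bilin_apply {β : F → F →L[ℝ] F →L[ℝ] ℝ} {c a b : ℝ → F} {c' a' b' : F} {t : ℝ}
    (hβ : DifferentiableAt ℝ β (c t)) (hc : HasDerivAt c c' t) (ha : HasDerivAt a a' t)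
    (hb : HasDerivAt b b' t) : HasDerivAt (fun s => β (c s) (a s) (b s))
      (fderiv ℝ β (c t) c' (a t) (b t) + β (c t) a' (b t) + β (c t) (a t) b') t :=
  HasDerivAt.clm_apply (hasDerivAt_clm_comp_apply hβ hc ha) hb

end BilinearDerivatives

variable {E : Type*} [NormedAddCommGroup E] [NormedSpace ℝ E]
  {B : Type*} [TopologicalSpace B] {I : ModelWithCorners ℝ E B}
  {M : Type*} [TopologicalSpace M] [ChartedSpace B M]
  [FiniteDimensional ℝ E] [IsManifold I ∞ M]

theorem differentiableAt_coordBilin (σ : SymplecticForm I M) {x₀ : M} {y : E}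
    (hy : y ∈ chartInterior I x₀) : DifferentiableAt ℝ (coordBilin σ.form x₀) y :=
  ((contDiffOn_coordBilin σ.form σ.contMDiff x₀).contDiffAt
    ((isOpen_chartInterior x₀).mem_nhds hy)).differentiableAt (by simp)

theorem fderivWithin_coordForm (σ : SymplecticForm I M) {x₀ : M} {y : E}
    (hy : y ∈ chartInterior I x₀) (u v w : E) :
    fderivWithin ℝ (coordForm σ.form x₀ v w) (range I) y u
      = fderiv ℝ (coordBilin σ.form x₀) y u v w := by
  rw [fderivWithin_of_mem_nhds (range_mem_nhds_of_mem_chartInterior hy)]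
  have hd := differentiableAt_coordBilin σ hy
  have h1 : HasFDerivAt (fun z => coordBilin σ.form x₀ z v)
      ((fderiv ℝ (coordBilin σ.form x₀) y).flip v) y := by
    simpa using hd.hasFDerivAt.clm_apply (hasFDerivAt_const v y)
  have h2 : HasFDerivAt (fun z => coordBilin σ.form x₀ z v w)
      (((fderiv ℝ (coordBilin σ.form x₀) y).flip v).flip w) y := by
    simpa using h1.clm_apply (hasFDerivAt_const w y)
  have h3 : (fun z => coordBilin σ.form x₀ z v w) = coordForm σ.form x₀ v w := rfl
  rw [← h3, h2.fderiv]
  rfl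

theorem fderiv_coordBilin_skew (σ : SymplecticForm I M) {x₀ : M} {y : E}
    (hy : y ∈ chartInterior I x₀) (u a b : E) :
    fderiv ℝ (coordBilin σ.form x₀) y u a b = -fderiv ℝ (coordBilin σ.form x₀) y u b a := by
  rw [← fderivWithin_coordForm σ hy, ← fderivWithin_coordForm σ hy]
  have : coordForm σ.form x₀ a b = -coordForm σ.form x₀ b a := by
    ext z
    exact σ.skew _ _ _
  rw [fderivWithin_of_mem_nhds (range_mem_nhds_of_mem_chartInterior hy),
    fderivWithin_of_mem_nhds (range_mem_nhds_of_mem_chartInterior hy), this, fderiv_neg]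
  rfl

/-- The Lie derivative of the symplectic form along a Hamiltonian vector field vanishes, in
coordinates: this combines `dσ = 0` and the symmetry of the second derivative of `H`. -/
theorem lieDeriv_coordBilin_eq_zero (σ : SymplecticForm I M) (H : Hamiltonian I M) {x₀ : M} {y : E}
    (hy : y ∈ chartInterior I x₀) (v w : E) :
    fderiv ℝ (coordBilin σ.form x₀) y (coordVF σ H x₀ y) v w
      + coordBilin σ.form x₀ y (fderiv ℝ (coordVF σ H x₀) y v) w
      + coordBilin σ.form x₀ y v (fderiv ℝ (coordVF σ H x₀) y w) = 0 := by
  -- differentiating `σ(X, b) = dH(b)` in the direction `a`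
  have hdiff := fderiv_bilin_apply (differentiableAt_coordBilin σ hy)
    ((contDiffAt_coordVF σ H hy).differentiableAt (by norm_num))
    (f := fderiv ℝ (coordHam H x₀)) (by
      filter_upwards [(isOpen_chartInterior x₀).mem_nhds hy] with z hz
      ext u
      exact coordBilin_coordVF σ H hz u)
  have hsymm : fderiv ℝ (fderiv ℝ (coordHam H x₀)) y v w
      = fderiv ℝ (fderiv ℝ (coordHam H x₀)) y w v :=
    ((contDiffAt_coordHam H hy).isSymmSndFDerivAt (by simp)).eq v w
  have hclosed := σ.closed x₀ y (chartInterior_subset x₀ hy) (coordVF σ H x₀ y) v w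
  rw [fderivWithin_coordForm σ hy, fderivWithin_coordForm σ hy, fderivWithin_coordForm σ hy]
    at hclosed
  have e1 := hdiff v w
  have e2 := hdiff w v
  have e3 : coordBilin σ.form x₀ y v (fderiv ℝ (coordVF σ H x₀) y w)
      = -coordBilin σ.form x₀ y (fderiv ℝ (coordVF σ H x₀) y w) v := σ.skew _ _ _
  have e4 := fderiv_coordBilin_skew σ hy v w (coordVF σ H x₀ y)
  linarith

variable [CompactSpace M] [T2Space M]
variable {σ : SymplecticForm I M} {H : Hamiltonian I M} {x : M}

theorem hasDerivAt_form_flowD_zero (hx : energySurface H x ⊆ I.interior M) (v w : E) :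
    HasDerivAt (fun t => σ.form (hamFlow σ H t x) (flowD σ H t x v) (flowD σ H t x w)) 0 0 := by
  have hxI := hx (mem_energySurface_self H x)
  obtain ⟨R, τ, ψ, D, hR, hτ, hRU, hev⟩ := exists_localFlow σ H hxI
  obtain ⟨L, K, hbox, hψ⟩ := hev.self_of_nhds
  have hd := self_mem_chartDomain hxI
  set y := extChartAt I x x with hy
  have hyb : y ∈ ball y (R / 2) := mem_ball_self (half_pos hR)
  have hyb' := ball_subset_closedBall hyb
  have h0 : (0 : ℝ) ∈ Ioo (-τ) τ := ⟨by linarith, hτ⟩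
  have hI0 := Icc_mem_nhds h0.1 h0.2
  have hψ1 : HasDerivAt (ψ H y) (coordVF σ H x y) 0 := by
    have := (hψ.deriv y hyb' 0 (Ioo_subset_Icc_self h0)).hasDerivAt hI0
    rwa [hψ.zero y hyb'] at this
  have hD1 : HasDerivAt (D H y) (fderiv ℝ (coordVF σ H x) y) 0 := by
    have := (hψ.D_deriv y hyb' 0 (Ioo_subset_Icc_self h0)).hasDerivAt hI0
    rwa [hψ.zero y hyb', hψ.D_zero y hyb', ContinuousLinearMap.comp_id] at this
  have hDv : ∀ u, HasDerivAt (fun t => D H y t u) (fderiv ℝ (coordVF σ H x) y u) 0 := fun u => by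
    simpa using hD1.clm_apply (hasDerivAt_const 0 u)
  have h2 := hasDerivAt_bilin_apply (β := coordBilin σ.form x) (c := ψ H y)
    (by rw [hψ.zero y hyb']; exact differentiableAt_coordBilin σ hd.2) hψ1
    (hDv (toCoord I x x v)) (hDv (toCoord I x x w))
  rw [hψ.zero y hyb', hψ.D_zero y hyb', ContinuousLinearMap.id_apply,
    ContinuousLinearMap.id_apply, lieDeriv_coordBilin_eq_zero σ H hd.2] at h2
  refine h2.congr_of_eventuallyEq ?_
  filter_upwards [Ioo_mem_nhds h0.1 h0.2] with t ht
  have hm := hRU (hψ.mem _ hyb' t (Ioo_subset_Icc_self ht))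
  have hf := hamFlow_eq_localFlow hψ hRU hx hd hyb' ht
  rw [← toCoord_flowD_of_localFlow hbox hψ hRU hx hd hyb ht v,
    ← toCoord_flowD_of_localFlow hbox hψ hRU hx hd hyb ht w]
  have hm' : hamFlow σ H t x ∈ chartDomain I x := by rw [hf]; exact symm_mem_chartDomain hm
  have := coordBilin_toCoord σ.form hm' (flowD σ H t x v) (flowD σ H t x w)
  rw [← this]
  congr 3
  rw [hf, chart_chart_symm hm]

/-- The Hamiltonian flow preserves the symplectic form. -/
theorem form_flowD (hx : energySurface H x ⊆ I.interior M) (t : ℝ) (v w : E) :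
    σ.form (hamFlow σ H t x) (flowD σ H t x v) (flowD σ H t x w) = σ.form x v w := by
  have hder : ∀ t, HasDerivAt
      (fun t => σ.form (hamFlow σ H t x) (flowD σ H t x v) (flowD σ H t x w)) 0 t := by
    intro t
    have h1 := hasDerivAt_form_flowD_zero (σ := σ) (energySurface_hamFlow_subset (σ := σ) hx t)
      (flowD σ H t x v) (flowD σ H t x w)
    have h2 := HasDerivAt.comp_sub_const t t (by rw [sub_self]; exact h1)
    refine h2.congr_of_eventuallyEq (Eventually.of_forall fun s => ?_)
    beta_reduce
    rw [← flowD_add hx, ← flowD_add hx, ← hamFlow_add hx, sub_add_cancel]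
  have := is_const_of_deriv_eq_zero (fun t => (hder t).differentiableAt)
    (fun t => (hder t).deriv) t 0
  rw [this, flowD_zero hx, hamFlow_zero hx]
  rfl

theorem dHam_flowD (hx : energySurface H x ⊆ I.interior M) (t : ℝ) (v : E) :
    dHam H (hamFlow σ H t x) (flowD σ H t x v) = dHam H x v := by
  have h1 : (H : M → ℝ) ∘ hamFlow σ H t =ᶠ[𝓝 x] H := by
    filter_upwards [eventually_energySurface_subset_interior' hx] with y hy
    exact ham_eq_of_mem_energySurface (hamFlow_mem_energySurface hy t)
  have h2 := h1.mfderiv_eq (I := I) (I' := 𝓘(ℝ, ℝ))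
  rw [mfderiv_comp x (mdifferentiableAt_ham H _) (mdifferentiableAt_hamFlow hx t)] at h2
  exact congrArg (fun A : E →L[ℝ] ℝ => A v) h2

theorem flowD_hamVF (hx : energySurface H x ⊆ I.interior M) (t : ℝ) :
    flowD σ H t x (hamVF σ H x) = hamVF σ H (hamFlow σ H t x) := by
  have h1 : HasMFDerivAt 𝓘(ℝ, ℝ) I (fun s => hamFlow σ H t (hamFlow σ H s x)) 0 _ :=
    HasMFDerivAt.comp (0 : ℝ) (mdifferentiableAt_hamFlow (energySurface_hamFlow_subset hx 0)
      t).hasMFDerivAt (isMIntegralCurve_hamFlow (σ := σ) hx 0)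
  have h2 := (isMIntegralCurve_hamFlow (σ := σ) hx).comp_add t 0
  have h3 : (fun s => hamFlow σ H t (hamFlow σ H s x)) = (fun s => hamFlow σ H s x) ∘ (· + t) := by
    ext s
    rw [Function.comp_apply, ← hamFlow_add hx, add_comm]
  have h4 := h1.mfderiv
  rw [h3, h2.mfderiv] at h4
  have h5 := congrArg (fun A : ℝ →L[ℝ] E => A 1) h4
  have h6 : ∀ (y : M), y = x → ∀ z, z = hamFlow σ H t x →
      (1 : ℝ) • (hamVF σ H z : E) = flowD σ H t y ((1 : ℝ) • (hamVF σ H y : E)) →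
      flowD σ H t x (hamVF σ H x) = hamVF σ H (hamFlow σ H t x) := by
    rintro _ rfl _ rfl h
    rw [one_smul, one_smul] at h
    exact h.symm
  exact h6 _ (hamFlow_zero hx) _ (by simp) h5

end Invariance

/-! ### Inner products and the norm transverse to a vector -/

section InnerProducts

variable {E : Type*} [NormedAddCommGroup E] [NormedSpace ℝ E]

/-- The bilinear form `β` is symmetric and positive definite. -/
structure IsInnerForm (β : E →L[ℝ] E →L[ℝ] ℝ) : Prop where
  symm : ∀ v w, β v w = β w v
  pos : ∀ v, v ≠ 0 → 0 < β v v

/-- The component of `v` orthogonal to `X`. -/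
def orthPart (β : E →L[ℝ] E →L[ℝ] ℝ) (X : E) : E →ₗ[ℝ] E :=
  LinearMap.id - ((β.flip X : E →L[ℝ] ℝ) : E →ₗ[ℝ] ℝ).smulRight ((β X X)⁻¹ • X)

theorem orthPart_apply (β : E →L[ℝ] E →L[ℝ] ℝ) (X v : E) :
    orthPart β X v = v - (β v X / β X X) • X := by
  simp [orthPart, smul_smul, div_eq_mul_inv]

namespace IsInnerForm

variable {β : E →L[ℝ] E →L[ℝ] ℝ}

theorem nonneg (h : IsInnerForm β) (v : E) : 0 ≤ β v v := by
  by_cases hv : v = 0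
  · simp [hv]
  · exact (h.pos v hv).le

theorem apply_orthPart (h : IsInnerForm β) {X : E} (hX : X ≠ 0) (v : E) : β (orthPart β X v) X = 0 := by
  have := (h.pos X hX).ne'
  rw [orthPart_apply]
  simp only [map_sub, map_smul, sub_apply, smul_apply, smul_eq_mul]
  field_simp
  ring

theorem apply_self_orthPart (h : IsInnerForm β) {X : E} (hX : X ≠ 0) (v : E) :
    β (orthPart β X v) (orthPart β X v) = β v v - β v X ^ 2 / β X X := by
  have h0 := (h.pos X hX).ne'
  have h1 := h.apply_orthPart hX v
  conv_lhs => rw [orthPart_apply β X v, map_sub (β _), map_smul (β _)]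
  rw [orthPart_apply] at h1
  rw [h1]
  simp only [map_sub, map_smul, sub_apply, smul_apply, smul_eq_mul, h.symm X v]
  field_simp
  ring

theorem apply_sq_le (h : IsInnerForm β) (v w : E) : β v w ^ 2 ≤ β v v * β w w := by
  by_cases hw : w = 0
  · simp [hw]
  · have h1 := h.nonneg (orthPart β w v)
    rw [h.apply_self_orthPart hw, sub_nonneg, div_le_iff₀ (h.pos w hw)] at h1
    exact h1

theorem abs_apply_le (h : IsInnerForm β) (v w : E) : |β v w| ≤ √(β v v) * √(β w w) := by
  rw [← Real.sqrt_mul (h.nonneg v), ← Real.sqrt_sq_eq_abs]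
  exact Real.sqrt_le_sqrt (h.apply_sq_le v w)

/-- The norm of an inner product. -/
def seminorm (h : IsInnerForm β) : Seminorm ℝ E :=
  Seminorm.of (fun v => √(β v v))
    (fun v w => by
      have h1 := (le_abs_self _).trans (h.abs_apply_le v w)
      refine Real.sqrt_le_iff.2 ⟨by positivity, ?_⟩
      have e : β (v + w) (v + w) = β v v + 2 * β v w + β w w := by
        simp only [map_add, add_apply, h.symm w v]
        ring
      rw [e, add_sq, Real.sq_sqrt (h.nonneg v), Real.sq_sqrt (h.nonneg w)]
      linarith)
    (fun a v => by
      have e : β (a • v) (a • v) = a ^ 2 * β v v := by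
        simp only [map_smul, smul_apply, smul_eq_mul]
        ring
      rw [e, Real.sqrt_mul (sq_nonneg a), Real.sqrt_sq_eq_abs, Real.norm_eq_abs])

theorem seminorm_apply (h : IsInnerForm β) (v : E) : h.seminorm v = √(β v v) := rfl

theorem seminorm_sq (h : IsInnerForm β) (v : E) : h.seminorm v ^ 2 = β v v := Real.sq_sqrt (h.nonneg v)

theorem seminorm_pos (h : IsInnerForm β) {v : E} (hv : v ≠ 0) : 0 < h.seminorm v := Real.sqrt_pos.2 (h.pos v hv)

theorem eq_zero_of_seminorm (h : IsInnerForm β) {v : E} (hv : h.seminorm v = 0) : v = 0 := by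
  by_contra hne
  exact (h.seminorm_pos hne).ne' hv

/-- The seminorm of the component orthogonal to `X`. -/
def orthSeminorm (h : IsInnerForm β) (X : E) : Seminorm ℝ E := h.seminorm.comp (orthPart β X)

theorem orthSeminorm_apply (h : IsInnerForm β) (X v : E) : h.orthSeminorm X v = h.seminorm (orthPart β X v) := rfl

theorem orthSeminorm_le (h : IsInnerForm β) {X : E} (hX : X ≠ 0) (v : E) : h.orthSeminorm X v ≤ h.seminorm v := by
  rw [orthSeminorm_apply, seminorm_apply, seminorm_apply]
  refine Real.sqrt_le_sqrt ?_
  rw [h.apply_self_orthPart hX, sub_le_self_iff]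
  exact div_nonneg (sq_nonneg _) (h.nonneg X)

theorem orthPart_add_smul (h : IsInnerForm β) {X : E} (hX : X ≠ 0) (v : E) (s : ℝ) :
    orthPart β X (v + s • X) = orthPart β X v := by
  have h0 := (h.pos X hX).ne'
  have : orthPart β X X = 0 := by
    rw [orthPart_apply, div_self h0, one_smul, sub_self]
  rw [map_add, map_smul, this, smul_zero, add_zero]

theorem orthSeminorm_add_smul (h : IsInnerForm β) {X : E} (hX : X ≠ 0) (v : E) (s : ℝ) :
    h.orthSeminorm X (v + s • X) = h.orthSeminorm X v := by
  rw [orthSeminorm_apply, h.orthPart_add_smul hX, orthSeminorm_apply]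

theorem orthSeminorm_of_orthogonal (h : IsInnerForm β) {X v : E} (hv : β v X = 0) :
    h.orthSeminorm X v = h.seminorm v := by
  rw [orthSeminorm_apply, orthPart_apply, hv, zero_div, zero_smul, sub_zero]

theorem continuous_seminorm (h : IsInnerForm β) : Continuous h.seminorm := by
  change Continuous fun v => √(β v v)
  fun_prop

theorem continuous_orthSeminorm (h : IsInnerForm β) [FiniteDimensional ℝ E] (X : E) : Continuous (h.orthSeminorm X) :=
  h.continuous_seminorm.comp (orthPart β X).continuous_of_finiteDimensional

end IsInnerForm

end InnerProducts

/-! ### The Riemannian metric and continuity on the tangent bundle -/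

section Metric

open Set Filter Metric

variable {E : Type*} [NormedAddCommGroup E] [NormedSpace ℝ E]
  {B : Type*} [TopologicalSpace B] {I : ModelWithCorners ℝ E B}
  {M : Type*} [TopologicalSpace M] [ChartedSpace B M] [FiniteDimensional ℝ E] [IsManifold I ∞ M]

/-- The Riemannian metric at `x`, as a bilinear form on the model space. -/
def gForm (g : Bundle.ContMDiffRiemannianMetric I ∞ E (TangentSpace I : M → Type _)) (x : M) :
    E →L[ℝ] E →L[ℝ] ℝ := g.inner x

omit [FiniteDimensional ℝ E] in
theorem isInnerForm_gForm
    (g : Bundle.ContMDiffRiemannianMetric I ∞ E (TangentSpace I : M → Type _)) (x : M) :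
    IsInnerForm (gForm g x) := ⟨g.symm x, g.pos x⟩

/-- The Riemannian norm on the tangent space at `x`. -/
def gSeminorm (g : Bundle.ContMDiffRiemannianMetric I ∞ E (TangentSpace I : M → Type _)) (x : M) :
    Seminorm ℝ E := (isInnerForm_gForm g x).seminorm

/-- The norm of the component orthogonal to the Hamiltonian vector field. -/
def transSeminorm (σ : SymplecticForm I M)
    (g : Bundle.ContMDiffRiemannianMetric I ∞ E (TangentSpace I : M → Type _))
    (H : Hamiltonian I M) (x : M) : Seminorm ℝ E :=
  (isInnerForm_gForm g x).orthSeminorm (hamVF σ H x)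

/-- The endomorphism `J` with `g(J v, w) = σ(v, w)`. -/
def compatMap (σ : SymplecticForm I M)
    (g : Bundle.ContMDiffRiemannianMetric I ∞ E (TangentSpace I : M → Type _)) (x : M) :
    E →L[ℝ] E :=
  let ς : E →L[ℝ] E →L[ℝ] ℝ := σ.form x
  (gForm g x).inverse.comp ς

variable {σ : SymplecticForm I M}
  {g : Bundle.ContMDiffRiemannianMetric I ∞ E (TangentSpace I : M → Type _)}

omit [FiniteDimensional ℝ E] in
theorem gForm_nondeg (g : Bundle.ContMDiffRiemannianMetric I ∞ E (TangentSpace I : M → Type _))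
    (x : M) (v : E) (hv : ∀ w, gForm g x v w = 0) : v = 0 := by
  by_contra hne
  exact ((isInnerForm_gForm g x).pos v hne).ne' (hv v)

theorem gForm_compatMap (x : M) (v w : E) :
    gForm g x (compatMap σ g x v) w = σ.form x v w := by
  obtain ⟨e, he⟩ := isInvertible_of_nondegenerate (gForm_nondeg g x)
  let ς : E →L[ℝ] E →L[ℝ] ℝ := σ.form x
  have : gForm g x ((gForm g x).inverse (ς v)) = ς v := by
    rw [← he, ContinuousLinearMap.inverse_equiv]
    exact e.apply_symm_apply _
  exact congrArg (fun A : E →L[ℝ] ℝ => A w) this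

/-! #### Continuity in coordinates -/

omit [FiniteDimensional ℝ E] in
/-- The coordinates of a tangent vector depend continuously on it. -/
theorem tendsto_coords (H : Hamiltonian I M) {x₀ x : M} (hx : x ∈ chartDomain I x₀)
    (v : TangentSpace I x) :
    Tendsto (fun q : Hamiltonian I M × TangentBundle I M =>
      (q.1, extChartAt I x₀ q.2.1, toCoord I x₀ q.2.1 q.2.2)) (𝓝 (H, ⟨x, v⟩))
      (𝓝 (H, extChartAt I x₀ x, toCoord I x₀ x v)) := by
  have hsnd : Tendsto (fun q : Hamiltonian I M × TangentBundle I M => q.2) (𝓝 (H, ⟨x, v⟩))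
      (𝓝 ⟨x, v⟩) := continuousAt_snd
  rw [tendsto_tangentBundle_iff (x₀ := x₀) (by exact hx)] at hsnd
  exact Tendsto.prodMk_nhds continuousAt_fst
    (((continuousAt_chart hx).tendsto.comp hsnd.1).prodMk_nhds hsnd.2)

omit [FiniteDimensional ℝ E] in
theorem eventually_mem_chartDomain (H : Hamiltonian I M) {x₀ x : M} (hx : x ∈ chartDomain I x₀)
    (v : TangentSpace I x) : ∀ᶠ q : Hamiltonian I M × TangentBundle I M in 𝓝 (H, ⟨x, v⟩),
      q.2.1 ∈ chartDomain I x₀ :=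
  (((FiberBundle.continuous_proj E (TangentSpace I : M → Type _)).tendsto _).comp
    continuousAt_snd).eventually ((isOpen_chartDomain x₀).mem_nhds hx)

omit [FiniteDimensional ℝ E] in
/-- A function on the tangent bundle is continuous if its coordinate expression is. -/
theorem continuousAt_of_coords {H : Hamiltonian I M} {x₀ x : M} (hx : x ∈ chartDomain I x₀)
    {v : TangentSpace I x} {f : Hamiltonian I M × TangentBundle I M → ℝ}
    {F : Hamiltonian I M × E × E → ℝ}
    (hF : ContinuousAt F (H, extChartAt I x₀ x, toCoord I x₀ x v))
    (hf : ∀ q : Hamiltonian I M × TangentBundle I M, q.2.1 ∈ chartDomain I x₀ →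
      f q = F (q.1, extChartAt I x₀ q.2.1, toCoord I x₀ q.2.1 q.2.2)) :
    ContinuousAt f (H, ⟨x, v⟩) := by
  have h1 := hF.tendsto.comp (tendsto_coords H hx v)
  rw [ContinuousAt, hf _ (by exact hx)]
  refine h1.congr' ?_
  filter_upwards [eventually_mem_chartDomain H hx v] with q hq using (hf q hq).symm

theorem continuousAt_coordBilin {b : ∀ x : M, TangentSpace I x →L[ℝ] TangentSpace I x →L[ℝ] ℝ}
    (hb : ContMDiff I (I.prod 𝓘(ℝ, E →L[ℝ] E →L[ℝ] ℝ)) ∞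
      (fun x ↦ Bundle.TotalSpace.mk' (E →L[ℝ] E →L[ℝ] ℝ)
      (E := fun x : M ↦ TangentSpace I x →L[ℝ] TangentSpace I x →L[ℝ] ℝ) x (b x)))
    {x₀ : M} {y : E} (hy : y ∈ chartInterior I x₀) : ContinuousAt (coordBilin b x₀) y :=
  ((contDiffOn_coordBilin b hb x₀).contDiffAt ((isOpen_chartInterior x₀).mem_nhds hy)).continuousAt

theorem continuousAt_bilin_apply {F X : Type*} [NormedAddCommGroup F] [NormedSpace ℝ F]
    [TopologicalSpace X] {β : X → F →L[ℝ] F →L[ℝ] ℝ} {a b : X → F} {x : X}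
    (hβ : ContinuousAt β x) (ha : ContinuousAt a x) (hb : ContinuousAt b x) :
    ContinuousAt (fun z => β z (a z) (b z)) x :=
  (hβ.clm_apply ha).clm_apply hb

theorem continuousAt_gForm_self (H : Hamiltonian I M) {x : M} (hx : x ∈ I.interior M)
    (v : TangentSpace I x) :
    ContinuousAt (fun q : Hamiltonian I M × TangentBundle I M => gForm g q.2.1 q.2.2 q.2.2)
      (H, ⟨x, v⟩) := by
  have hd := self_mem_chartDomain hx
  refine continuousAt_of_coords hd (F := fun r => coordBilin g.inner x r.2.1 r.2.2 r.2.2)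
    (continuousAt_bilin_apply ?_ (by fun_prop) (by fun_prop)) fun q hq => ?_
  · exact (continuousAt_coordBilin g.contMDiff hd.2).comp_of_eq
      (f := fun r : Hamiltonian I M × E × E => r.2.1) (by fun_prop) rfl
  · exact (coordBilin_toCoord g.inner hq _ _).symm

theorem continuousAt_coordVF' (σ : SymplecticForm I M) (H : Hamiltonian I M) {x₀ : M} {y : E}
    (hy : y ∈ chartInterior I x₀) (u : E) :
    ContinuousAt (fun r : Hamiltonian I M × E × E => coordVF σ r.1 x₀ r.2.1) (H, y, u) :=
  (continuousAt_coordVF σ H hy).comp_of_eq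
    (f := fun r : Hamiltonian I M × E × E => (r.1, r.2.1)) (by fun_prop) rfl

theorem continuousAt_gForm_hamVF (H : Hamiltonian I M) {x : M} (hx : x ∈ I.interior M)
    (v : TangentSpace I x) :
    ContinuousAt (fun q : Hamiltonian I M × TangentBundle I M =>
      gForm g q.2.1 q.2.2 (hamVF σ q.1 q.2.1)) (H, ⟨x, v⟩) := by
  have hd := self_mem_chartDomain hx
  refine continuousAt_of_coords hd
    (F := fun r => coordBilin g.inner x r.2.1 r.2.2 (coordVF σ r.1 x r.2.1))
    (continuousAt_bilin_apply ?_ (by fun_prop) (continuousAt_coordVF' σ H hd.2 _)) fun q hq => ?_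
  · exact (continuousAt_coordBilin g.contMDiff hd.2).comp_of_eq
      (f := fun r : Hamiltonian I M × E × E => r.2.1) (by fun_prop) rfl
  · rw [← toCoord_hamVF σ q.1 hq]
    exact (coordBilin_toCoord g.inner hq _ _).symm

theorem continuousAt_gForm_hamVF_self (H : Hamiltonian I M) {x : M} (hx : x ∈ I.interior M)
    (v : TangentSpace I x) :
    ContinuousAt (fun q : Hamiltonian I M × TangentBundle I M =>
      gForm g q.2.1 (hamVF σ q.1 q.2.1) (hamVF σ q.1 q.2.1)) (H, ⟨x, v⟩) := by
  have hd := self_mem_chartDomain hx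
  refine continuousAt_of_coords hd
    (F := fun r => coordBilin g.inner x r.2.1 (coordVF σ r.1 x r.2.1) (coordVF σ r.1 x r.2.1))
    (continuousAt_bilin_apply ?_ (continuousAt_coordVF' σ H hd.2 _)
      (continuousAt_coordVF' σ H hd.2 _)) fun q hq => ?_
  · exact (continuousAt_coordBilin g.contMDiff hd.2).comp_of_eq
      (f := fun r : Hamiltonian I M × E × E => r.2.1) (by fun_prop) rfl
  · rw [← toCoord_hamVF σ q.1 hq]
    exact (coordBilin_toCoord g.inner hq _ _).symm

theorem continuousAt_dHam (H : Hamiltonian I M) {x : M} (hx : x ∈ I.interior M)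
    (v : TangentSpace I x) :
    ContinuousAt (fun q : Hamiltonian I M × TangentBundle I M => dHam q.1 q.2.1 q.2.2)
      (H, ⟨x, v⟩) := by
  have hd := self_mem_chartDomain hx
  refine continuousAt_of_coords hd (F := fun r => fderiv ℝ (coordHam r.1 x) r.2.1 r.2.2)
    (ContinuousAt.clm_apply ?_ (by fun_prop)) fun q hq => (dHam_toCoord q.1 hq _).symm
  exact (continuousAt_fderiv_coordHam H hd.2).comp_of_eq
    (f := fun r : Hamiltonian I M × E × E => (r.1, r.2.1)) (by fun_prop) rfl

theorem hamVF_ne_zero {H : Hamiltonian I M} {x : M} (h : dHam H x ≠ 0) : hamVF σ H x ≠ 0 := by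
  intro h0
  refine h (ContinuousLinearMap.ext fun u => ?_)
  rw [← form_hamVF σ, h0, map_zero]

theorem transSeminorm_eq {H : Hamiltonian I M} {x : M} (h : (hamVF σ H x : E) ≠ 0) (v : E) :
    transSeminorm σ g H x v = √(gForm g x v v
      - gForm g x v (hamVF σ H x) ^ 2 / gForm g x (hamVF σ H x) (hamVF σ H x)) := by
  rw [← (isInnerForm_gForm g x).apply_self_orthPart h]
  rfl

/-- The transverse norm depends continuously on the Hamiltonian and the tangent vector. -/
theorem continuousAt_transSeminorm {H : Hamiltonian I M} {x : M} (hx : x ∈ I.interior M)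
    (h : dHam H x ≠ 0) (v : TangentSpace I x) :
    ContinuousAt (fun q : Hamiltonian I M × TangentBundle I M =>
      transSeminorm σ g q.1 q.2.1 q.2.2) (H, ⟨x, v⟩) := by
  have hX : gForm g x (hamVF σ H x) (hamVF σ H x) ≠ 0 :=
    ((isInnerForm_gForm g x).pos _ (hamVF_ne_zero h)).ne'
  have c3 := continuousAt_gForm_hamVF_self (σ := σ) (g := g) H hx v
  have h1 := ((continuousAt_gForm_self (g := g) H hx v).sub
    (((continuousAt_gForm_hamVF (σ := σ) (g := g) H hx v).pow 2).div c3 hX)).sqrt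
  refine h1.congr ?_
  filter_upwards [c3.eventually_ne hX] with q hq
  have h0 : ∀ X : E, X = 0 → gForm g q.2.1 X X = 0 := by
    rintro _ rfl
    rw [map_zero]
  exact (transSeminorm_eq (fun hq' => hq (h0 _ hq')) _).symm

theorem continuousAt_gSeminorm (H : Hamiltonian I M) {x : M} (hx : x ∈ I.interior M)
    (v : TangentSpace I x) :
    ContinuousAt (fun q : Hamiltonian I M × TangentBundle I M => gSeminorm g q.2.1 q.2.2)
      (H, ⟨x, v⟩) :=
  (continuousAt_gForm_self (g := g) H hx v).sqrt

theorem toCoord_compatMap {x₀ x : M} (hx : x ∈ chartDomain I x₀) (v : E) :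
    toCoord I x₀ x (compatMap σ g x v) = (coordBilin g.inner x₀ (extChartAt I x₀ x)).inverse
      (coordBilin σ.form x₀ (extChartAt I x₀ x) (toCoord I x₀ x v)) := by
  have key : coordBilin g.inner x₀ (extChartAt I x₀ x) (toCoord I x₀ x (compatMap σ g x v))
      = coordBilin σ.form x₀ (extChartAt I x₀ x) (toCoord I x₀ x v) := by
    ext u
    rw [← toCoord_ofCoord' hx u]
    have h1 := coordBilin_toCoord g.inner hx (compatMap σ g x v)
      (ofCoord I x₀ (extChartAt I x₀ x) u)
    have h2 := coordBilin_toCoord σ.form hx v (ofCoord I x₀ (extChartAt I x₀ x) u)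
    rw [h1, h2]
    exact gForm_compatMap x v _
  obtain ⟨e, he⟩ := isInvertible_coordBilin (gForm_nondeg g) (x₀ := x₀) hx.2
  have he' : coordBilin g.inner x₀ (extChartAt I x₀ x) = e := he.symm
  rw [← key, he', ContinuousLinearMap.inverse_equiv]
  exact (e.symm_apply_apply _).symm

theorem continuousAt_gForm_compatMap (H : Hamiltonian I M) {x : M} (hx : x ∈ I.interior M)
    (v : TangentSpace I x) :
    ContinuousAt (fun q : Hamiltonian I M × TangentBundle I M =>
      gForm g q.2.1 (compatMap σ g q.2.1 q.2.2) (compatMap σ g q.2.1 q.2.2)) (H, ⟨x, v⟩) := by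
  have hd := self_mem_chartDomain hx
  have hy : ContinuousAt (fun r : Hamiltonian I M × E × E => r.2.1)
    (H, extChartAt I x x, toCoord I x x v) := by fun_prop
  have hu : ContinuousAt (fun r : Hamiltonian I M × E × E => r.2.2)
    (H, extChartAt I x x, toCoord I x x v) := by fun_prop
  have hinv : ContinuousAt (fun y => (coordBilin g.inner x y).inverse) (extChartAt I x x) :=
    ((contDiffOn_inverse_coordBilin g.contMDiff (gForm_nondeg g) x).contDiffAt
      ((isOpen_chartInterior x).mem_nhds hd.2)).continuousAt
  have h1 := (continuousAt_coordBilin σ.contMDiff hd.2).comp_of_eq hy rfl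
  have h2 := (continuousAt_coordBilin g.contMDiff hd.2).comp_of_eq hy rfl
  have h3 := hinv.comp_of_eq hy rfl
  have h4 : ContinuousAt (fun r : Hamiltonian I M × E × E =>
      (coordBilin g.inner x r.2.1).inverse (coordBilin σ.form x r.2.1 r.2.2))
      (H, extChartAt I x x, toCoord I x x v) := h3.clm_apply (h1.clm_apply hu)
  refine continuousAt_of_coords hd
    (F := fun r => coordBilin g.inner x r.2.1 ((coordBilin g.inner x r.2.1).inverse
      (coordBilin σ.form x r.2.1 r.2.2)) ((coordBilin g.inner x r.2.1).inverse
      (coordBilin σ.form x r.2.1 r.2.2))) (continuousAt_bilin_apply h2 h4 h4) fun q hq => ?_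
  have h5 := coordBilin_toCoord g.inner hq (compatMap σ g q.2.1 q.2.2) (compatMap σ g q.2.1 q.2.2)
  rw [toCoord_compatMap hq q.2.2] at h5
  exact h5.symm

end Metric

/-! ### Uniform bounds on compact sets -/

section Bounds

open Set Filter Metric

variable {E : Type*} [NormedAddCommGroup E] [NormedSpace ℝ E]
  {B : Type*} [TopologicalSpace B] {I : ModelWithCorners ℝ E B}
  {M : Type*} [TopologicalSpace M] [ChartedSpace B M] [FiniteDimensional ℝ E] [IsManifold I ∞ M]

omit [FiniteDimensional ℝ E] in
/-- The tangent vector with given base point and coordinates depends continuously on both. -/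
theorem continuousAt_ofCoord {x₀ x : M} (hx : x ∈ chartDomain I x₀) (u : E) :
    ContinuousAt (fun r : M × E =>
      (⟨r.1, ofCoord I x₀ (extChartAt I x₀ r.1) r.2⟩ : TangentBundle I M)) (x, u) := by
  have hfst : Tendsto (fun r : M × E => r.1) (𝓝 (x, u)) (𝓝 x) := continuousAt_fst
  rw [ContinuousAt, tendsto_tangentBundle_iff (x₀ := x₀) (by exact hx)]
  refine ⟨hfst, ?_⟩
  rw [toCoord_ofCoord' hx]
  have hsnd : Tendsto (fun r : M × E => r.2) (𝓝 (x, u)) (𝓝 u) := continuousAt_snd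
  refine hsnd.congr' ?_
  filter_upwards [hfst.eventually ((isOpen_chartDomain x₀).mem_nhds hx)] with r hr
  exact (toCoord_ofCoord' hr _).symm

omit [FiniteDimensional ℝ E] in
/-- A nonzero tangent vector is a multiple of one whose coordinates have norm one. -/
theorem exists_smul_ofCoord {x₀ x : M} (hx : x ∈ chartDomain I x₀) {v : E} (hv : v ≠ 0) :
    ∃ s : ℝ, 0 < s ∧ ∃ u ∈ sphere (0 : E) 1, v = s • ofCoord I x₀ (extChartAt I x₀ x) u := by
  have hne : toCoord I x₀ x v ≠ 0 := fun h => hv (by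
    rw [← ofCoord_toCoord hx v, h, map_zero])
  have hpos : 0 < ‖toCoord I x₀ x v‖ := norm_pos_iff.2 hne
  refine ⟨‖toCoord I x₀ x v‖, hpos, ‖toCoord I x₀ x v‖⁻¹ • toCoord I x₀ x v, ?_, ?_⟩
  · rw [mem_sphere_zero_iff_norm, norm_smul, norm_inv, norm_norm, inv_mul_cancel₀ hpos.ne']
  · rw [map_smul, smul_smul, mul_inv_cancel₀ hpos.ne', one_smul, ofCoord_toCoord hx]

variable [CompactSpace M] [T2Space M]

/-- Continuous families of norms on a compact set are uniformly comparable. -/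
theorem exists_bound_seminorm {K : Set M} (hK : IsCompact K) (hKI : K ⊆ I.interior M)
    {a b : M → Seminorm ℝ E}
    (ha : ∀ x ∈ K, ∀ v : TangentSpace I x,
      ContinuousAt (fun z : TangentBundle I M => a z.1 z.2) ⟨x, v⟩)
    (hb : ∀ x ∈ K, ∀ v : TangentSpace I x,
      ContinuousAt (fun z : TangentBundle I M => b z.1 z.2) ⟨x, v⟩)
    (hpos : ∀ x ∈ K, ∀ v, v ≠ 0 → 0 < b x v) : ∃ C > 0, ∀ x ∈ K, ∀ v, a x v ≤ C * b x v := by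
  suffices h : ∃ ε > 0, ∀ x ∈ K, x ∈ K → ∀ v, ε * a x v ≤ b x v by
    obtain ⟨ε, hε, h⟩ := h
    refine ⟨ε⁻¹, inv_pos.2 hε, fun x hx v => ?_⟩
    rw [← div_eq_inv_mul, le_div_iff₀ hε, mul_comm]
    exact h x hx hx v
  refine exists_uniform_time hK (P := fun ε x => x ∈ K → ∀ v, ε * a x v ≤ b x v)
    (fun ε ε' x hle h hx v => (mul_le_mul_of_nonneg_right hle (apply_nonneg _ _)).trans (h hx v))
    fun x₀ hx₀ => ?_
  obtain ⟨K₁, hK₁, hK₁d, hK₁c⟩ := local_compact_nhds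
    ((isOpen_chartDomain x₀).mem_nhds (self_mem_chartDomain (hKI hx₀)))
  obtain ⟨ε, hε, h⟩ := exists_uniform_time ((hK.inter hK₁c).prod (isCompact_sphere (0 : E) 1))
    (P := fun ε r => ε * a r.1 (ofCoord I x₀ (extChartAt I x₀ r.1) r.2)
      ≤ b r.1 (ofCoord I x₀ (extChartAt I x₀ r.1) r.2))
    (fun ε ε' r hle h => (mul_le_mul_of_nonneg_right hle (apply_nonneg _ _)).trans h) (by
      rintro ⟨x, u⟩ ⟨⟨hxK, hxK₁⟩, hu⟩
      have hxd := hK₁d hxK₁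
      set w := ofCoord I x₀ (extChartAt I x₀ x) u with hw
      have hw0 : w ≠ 0 := fun h0 => by
        have : u = 0 := by rw [← toCoord_ofCoord' hxd u, ← hw, h0, map_zero]
        rw [this] at hu
        simp at hu
      have hbw := hpos x hxK w hw0
      have haw : 0 ≤ a x w := apply_nonneg _ _
      have c1 : ContinuousAt (fun r : M × E => a r.1 (ofCoord I x₀ (extChartAt I x₀ r.1) r.2))
          (x, u) := (ha x hxK w).comp_of_eq (continuousAt_ofCoord hxd u) rfl
      have c2 : ContinuousAt (fun r : M × E => b r.1 (ofCoord I x₀ (extChartAt I x₀ r.1) r.2))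
          (x, u) := (hb x hxK w).comp_of_eq (continuousAt_ofCoord hxd u) rfl
      refine ⟨b x w / (a x w + 1), by positivity, ?_⟩
      refine ((continuousAt_const.mul c1).eventually_lt c2 ?_).mono fun r hr => hr.le
      change b x w / (a x w + 1) * a x w < b x w
      rw [div_mul_eq_mul_div, div_lt_iff₀ (by positivity)]
      nlinarith)
  refine ⟨ε, hε, ?_⟩
  filter_upwards [hK₁] with x hx hxK v
  by_cases hv : v = 0
  · simp [hv]
  · obtain ⟨s, hs, u, hu, rfl⟩ := exists_smul_ofCoord (hK₁d hx) hv
    have := h (x, u) ⟨⟨hxK, hx⟩, hu⟩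
    rw [map_smul_eq_mul, map_smul_eq_mul, Real.norm_of_nonneg hs.le, mul_left_comm]
    exact mul_le_mul_of_nonneg_left this hs.le

variable {σ : SymplecticForm I M}
  {g : Bundle.ContMDiffRiemannianMetric I ∞ E (TangentSpace I : M → Type _)}
  {H : Hamiltonian I M} {x₀ : M}

theorem continuousAt_comp_prodMk {X Y Z : Type*} [TopologicalSpace X] [TopologicalSpace Y]
    [TopologicalSpace Z] {f : X × Y → Z} {x : X} {y : Y} (h : ContinuousAt f (x, y)) :
    ContinuousAt (fun y => f (x, y)) y :=
  h.comp_of_eq (f := fun y => (x, y)) (by fun_prop) rfl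

theorem exists_bound_gSeminorm {K : Set M} (hK : IsCompact K) (hKI : K ⊆ I.interior M)
    {a : M → Seminorm ℝ E}
    (ha : ∀ x ∈ K, ∀ v : TangentSpace I x,
      ContinuousAt (fun z : TangentBundle I M => a z.1 z.2) ⟨x, v⟩) (H : Hamiltonian I M) :
    ∃ C > 0, ∀ x ∈ K, ∀ v, a x v ≤ C * gSeminorm g x v :=
  exists_bound_seminorm hK hKI ha
    (fun _ hx v => continuousAt_comp_prodMk (continuousAt_gSeminorm H (hKI hx) v))
    fun _ _ _ hv => (isInnerForm_gForm g _).seminorm_pos hv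

/-- The compatible endomorphism distorts the norm by bounded factors. -/
theorem exists_bounds_compatMap {K : Set M} (hK : IsCompact K) (hKI : K ⊆ I.interior M)
    (σ : SymplecticForm I M)
    (g : Bundle.ContMDiffRiemannianMetric I ∞ E (TangentSpace I : M → Type _))
    (H : Hamiltonian I M) :
    ∃ c > 0, ∃ C > 0, ∀ x ∈ K, ∀ v, c * gSeminorm g x v ≤ gSeminorm g x (compatMap σ g x v) ∧
      gSeminorm g x (compatMap σ g x v) ≤ C * gSeminorm g x v := by
  have hJ : ∀ x ∈ K, ∀ v : TangentSpace I x, ContinuousAt (fun z : TangentBundle I M =>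
      (gSeminorm g z.1).comp (compatMap σ g z.1 : E →ₗ[ℝ] E) z.2) ⟨x, v⟩ := fun x hx v =>
    continuousAt_comp_prodMk (continuousAt_gForm_compatMap (σ := σ) (g := g) H (hKI hx) v).sqrt
  obtain ⟨C, hC, h1⟩ := exists_bound_gSeminorm (g := g)
    (a := fun x => (gSeminorm g x).comp (compatMap σ g x : E →ₗ[ℝ] E)) hK hKI hJ H
  obtain ⟨c, hc, h2⟩ := exists_bound_seminorm (a := gSeminorm g)
    (b := fun x => (gSeminorm g x).comp (compatMap σ g x : E →ₗ[ℝ] E)) hK hKI (fun x hx v =>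
    continuousAt_comp_prodMk (continuousAt_gSeminorm (g := g) H (hKI hx) v)) hJ (by
      intro x _ v hv
      refine (isInnerForm_gForm g x).seminorm_pos fun h0 => hv (σ.nondeg x v fun w => ?_)
      have h3 := gForm_compatMap (σ := σ) (g := g) x v w
      have h4 : compatMap σ g x v = 0 := h0
      rw [h4, map_zero] at h3
      exact h3.symm)
  refine ⟨c⁻¹, inv_pos.2 hc, C, hC, fun x hx v => ⟨?_, h1 x hx v⟩⟩
  rw [← div_eq_inv_mul, div_le_iff₀ hc, mul_comm]
  exact h2 x hx v

/-- The differential of `H`, as a linear form on the model space. -/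
def dHamLin (H : Hamiltonian I M) (x : M) : E →ₗ[ℝ] ℝ :=
  (dHam H x : TangentSpace I x →ₗ[ℝ] ℝ)

/-- The tangent flow on an energy surface in the interior of `M`, free of critical points, is an
energy cocycle. -/
theorem isEnergyCocycle (hx₀ : energySurface H x₀ ⊆ I.interior M)
    (hne : ∀ x ∈ energySurface H x₀, dHam H x ≠ 0) :
    IsEnergyCocycle (energySurface H x₀) (hamFlow σ H) (flowD σ H) (fun x => hamVF σ H x)
      (dHamLin H) (gSeminorm g) (transSeminorm σ g H) := by
  have hgood : ∀ y ∈ energySurface H x₀, energySurface H y ⊆ I.interior M := fun y hy => by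
    rwa [energySurface_eq hy]
  have hX : ∀ x ∈ energySurface H x₀, (hamVF σ H x : E) ≠ 0 := fun x hx => hamVF_ne_zero (hne x hx)
  have hcpt := isCompact_energySurface H x₀
  constructor
  case mem =>
    intro t x hx
    rw [← energySurface_eq hx]
    exact hamFlow_mem_energySurface (hgood x hx) t
  case map_zero => exact fun x hx => hamFlow_zero (hgood x hx)
  case map_add => exact fun s t x hx => hamFlow_add (hgood x hx) s t
  case D_zero => exact fun x hx v => by rw [flowD_zero (hgood x hx)]; rfl
  case D_add => exact fun s t x hx v => flowD_add (hgood x hx) s t v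
  case D_X => exact fun t x hx => flowD_hamVF (hgood x hx) t
  case ℓ_D => exact fun t x hx v => dHam_flowD (hgood x hx) t v
  case ℓ_X => exact fun x hx => dHam_hamVF σ H x
  case N_eq_zero => exact fun x hx v hv => (isInnerForm_gForm g x).eq_zero_of_seminorm hv
  case p_le => exact fun x hx v => (isInnerForm_gForm g x).orthSeminorm_le (hX x hx) v
  case p_add_smul => exact fun x hx v s =>
    (isInnerForm_gForm g x).orthSeminorm_add_smul (hX x hx) v s
  case exists_sub_smul => exact fun x hx v =>
    ⟨_, congrArg (gSeminorm g x) (orthPart_apply (gForm g x) (hamVF σ H x) v).symm⟩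
  case D_bound =>
    intro t
    refine exists_bound_gSeminorm (a := fun x => (gSeminorm g (hamFlow σ H t x)).comp
      (flowD σ H t x : E →ₗ[ℝ] E)) hcpt hx₀ (fun x hx v => ?_) H
    have h1 : ContinuousAt (fun q : Hamiltonian I M × TangentBundle I M => (q.1, flowMap σ t q))
      (H, ⟨x, v⟩) := continuousAt_fst.prodMk (continuousAt_flowMap (hgood x hx) t v)
    have hy := hgood x hx (hamFlow_mem_energySurface (σ := σ) (hgood x hx) t)
    exact continuousAt_comp_prodMk ((continuousAt_gSeminorm (g := g) H hy
      (tangentFlow σ H t x v)).comp_of_eq h1 rfl)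
  case X_bound =>
    have hc : ContinuousOn (fun x => gSeminorm g x (hamVF σ H x)) (energySurface H x₀) := by
      intro x hx
      refine ContinuousAt.continuousWithinAt ?_
      have h1 := continuousAt_comp_prodMk (continuousAt_gForm_hamVF_self (σ := σ) (g := g) H
        (hx₀ hx) 0).sqrt
      exact h1.comp_of_eq (f := fun y : M => (⟨y, 0⟩ : TangentBundle I M))
        ((Bundle.contMDiff_zeroSection (n := 0) (IB := I) ℝ
          (TangentSpace I : M → Type _)).continuous.continuousAt) rfl
    obtain ⟨b, hb⟩ := hcpt.exists_bound_of_continuousOn hc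
    obtain ⟨y, hy, hmin⟩ := hcpt.exists_isMinOn ⟨x₀, mem_energySurface_self H x₀⟩ hc
    refine ⟨_, (isInnerForm_gForm g y).seminorm_pos (hX y hy), |b| + 1, by positivity,
      fun x hx => ⟨hmin hx, ?_⟩⟩
    have := hb x hx
    linarith [le_abs_self b, Real.le_norm_self (gSeminorm g x (hamVF σ H x))]

end Bounds

/-! ### Openness of transverse expansion -/

section Openness

open Set Filter Metric

variable {E : Type*} [NormedAddCommGroup E] [NormedSpace ℝ E]
  {B : Type*} [TopologicalSpace B] {I : ModelWithCorners ℝ E B}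
  {M : Type*} [TopologicalSpace M] [ChartedSpace B M] [FiniteDimensional ℝ E] [IsManifold I ∞ M]

/-- Every vector tangent to the energy level at `x` is expanded, transversally to the vector field,
by the factor `k` at time `T` or at time `-T`. -/
def ExpandsTransversally (σ : SymplecticForm I M)
    (g : Bundle.ContMDiffRiemannianMetric I ∞ E (TangentSpace I : M → Type _))
    (H : Hamiltonian I M) (T k : ℝ) (x : M) : Prop :=
  ∀ w : E, dHamLin H x w = 0 → k * transSeminorm σ g H x w
    ≤ max (transSeminorm σ g H (hamFlow σ H T x) (flowD σ H T x w))
      (transSeminorm σ g H (hamFlow σ H (-T) x) (flowD σ H (-T) x w))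

variable [CompactSpace M] [T2Space M] {σ : SymplecticForm I M}
  {g : Bundle.ContMDiffRiemannianMetric I ∞ E (TangentSpace I : M → Type _)}
  {H : Hamiltonian I M} {x : M}

theorem dHam_hamFlow_ne_zero (hx : energySurface H x ⊆ I.interior M) (h : dHam H x ≠ 0) (t : ℝ) :
    dHam H (hamFlow σ H t x) ≠ 0 := by
  intro h0
  refine h (ContinuousLinearMap.ext fun v => ?_)
  rw [← dHam_flowD (σ := σ) hx t v, h0]
  rfl

theorem transSeminorm_flowD_add_smul (hx : energySurface H x ⊆ I.interior M) (h : dHam H x ≠ 0)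
    {X : E} (hX : X = hamVF σ H x) (t : ℝ) (v : E) (s : ℝ) :
    transSeminorm σ g H (hamFlow σ H t x) (flowD σ H t x (v + s • X))
      = transSeminorm σ g H (hamFlow σ H t x) (flowD σ H t x v) := by
  rw [map_add, map_smul, hX, flowD_hamVF hx]
  exact (isInnerForm_gForm g _).orthSeminorm_add_smul
    (hamVF_ne_zero (dHam_hamFlow_ne_zero hx h t)) _ _

theorem continuousAt_transSeminorm_flowMap (hx : energySurface H x ⊆ I.interior M)
    (h : dHam H x ≠ 0) (t : ℝ) (v : TangentSpace I x) :
    ContinuousAt (fun q : Hamiltonian I M × TangentBundle I M => transSeminorm σ g q.1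
      (flowMap σ t q).1 (flowMap σ t q).2) (H, ⟨x, v⟩) := by
  have h1 : ContinuousAt (fun q : Hamiltonian I M × TangentBundle I M => (q.1, flowMap σ t q))
    (H, ⟨x, v⟩) := continuousAt_fst.prodMk (continuousAt_flowMap hx t v)
  have h2 := continuousAt_transSeminorm (σ := σ) (g := g)
    (hx (hamFlow_mem_energySurface (σ := σ) hx t)) (dHam_hamFlow_ne_zero hx h t)
    (tangentFlow σ H t x v)
  exact ContinuousAt.comp (f := fun q : Hamiltonian I M × TangentBundle I M => (q.1, flowMap σ t q))
    (x := (H, ⟨x, v⟩)) h2 h1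

omit [CompactSpace M] [T2Space M] [FiniteDimensional ℝ E] in
theorem continuousAt_ofCoord_prod {x₀ : M} (hx : x ∈ chartDomain I x₀) (u : E) :
    ContinuousAt (fun r : (Hamiltonian I M × M) × E =>
      ((r.1.1, ⟨r.1.2, ofCoord I x₀ (extChartAt I x₀ r.1.2) r.2⟩) :
        Hamiltonian I M × TangentBundle I M)) ((H, x), u) := by
  refine ContinuousAt.prodMk (by fun_prop) ?_
  exact (continuousAt_ofCoord hx u).comp_of_eq
    (f := fun r : (Hamiltonian I M × M) × E => (r.1.2, r.2)) (by fun_prop) rfl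

omit [CompactSpace M] [T2Space M] in
/-- Being a regular point is an open condition. -/
theorem eventually_dHam_ne_zero (hx : x ∈ I.interior M) (h : dHam H x ≠ 0) :
    ∀ᶠ p : Hamiltonian I M × M in 𝓝 (H, x), dHam p.1 p.2 ≠ 0 := by
  have hd := self_mem_chartDomain hx
  have h1 : ContinuousAt (fun p : Hamiltonian I M × M =>
      fderiv ℝ (coordHam p.1 x) (extChartAt I x p.2)) (H, x) :=
    (continuousAt_fderiv_coordHam H hd.2).comp_of_eq
      (f := fun p : Hamiltonian I M × M => (p.1, extChartAt I x p.2))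
      (continuousAt_fst.prodMk ((continuousAt_chart hd).comp continuousAt_snd)) rfl
  have hdom : ∀ᶠ p : Hamiltonian I M × M in 𝓝 (H, x), p.2 ∈ chartDomain I x :=
    continuousAt_snd ((isOpen_chartDomain x).mem_nhds hd)
  have h2 : fderiv ℝ (coordHam H x) (extChartAt I x x) ≠ 0 := fun h0 =>
    h (ContinuousLinearMap.ext fun v => by rw [← dHam_toCoord H hd v, h0]; rfl)
  filter_upwards [h1.eventually_ne h2, hdom] with p hp hpd h0
  refine hp (ContinuousLinearMap.ext fun u => ?_)
  rw [← toCoord_ofCoord' hpd u, dHam_toCoord p.1 hpd, h0]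
  rfl

/-- Transverse expansion by the factor `2` holds near every point where there is transverse
expansion by the factor `3`, also for nearby Hamiltonians. -/
theorem eventually_expandsTransversally (hx : energySurface H x ⊆ I.interior M) (h : dHam H x ≠ 0)
    {T : ℝ} (hT : ExpandsTransversally σ g H T 3 x) :
    ∀ᶠ p : Hamiltonian I M × M in 𝓝 (H, x), ExpandsTransversally σ g p.1 T 2 p.2 := by
  have hxI := hx (mem_energySurface_self H x)
  have hd := self_mem_chartDomain hxI
  -- it suffices to consider vectors orthogonal to the vector field, with coordinates of norm one
  have key : ∀ᶠ p : Hamiltonian I M × M in 𝓝 (H, x), ∀ u ∈ sphere (0 : E) 1,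
      dHam p.1 p.2 (ofCoord I x (extChartAt I x p.2) u) = 0 →
      gForm g p.2 (ofCoord I x (extChartAt I x p.2) u) (hamVF σ p.1 p.2) = 0 →
      2 * transSeminorm σ g p.1 p.2 (ofCoord I x (extChartAt I x p.2) u)
        ≤ max (transSeminorm σ g p.1 (hamFlow σ p.1 T p.2)
          (flowD σ p.1 T p.2 (ofCoord I x (extChartAt I x p.2) u)))
        (transSeminorm σ g p.1 (hamFlow σ p.1 (-T) p.2)
          (flowD σ p.1 (-T) p.2 (ofCoord I x (extChartAt I x p.2) u))) := by
    refine (isCompact_sphere (0 : E) 1).eventually_forall_of_forall_eventually fun u hu => ?_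
    set w := ofCoord I x (extChartAt I x x) u with hw
    have hw0 : w ≠ 0 := fun h0 => by
      have : u = 0 := by rw [← toCoord_ofCoord' hd u, ← hw, h0, map_zero]
      rw [this] at hu
      simp at hu
    have hc := continuousAt_ofCoord_prod (H := H) hd u
    have c1 := (continuousAt_dHam H hxI w).comp_of_eq hc rfl
    have c2 := (continuousAt_gForm_hamVF (σ := σ) (g := g) H hxI w).comp_of_eq hc rfl
    by_cases h1 : dHam H x w = 0
    · by_cases h2 : gForm g x w (hamVF σ H x) = 0
      · have c3 := (continuousAt_transSeminorm (σ := σ) (g := g) hxI h w).comp_of_eq hc rfl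
        have c4 := (continuousAt_transSeminorm_flowMap (σ := σ) (g := g) hx h T w).comp_of_eq hc rfl
        have c5 := (continuousAt_transSeminorm_flowMap (σ := σ) (g := g) hx h (-T) w).comp_of_eq
          hc rfl
        have hpos : 0 < transSeminorm σ g H x w := by
          have h3 := (isInnerForm_gForm g x).orthSeminorm_of_orthogonal h2
          have h4 := (isInnerForm_gForm g x).seminorm_pos hw0
          rwa [← h3] at h4
        have hlt : 2 * transSeminorm σ g H x w
            < max (transSeminorm σ g H (hamFlow σ H T x) (flowD σ H T x w))
              (transSeminorm σ g H (hamFlow σ H (-T) x) (flowD σ H (-T) x w)) :=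
          lt_of_lt_of_le (by linarith) (hT w h1)
        exact ((continuousAt_const.mul c3).eventually_lt (c4.max c5) hlt).mono
          fun r hr _ _ => hr.le
      · exact (c2.eventually_ne h2).mono fun r hr _ h0 => absurd h0 hr
    · exact (c1.eventually_ne h1).mono fun r hr h0 => absurd h0 hr
  have hdom : ∀ᶠ p : Hamiltonian I M × M in 𝓝 (H, x), p.2 ∈ chartDomain I x :=
    continuousAt_snd ((isOpen_chartDomain x).mem_nhds hd)
  filter_upwards [key, hdom, eventually_energySurface_subset_interior hx,
    eventually_dHam_ne_zero hxI h] with p hp hpd hpx hpne w hw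
  set β := gForm g p.2
  have hβ : IsInnerForm β := isInnerForm_gForm g p.2
  set X : E := hamVF σ p.1 p.2 with hX
  have hX0 : X ≠ 0 := hamVF_ne_zero hpne
  set w' := orthPart β X w with hw'
  set c := β w X / β X X with hc
  have hww' : w = w' + c • X := by rw [hw', orthPart_apply, sub_add_cancel]
  have hw'ker : dHamLin p.1 p.2 w' = 0 := by
    have h1 : dHamLin p.1 p.2 X = 0 := dHam_hamVF σ p.1 p.2
    rw [hww', map_add, map_smul, h1, smul_zero, add_zero] at hw
    exact hw
  have e1 : transSeminorm σ g p.1 p.2 w = transSeminorm σ g p.1 p.2 w' := by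
    rw [hww']
    exact hβ.orthSeminorm_add_smul hX0 _ _
  rw [e1, hww', transSeminorm_flowD_add_smul hpx hpne hX,
    transSeminorm_flowD_add_smul hpx hpne hX]
  by_cases h0 : w' = 0
  · simp [h0]
  · obtain ⟨s, hs, u, hu, hsu⟩ := exists_smul_ofCoord hpd h0
    have horth : β w' X = 0 := hβ.apply_orthPart hX0 w
    set z := ofCoord I x (extChartAt I x p.2) u
    have h1 : dHam p.1 p.2 z = 0 := by
      have h2 : dHamLin p.1 p.2 z = 0 := by
        rw [hsu, map_smul] at hw'ker
        exact (smul_eq_zero.1 hw'ker).resolve_left hs.ne'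
      exact h2
    have h2 : β z X = 0 := by
      rw [hsu, map_smul, smul_apply] at horth
      exact (smul_eq_zero.1 horth).resolve_left hs.ne'
    have h3 := mul_le_mul_of_nonneg_left (hp u hu h1 h2) hs.le
    rw [mul_max_of_nonneg _ _ hs.le] at h3
    rw [hsu]
    simp only [map_smul, map_smul_eq_mul, Real.norm_of_nonneg hs.le]
    linarith

omit [FiniteDimensional ℝ E] [CompactSpace M] [T2Space M] in
/-- Near a regular point in the interior, nearby energy values are taken by nearby Hamiltonians. -/
theorem exists_eventually_exists_eq (hx : x ∈ I.interior M) (h : dHam H x ≠ 0) {N : Set M}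
    (hN : N ∈ 𝓝 x) : ∃ δ > 0, ∀ᶠ H' in 𝓝 H, ∀ e' ∈ Ioo (H x - δ) (H x + δ), ∃ x' ∈ N,
      (H' : Hamiltonian I M) x' = e' := by
  have hd := self_mem_chartDomain hx
  set y₀ := extChartAt I x x with hy₀
  have hsymm : (extChartAt I x).symm y₀ = x := chart_symm_chart hd
  obtain ⟨r, hr, hrU⟩ := Metric.mem_nhds_iff.1 (inter_mem ((isOpen_chartInterior x).mem_nhds hd.2)
    ((continuousAt_chart_symm hd.2).preimage_mem_nhds (by rwa [hsymm])))
  have hfd : fderiv ℝ (coordHam H x) y₀ ≠ 0 := by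
    intro h0
    refine h (ContinuousLinearMap.ext fun v => ?_)
    rw [← dHam_toCoord H hd v, ← hy₀, h0]
    rfl
  have hval : coordHam H x y₀ = H x := by rw [coordHam, hsymm]
  -- `x` is neither a local minimum nor a local maximum
  obtain ⟨y₁, hy₁, h1⟩ : ∃ y₁ ∈ ball y₀ r, coordHam H x y₁ < H x := by
    by_contra! hcon
    refine hfd (IsLocalMin.fderiv_eq_zero ?_)
    filter_upwards [ball_mem_nhds y₀ hr] with y hy
    rw [hval]
    exact hcon y hy
  obtain ⟨y₂, hy₂, h2⟩ : ∃ y₂ ∈ ball y₀ r, H x < coordHam H x y₂ := by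
    by_contra! hcon
    refine hfd (IsLocalMax.fderiv_eq_zero ?_)
    filter_upwards [ball_mem_nhds y₀ hr] with y hy
    rw [hval]
    exact hcon y hy
  set δ := min (H x - coordHam H x y₁) (coordHam H x y₂ - H x) / 2 with hδ
  have hδ0 : 0 < δ := half_pos (lt_min (sub_pos.2 h1) (sub_pos.2 h2))
  have hδ1 : 2 * δ ≤ H x - coordHam H x y₁ := by
    rw [hδ, mul_div_cancel₀ _ two_ne_zero]; exact min_le_left _ _
  have hδ2 : 2 * δ ≤ coordHam H x y₂ - H x := by
    rw [hδ, mul_div_cancel₀ _ two_ne_zero]; exact min_le_right _ _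
  have hclose := eventually_c2_close H (K := {y₁, y₂}) (x₀ := x)
    ((Set.finite_singleton y₂).insert y₁).isCompact (by
      rintro _ (rfl | rfl)
      · exact (hrU hy₁).1
      · exact (hrU hy₂).1) hδ0
  refine ⟨δ, hδ0, hclose.mono fun H' hH' e' he' => ?_⟩
  have k1 := (abs_lt.1 (hH' y₁ (by simp)).1).2
  have k2 := (abs_lt.1 (hH' y₂ (by simp)).1).1
  obtain ⟨y, hy, hye⟩ := (convex_ball y₀ r).isPreconnected.intermediate_value hy₁ hy₂
    (f := coordHam H' x) (fun y hy =>
      (contDiffAt_coordHam H' (hrU hy).1).continuousAt.continuousWithinAt)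
    (show e' ∈ Icc _ _ from ⟨by linarith [he'.1], by linarith [he'.2]⟩)
  exact ⟨_, (hrU hy).2, hye⟩

end Openness

/-! ### Hyperbolicity in terms of transverse expansion -/

section Hyperbolicity

open Set Filter Metric

variable {E : Type*} [NormedAddCommGroup E] [NormedSpace ℝ E]
  {B : Type*} [TopologicalSpace B] {I : ModelWithCorners ℝ E B}
  {M : Type*} [TopologicalSpace M] [ChartedSpace B M] [FiniteDimensional ℝ E] [IsManifold I ∞ M]
  [CompactSpace M] [T2Space M] {σ : SymplecticForm I M}
  {g : Bundle.ContMDiffRiemannianMetric I ∞ E (TangentSpace I : M → Type _)}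
  {H : Hamiltonian I M} {x : M}

/-- A hyperbolic energy surface is transversally expanding, uniformly in the base point, by a factor
with room to spare over the factor `2` that is sufficient for hyperbolicity. -/
theorem exists_expandsTransversally_of_isHyperbolicSet (hx : energySurface H x ⊆ I.interior M)
    (h : IsHyperbolicSet σ g H (energySurface H x)) :
    ∃ T : ℕ, 0 < T ∧ ∀ y ∈ energySurface H x, ExpandsTransversally σ g H T 3 y := by
  obtain ⟨-, -, hne, m, θ, Em, Ep, hm, hθ, hθ1, hsplit⟩ := h
  obtain ⟨T, hT, hexp⟩ := (isEnergyCocycle (σ := σ) (g := g) hx hne).exists_expansion hm hθ hθ1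
    (Em := Em) (Ep := Ep)
    (fun t y hy v hv => ((hsplit y hy).2.2.1 t).1.le (Submodule.mem_map_of_mem hv))
    (fun t y hy v hv => ((hsplit y hy).2.2.1 t).2.le (Submodule.mem_map_of_mem hv))
    (fun y hy v hv => (hsplit y hy).2.2.2.1 v hv)
    (fun y hy v hv => (hsplit y hy).2.2.2.2 v hv)
    (fun y hy => (hsplit y hy).2.1)
  exact ⟨T, hT, fun y hy w hw => hexp y hy w hw⟩

/-- Transverse expansion by the factor `2` on a regular energy surface implies hyperbolicity. -/
theorem isHyperbolicSet_of_expandsTransversally {d : ℕ} (hdim : Module.finrank ℝ E = 2 * d)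
    (hx : energySurface H x ⊆ I.interior M) (hne : ∀ y ∈ energySurface H x, dHam H y ≠ 0)
    {T : ℕ} (hT : 0 < T) (hexp : ∀ y ∈ energySurface H x, ExpandsTransversally σ g H T 2 y) :
    IsHyperbolicSet σ g H (energySurface H x) := by
  have hgood : ∀ y ∈ energySurface H x, energySurface H y ⊆ I.interior M := fun y hy => by
    rwa [energySurface_eq hy]
  have hcpt := isCompact_energySurface H x
  obtain ⟨c, hc, C, hC, hJ⟩ := exists_bounds_compatMap hcpt hx σ g H
  let toBilin : (E →L[ℝ] E →L[ℝ] ℝ) → E →ₗ[ℝ] E →ₗ[ℝ] ℝ := fun β =>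
    (ContinuousLinearMap.coeLM ℝ).comp (β : E →ₗ[ℝ] E →L[ℝ] ℝ)
  obtain ⟨m, Em, Ep, hm, hsplit⟩ :=
    (isEnergyCocycle (σ := σ) (g := g) hx hne).exists_hyperbolic_splitting hT
      (fun y hy w hw => hexp y hy w hw) hdim
      (Ω := fun y => toBilin (σ.form y)) (g := fun y => toBilin (gForm g y))
      (J := fun y => (compatMap σ g y : E →ₗ[ℝ] E))
      (fun y hy h0 => hne y hy (ContinuousLinearMap.ext fun v => LinearMap.congr_fun h0 v))
      (fun y hy => (isInnerForm_gForm g y).continuous_orthSeminorm _)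
      (fun t y hy v w => form_flowD (hgood y hy) t v w)
      (fun y hy v => form_hamVF σ H y v)
      (fun y hy v w => σ.skew y v w)
      (fun y hy v => ((isInnerForm_gForm g y).seminorm_sq v).symm)
      (fun y hy v w => (isInnerForm_gForm g y).abs_apply_le v w)
      (fun y hy v w => gForm_compatMap y v w) hc hC
      (fun y hy v => (hJ y hy v).1) (fun y hy v => (hJ y hy v).2)
  refine ⟨hcpt, hamFlow_image_energySurface hx, hne, m, 1 / 2, Em, Ep, hm, by norm_num,
    by norm_num, fun y hy => hsplit y hy⟩

end Hyperbolicity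

/-! ### Stability of the Anosov property -/

section Main

open Set Filter

variable {E : Type*} [NormedAddCommGroup E] [NormedSpace ℝ E] [FiniteDimensional ℝ E]
  {B : Type*} [TopologicalSpace B] {I : ModelWithCorners ℝ E B}
  {M : Type*} [TopologicalSpace M] [ChartedSpace B M] [IsManifold I ∞ M]
  [CompactSpace M] [T2Space M]

/-- The Anosov property is stable under perturbation of the Hamiltonian and of the energy. -/
theorem IsAnosov.exists_nhds {d : ℕ} (hdim : Module.finrank ℝ E = 2 * d) {σ : SymplecticForm I M}
    {g : Bundle.ContMDiffRiemannianMetric I ∞ E (TangentSpace I : M → Type _)}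
    {H : Hamiltonian I M} {e : ℝ} (h : IsAnosov σ g H e) :
    ∃ V : Set (Hamiltonian I M), IsOpen V ∧ H ∈ V ∧ ∃ δ : ℝ, 0 < δ ∧
      ∀ H' ∈ V, ∀ e' ∈ Ioo (e - δ) (e + δ), IsAnosov σ g H' e' := by
  obtain ⟨x, rfl, hx, hhyp⟩ := h
  have hne := hhyp.2.2.1
  obtain ⟨T, hT, hexp⟩ := exists_expandsTransversally_of_isHyperbolicSet hx hhyp
  have hgood : ∀ y ∈ energySurface H x, energySurface H y ⊆ I.interior M := fun y hy => by
    rwa [energySurface_eq hy]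
  set U : Set (Hamiltonian I M × M) := {p | p.2 ∈ I.interior M ∧ dHam p.1 p.2 ≠ 0 ∧
    ExpandsTransversally σ g p.1 T 2 p.2} with hU
  have hsub : ({H} : Set (Hamiltonian I M)) ×ˢ energySurface H x ⊆ interior U := by
    rintro ⟨H', y⟩ ⟨rfl, hy⟩
    rw [mem_interior_iff_mem_nhds]
    have h1 : ∀ᶠ p : Hamiltonian I M × M in 𝓝 (H', y), p.2 ∈ I.interior M :=
      continuousAt_snd ((ModelWithCorners.isOpen_interior (n := 1) one_ne_zero).mem_nhds (hx hy))
    filter_upwards [h1, eventually_dHam_ne_zero (hx hy) (hne y hy),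
      eventually_expandsTransversally (hgood y hy) (hne y hy) (hexp y hy)] with p h1 h2 h3
      using ⟨h1, h2, h3⟩
  obtain ⟨V₁, W, hV₁, hW, hHV₁, hΛW, hVW⟩ := generalized_tube_lemma isCompact_singleton
    (isCompact_energySurface H x) isOpen_interior hsub
  have hHV₁' : H ∈ V₁ := hHV₁ rfl
  have hVW' : ∀ H' ∈ V₁, ∀ y ∈ W, y ∈ I.interior M ∧ dHam H' y ≠ 0 ∧
      ExpandsTransversally σ g H' T 2 y := fun H' hH' y hy =>
    (interior_subset (hVW ⟨hH', hy⟩) : (H', y) ∈ U)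
  have hWI : W ⊆ I.interior M := fun y hy => (hVW' H hHV₁' y hy).1
  have hxΛ := mem_energySurface_self H x
  have hnear := eventually_energySurface_subset hW hWI hΛW
  rw [nhds_prod_eq] at hnear
  obtain ⟨P, hP, Q, hQ, hPQ⟩ := eventually_prod_iff.1 hnear
  obtain ⟨δ, hδ, hev⟩ := exists_eventually_exists_eq (hx hxΛ) (hne x hxΛ) hQ
  obtain ⟨V, hVsub, hV, hHV⟩ := mem_nhds_iff.1
    (inter_mem (inter_mem (hV₁.mem_nhds hHV₁') hP) hev)
  refine ⟨V, hV, hHV, δ, hδ, fun H' hH' e' he' => ?_⟩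
  obtain ⟨⟨hH'V₁, hH'P⟩, hH'⟩ := hVsub hH'
  obtain ⟨x', hx'Q, hx'e⟩ := hH' e' he'
  have hsurf : energySurface H' x' ⊆ W := hPQ hH'P hx'Q
  exact ⟨x', hx'e, hsurf.trans hWI, isHyperbolicSet_of_expandsTransversally hdim
    (hsurf.trans hWI) (fun y hy => (hVW' H' hH'V₁ y (hsurf hy)).2.1) hT
    (fun y hy => (hVW' H' hH'V₁ y (hsurf hy)).2.2)⟩

theorem isOpen_anosovLevels {d : ℕ} (hdim : Module.finrank ℝ E = 2 * d) (σ : SymplecticForm I M)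
    (g : Bundle.ContMDiffRiemannianMetric I ∞ E (TangentSpace I : M → Type _)) :
    IsOpen (anosovLevels σ g) := by
  rw [isOpen_iff_mem_nhds]
  intro p hp
  obtain ⟨V, hV, hHV, δ, hδ, h⟩ := IsAnosov.exists_nhds hdim hp
  have h1 : V ×ˢ Ioo (p.1.2 - δ) (p.1.2 + δ) ∈ 𝓝 p.1 :=
    prod_mem_nhds (hV.mem_nhds hHV) (Ioo_mem_nhds (by linarith) (by linarith))
  filter_upwards [continuous_subtype_val.continuousAt.preimage_mem_nhds h1] with q hq
  exact h _ hq.1 _ hq.2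

end Main

end HamiltonianLevels

end

open HamiltonianLevels in
theorem mainTheorem4
    {E : Type*} [NormedAddCommGroup E] [NormedSpace ℝ E] [FiniteDimensional ℝ E]
    {B : Type*} [TopologicalSpace B] (I : ModelWithCorners ℝ E B)
    (M : Type*) [TopologicalSpace M] [ChartedSpace B M] [IsManifold I ∞ M]
    [CompactSpace M] [T2Space M]
    (d : ℕ) (hd : 2 ≤ d) (hdim : Module.finrank ℝ E = 2 * d)
    (σ : SymplecticForm I M)
    (g : Bundle.ContMDiffRiemannianMetric I ∞ E (TangentSpace I : M → Type _)) :
    IsOpen (anosovLevels σ g) ∧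
    ∀ (H : Hamiltonian I M) (e : ℝ), IsAnosov σ g H e →
      ∃ V : Set (Hamiltonian I M), IsOpen V ∧ H ∈ V ∧ ∃ δ : ℝ, 0 < δ ∧
        ∀ H' ∈ V, ∀ e' ∈ Set.Ioo (e - δ) (e + δ), IsAnosov σ g H' e' := by
  exact ⟨isOpen_anosovLevels hdim σ g, fun _ _ h => h.exists_nhds hdim⟩
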